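/- Let $n\ge 0$ be an integer, let $1<p<\infty$ and let $K\subset\mathbb R^n$ be a compact set which is regular, that is: $K$ is (non-empty and) connected, and each boundary point $x_0\in\partial K$ has a neighbourhood $V$ together with a Cartesian coordinate system $(x',x_n)$ and a continuous function $A$ of $x'\in\mathbb R^{n-1}$ such that, in $V$, the boundary $\partial K$ coincides with the graph $\{x_n=A(x')\}$ and $K$ coincides with $\{x_n\ge A(x')\}$. Assume that $K$ is a fundamental domain for $2\pi\mathbb Z^n$: the translates $K+2\pi k$, $k\in\mathbb Z^n$, are pairwise disjoint up to sets of Lebesgue measure zero, and their union is $\mathbb R^n$ up to a set of measure zero. Write $\hat f(\xi)=\int_{\mathbb R^n}e^{-ix\cdot\xi}f(x)\,dx$ for the Fourier transform (in the sense of Plancherel on $L^2$, and in the sense of tempered distributions in general), and let $E^p_K=\{f\in L^p(\mathbb R^n):\operatorname{supp}\hat f\subset K\}$, where complex-valued functions are meant. Each $f\in E^p_K$ is identified with its continuous representative, so that $f(k)$ makes sense for $k\in\mathbb Z^n$; let $S^p f=(f(k))_{k\in\mathbb Z^n}$. Then the following four properties are equivalent. (a) The indicator function $\chi_K$ is a multiplier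 of $\mathcal FL^p$: there is a constant $C$ such that for every $f\in L^2\cap L^p$ the function $\chi_K\hat f$ is the Fourier transform of a function $g\in L^2\cap L^p$ with $\|g\|_p\le C\|f\|_p$. (b) $\mathbb Z^n$ is a set of stable sampling for $E^p_K$: there is a constant $C$ such that $\|f\|_p^p\le C\sum_{k\in\mathbb Z^n}|f(k)|^p$ for all $f\in E^p_K$. (c) $\mathbb Z^n$ is a set of stable interpolation for $E^p_K$: for every $a\in\ell^p(\mathbb Z^n)$ there is $f\in E^p_K$ with $f(k)=a(k)$ for all $k\in\mathbb Z^n$. (d) The operator $S^p:E^p_K\to\ell^p(\mathbb Z^n)$ is an isomorphism, that is, a well-defined bounded linear bijection with bounded inverse. -/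

import Mathlib

open MeasureTheory FourierTransform SchwartzMap
open scoped ENNReal NNReal Pointwise Topology RealInnerProductSpace

noncomputable section

namespace BandLimited

/-- The Euclidean space `ℝⁿ`. -/
abbrev Rn (n : ℕ) : Type := EuclideanSpace ℝ (Fin n)

/-- The lattice `ℤⁿ ⊂ ℝⁿ`. -/
def intLattice (n : ℕ) : AddSubgroup (Rn n) where
  carrier := {x | ∀ i, ∃ m : ℤ, x i = m}
  zero_mem' := fun _ => ⟨0, by simp⟩
  add_mem' := by
    intro x y hx hy i
    obtain ⟨a, ha⟩ := hx i
    obtain ⟨b, hb⟩ := hy i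
    exact ⟨a + b, by simp [ha, hb]⟩
  neg_mem' := by
    intro x hx i
    obtain ⟨a, ha⟩ := hx i
    exact ⟨-a, by simp [ha]⟩

/-- The lattice `2πℤⁿ ⊂ ℝⁿ`. -/
def twoPiLattice (n : ℕ) : AddSubgroup (Rn n) := (2 * Real.pi) • intLattice n

/-- A regular compact set: it is connected and, near each point `x₀` of its boundary, there are
Cartesian coordinates (the last axis is directed by the unit vector `v`, and the other coordinates
of `x` are those of its orthogonal projection `x'` on the hyperplane orthogonal to `v`) and a
continuous function `A` of `x'` such that the boundary coincides with the graph `xₙ = A x'` and the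
set coincides with the region `xₙ ≥ A x'`. -/
structure IsRegularCompact {n : ℕ} (K : Set (Rn n)) : Prop where
  isCompact : IsCompact K
  isConnected : IsConnected K
  graph : ∀ x₀ ∈ frontier K, ∃ V ∈ 𝓝 x₀, ∃ v : Rn n, ‖v‖ = 1 ∧
    ∃ A : (ℝ ∙ v)ᗮ → ℝ, Continuous A ∧ ∀ x ∈ V,
      (x ∈ frontier K ↔ ⟪v, x⟫ = A ((ℝ ∙ v)ᗮ.orthogonalProjectionOnto x)) ∧
      (x ∈ K ↔ A ((ℝ ∙ v)ᗮ.orthogonalProjectionOnto x) ≤ ⟪v, x⟫)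

/-- The dilation `x ↦ x / (2π)` as a linear isomorphism of `ℝⁿ`. -/
def dilation (n : ℕ) : Rn n ≃L[ℝ] Rn n :=
  ContinuousLinearEquiv.smulLeft (Units.mk0 (2 * Real.pi)⁻¹ (inv_ne_zero Real.two_pi_pos.ne'))

theorem dilation_apply {n : ℕ} (x : Rn n) : dilation n x = (2 * Real.pi)⁻¹ • x := rfl

/-- The Fourier transform `φ̂(ξ) = ∫ exp(-i x·ξ) φ(x) dx` on the Schwartz class, obtained from
Mathlib's transform `𝓕 φ (ξ) = ∫ exp(-2πi x·ξ) φ(x) dx` by a dilation. -/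
def schwartzFourier {n : ℕ} (φ : 𝓢(Rn n, ℂ)) : 𝓢(Rn n, ℂ) :=
  SchwartzMap.compCLMOfContinuousLinearEquiv ℂ (dilation n) (𝓕 φ)

theorem schwartzFourier_apply {n : ℕ} (φ : 𝓢(Rn n, ℂ)) (ξ : Rn n) :
    schwartzFourier φ ξ = ∫ x, Complex.exp (-Complex.I * (⟪x, ξ⟫ : ℝ)) * φ x := by
  have h : schwartzFourier φ ξ = 𝓕 (φ : Rn n → ℂ) ((2 * Real.pi)⁻¹ • ξ) := by
    rw [← SchwartzMap.fourier_coe]; rfl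
  rw [h, Real.fourier_eq']
  congr 1
  ext x
  rw [smul_eq_mul, real_inner_smul_right]
  congr 2
  have : (Real.pi : ℂ) ≠ 0 := by exact_mod_cast Real.pi_ne_zero
  push_cast
  field_simp

/-- The Fourier transform `û` of a tempered distribution `u`, as a functional on test functions:
`⟨û, φ⟩ = ⟨u, φ̂⟩`. -/
def distributionFourier {n : ℕ} (u : 𝓢'(Rn n, ℂ)) : 𝓢(Rn n, ℂ) → ℂ :=
  fun φ => u (schwartzFourier φ)

theorem dsupport_distributionFourier_add {n : ℕ} (u v : 𝓢'(Rn n, ℂ)) :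
    Distribution.dsupport (distributionFourier (u + v)) ⊆
      Distribution.dsupport (distributionFourier u) ∪
        Distribution.dsupport (distributionFourier v) := by
  intro x hx
  by_contra hn
  rw [Set.mem_union, not_or, Distribution.notMem_dsupport_iff,
    Distribution.notMem_dsupport_iff] at hn
  obtain ⟨⟨s, hs, hso, hxs⟩, ⟨t, ht, hto, hxt⟩⟩ := hn
  refine (Distribution.notMem_dsupport_iff x).2 ⟨s ∩ t, ?_, hso.inter hto, hxs, hxt⟩ hx
  intro φ hφ
  have h1 : u (schwartzFourier φ) = 0 := hs φ (hφ.trans Set.inter_subset_left)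
  have h2 : v (schwartzFourier φ) = 0 := ht φ (hφ.trans Set.inter_subset_right)
  change u (schwartzFourier φ) + v (schwartzFourier φ) = 0
  rw [h1, h2, add_zero]

theorem dsupport_distributionFourier_smul {n : ℕ} (c : ℂ) (u : 𝓢'(Rn n, ℂ)) :
    Distribution.dsupport (distributionFourier (c • u)) ⊆
      Distribution.dsupport (distributionFourier u) := by
  intro x hx
  by_contra hn
  obtain ⟨s, hs, hso, hxs⟩ := (Distribution.notMem_dsupport_iff x).1 hn
  refine (Distribution.notMem_dsupport_iff x).2 ⟨s, ?_, hso, hxs⟩ hx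
  intro φ hφ
  have h1 : u (schwartzFourier φ) = 0 := hs φ hφ
  change c • u (schwartzFourier φ) = 0
  rw [h1, smul_zero]

/-- The space `E^p_K` of all `f ∈ L^p(ℝⁿ)` whose distributional Fourier transform is supported
by `K`, as a subspace of `L^p(ℝⁿ)`. -/
def bandLimited {n : ℕ} (K : Set (Rn n)) (p : ℝ≥0∞) [Fact (1 ≤ p)] :
    Submodule ℂ (Lp ℂ p (volume : Measure (Rn n))) where
  carrier := {f | Distribution.dsupport (distributionFourier (f : 𝓢'(Rn n, ℂ))) ⊆ K}
  zero_mem' := by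
    intro x hx
    refine absurd hx ((Distribution.notMem_dsupport_iff x).2
      ⟨Set.univ, fun φ _ => ?_, isOpen_univ, trivial⟩)
    have h : Lp.toTemperedDistributionCLM ℂ (volume : Measure (Rn n)) p 0 = 0 := map_zero _
    change Lp.toTemperedDistributionCLM ℂ (volume : Measure (Rn n)) p 0 (schwartzFourier φ) = 0
    rw [h]
    rfl
  add_mem' := by
    intro f g hf hg
    have h := map_add (Lp.toTemperedDistributionCLM ℂ (volume : Measure (Rn n)) p) f g
    change Distribution.dsupport (distributionFourier
      (Lp.toTemperedDistributionCLM ℂ (volume : Measure (Rn n)) p (f + g))) ⊆ K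
    rw [h]
    exact (dsupport_distributionFourier_add _ _).trans (Set.union_subset hf hg)
  smul_mem' := by
    intro c f hf
    have h := map_smul (Lp.toTemperedDistributionCLM ℂ (volume : Measure (Rn n)) p) c f
    change Distribution.dsupport (distributionFourier
      (Lp.toTemperedDistributionCLM ℂ (volume : Measure (Rn n)) p (c • f))) ⊆ K
    rw [h]
    exact (dsupport_distributionFourier_smul _ _).trans hf

theorem mem_bandLimited {n : ℕ} {K : Set (Rn n)} {p : ℝ≥0∞} [Fact (1 ≤ p)]
    {f : Lp ℂ p (volume : Measure (Rn n))} :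
    f ∈ bandLimited K p ↔
      Distribution.dsupport (distributionFourier (f : 𝓢'(Rn n, ℂ))) ⊆ K :=
  Iff.rfl

open Classical in
/-- The continuous function that represents the class `f` (and `0` if `f` has no continuous
representative, which never happens for `f ∈ E^p_K` with `K` compact). The values `f(x)` of a
function `f ∈ E^p_K` are those of its continuous representative. -/
def contRep {n : ℕ} {p : ℝ≥0∞} (f : Lp ℂ p (volume : Measure (Rn n))) : Rn n → ℂ :=
  if h : ∃ g : Rn n → ℂ, Continuous g ∧ f =ᵐ[volume] g then h.choose else 0

theorem contRep_eq {n : ℕ} {p : ℝ≥0∞} {f : Lp ℂ p (volume : Measure (Rn n))} {g : Rn n → ℂ}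
    (hg : Continuous g) (hfg : f =ᵐ[volume] g) : contRep f = g := by
  have h : ∃ g : Rn n → ℂ, Continuous g ∧ f =ᵐ[volume] g := ⟨g, hg, hfg⟩
  have hc : contRep f = h.choose := dif_pos h
  rw [hc]
  exact (h.choose_spec.1.ae_eq_iff_eq volume hg).1 (h.choose_spec.2.symm.trans hfg)

/-- `Γ` is a set of stable sampling for `E^p_K`: there is a constant `C` such that
`‖f‖_p^p ≤ C ∑_{γ ∈ Γ} |f(γ)|^p` for all `f ∈ E^p_K`. -/
def IsStableSampling {n : ℕ} (Γ K : Set (Rn n)) (p : ℝ≥0∞) [Fact (1 ≤ p)] : Prop :=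
  ∃ C : ℝ≥0, ∀ f ∈ bandLimited K p,
    ‖f‖ₑ ^ p.toReal ≤ C * ∑' γ : Γ, ‖contRep f γ‖ₑ ^ p.toReal

/-- `Γ` is a set of stable interpolation for `E^p_K`: every sequence `a ∈ ℓ^p(Γ)` is interpolated
on `Γ` by some `f ∈ E^p_K`. -/
def IsStableInterpolation {n : ℕ} (Γ K : Set (Rn n)) (p : ℝ≥0∞) [Fact (1 ≤ p)] : Prop :=
  ∀ a : lp (fun _ : Γ => ℂ) p, ∃ f ∈ bandLimited K p, ∀ γ : Γ, contRep f γ = a γ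

/-- The sampling operator `f ↦ (f(γ))_{γ ∈ Γ}` is (well defined and) an isomorphism of the normed
space `E^p_K` onto `ℓ^p(Γ)`. -/
def SamplingIsIsomorphism {n : ℕ} (Γ K : Set (Rn n)) (p : ℝ≥0∞) [Fact (1 ≤ p)] : Prop :=
  ∃ S : bandLimited K p ≃L[ℂ] lp (fun _ : Γ => ℂ) p,
    ∀ (f : bandLimited K p) (γ : Γ), S f γ = contRep (f : Lp ℂ p (volume : Measure (Rn n))) (γ : Rn n)

/-- The Fourier transform `f̂(ξ) = ∫ exp(-i x·ξ) f(x) dx` on `L²(ℝⁿ)`, obtained from Mathlib's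
Plancherel transform (with the kernel `exp(-2πi x·ξ)`) by a dilation. -/
def l2Fourier {n : ℕ} (f : Lp ℂ 2 (volume : Measure (Rn n))) : Rn n → ℂ :=
  fun ξ => (𝓕 f : Lp ℂ 2 (volume : Measure (Rn n))) ((2 * Real.pi)⁻¹ • ξ)

/-- The Borel function `m` is a multiplier of `𝓕L^p`: there is a constant `C` such that for
all `f ∈ L² ∩ L^p` the function `m f̂` is the Fourier transform of some `g ∈ L² ∩ L^p` with
`‖g‖_p ≤ C ‖f‖_p`. -/
def IsFLpMultiplier {n : ℕ} (m : Rn n → ℂ) (p : ℝ≥0∞) : Prop :=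
  Measurable m ∧ ∃ C : ℝ≥0, ∀ f : Lp ℂ 2 (volume : Measure (Rn n)), MemLp f p volume →
    ∃ g : Lp ℂ 2 (volume : Measure (Rn n)),
      l2Fourier g =ᵐ[volume] (fun ξ => m ξ * l2Fourier f ξ) ∧
      MemLp g p volume ∧ eLpNorm g p volume ≤ C * eLpNorm f p volume

end BandLimited

end

/-! After rescaling by 2π, `D = normalize K` is a compact fundamental domain for ℤⁿ. Let `h = ker D`
be the inverse Fourier transform of its indicator function, so that h(0) = 1 and h vanishes at the
other integer points. Each of the four properties is tied to a single inequality, `KerBound`: ‖∑ aₖ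
h(· - k)‖_p^p ≤ C ∑ |aₖ|^p for finitely supported a.

Multiplier and `KerBound`. The multiplier sends ∑ aₖ θ(· - k) to ∑ aₖ h(· - k) when θ is a Schwartz
function with θ̂ = 1 near D, and Schur's test bounds the former by ‖a‖_p
(`KerBound.of_multiplierBound`). Conversely the multiplier operator is convolution with h, which is
an average over y in the unit cube of the sums ∑ g(k + y) h(x - y - k); Jensen's inequality and a
limiting argument conclude (`KerBound.lintegral_op_le`, `MultiplierBound.of_kerBound`).

`KerBound` gives the isomorphism. Boundedness of sampling is the Plancherel–Pólya inequality. The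
series ∑ aₖ h(· - k) converges and interpolates a. For injectivity, a function vanishing on ℤⁿ has,
by Poisson summation, its spectrum in ∂D (`SpectralDomain.fVanishOn_compl_frontier`). A test
function near a boundary point is then split into its parts inside and outside D; each part can be
pushed off ∂D by a small translation, because ∂D is locally a graph. `KerBound` makes the two
pairings separately convergent (`KerBound.ae_eq_zero`).

Sampling or interpolation gives `KerBound`. The kernel h is the limit of Riemann sums h_N (`latKer`)
with nodes in a shifted grid s + N⁻¹ℤⁿ that avoids ∂D. Since D is a fundamental domain, the nodes in
D run once through a finite group, so h_N vanishes on ℤⁿ \ Nℤⁿ, and |h_N| is periodic under Nℤⁿ.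
Multiplying G_N = ∑ aₖ h_N(· - k) by a slowly varying factor φ(δ·), with φ̂ of compact support,
gives a member f of E^p_K whose integer samples are under control. Stable sampling bounds f
directly. Stable interpolation supplies g with the same samples and controlled norm; f - g has
spectrum in ∂D, hence away from the nodes, and Poisson summation recovers G_N from g. In both cases
the dependence on δN cancels, and Fatou's lemma as N → ∞ yields `KerBound`. -/

noncomputable section

namespace BandLimited

/-! ### Characters, Fourier integrals and integral inequalities -/

/-- The character `t ↦ exp(2πit)` with complex values. -/
def ec (t : ℝ) : ℂ := Complex.exp (2 * Real.pi * t * Complex.I)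

theorem ec_eq_fourierChar (t : ℝ) : ec t = (Real.fourierChar t : ℂ) := by
  rw [Real.fourierChar_apply, ec]
  push_cast
  rfl

theorem ec_add (s t : ℝ) : ec (s + t) = ec s * ec t := by
  rw [ec, ec, ec, ← Complex.exp_add]
  push_cast
  ring_nf

@[simp] theorem ec_zero : ec 0 = 1 := by simp [ec]

@[simp] theorem norm_ec (t : ℝ) : ‖ec t‖ = 1 := by
  rw [ec_eq_fourierChar]; exact Circle.norm_coe _

@[simp] theorem enorm_ec (t : ℝ) : ‖ec t‖ₑ = 1 := by
  rw [← ofReal_norm, norm_ec, ENNReal.ofReal_one]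

theorem ec_int (m : ℤ) : ec m = 1 := by
  rw [ec, Complex.exp_eq_one_iff]
  exact ⟨m, by push_cast; ring⟩

theorem ec_neg_mul (t : ℝ) : ec (-t) * ec t = 1 := by
  rw [← ec_add]; simp

theorem conj_ec (t : ℝ) : (starRingEnd ℂ) (ec t) = ec (-t) := by
  simp only [ec, ← Complex.exp_conj]
  congr 1
  simp only [map_mul, Complex.conj_ofReal, Complex.conj_I, map_ofNat]
  push_cast
  ring

@[fun_prop]
theorem continuous_ec : Continuous ec := by unfold ec; fun_prop

theorem fourier_eq_ec {n : ℕ} (f : Rn n → ℂ) (ξ : Rn n) :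
    𝓕 f ξ = ∫ x, ec (-⟪x, ξ⟫) * f x := by
  rw [Real.fourier_eq]
  simp only [Circle.smul_def, smul_eq_mul, ec_eq_fourierChar]

theorem fourierInv_eq_ec {n : ℕ} (f : Rn n → ℂ) (ξ : Rn n) :
    𝓕⁻ f ξ = ∫ x, ec ⟪x, ξ⟫ * f x := by
  rw [Real.fourierInv_eq]
  simp only [Circle.smul_def, smul_eq_mul, ec_eq_fourierChar]

theorem integrable_ec_mul {n : ℕ} {f : Rn n → ℂ} {μ : Measure (Rn n)} (hf : Integrable f μ)
    {g : Rn n → ℝ} (hg : Continuous g) : Integrable (fun x => ec (g x) * f x) μ :=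
  hf.bdd_mul (c := 1) (continuous_ec.comp hg).aestronglyMeasurable
    (Filter.Eventually.of_forall fun _ => (norm_ec _).le)

theorem integral_fourier_mul_flip {n : ℕ} {f g : Rn n → ℂ} (hf : Integrable f)
    (hg : Integrable g) : ∫ ξ, 𝓕 f ξ * g ξ = ∫ x, f x * 𝓕 g x := by
  have h := VectorFourier.integral_fourierIntegral_smul_eq_flip (μ := (volume : Measure (Rn n)))
    (ν := (volume : Measure (Rn n))) (L := innerₗ (Rn n)) Real.continuous_fourierChar
    (by exact continuous_inner) hf hg
  rw [flip_innerₗ] at h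
  exact h

/-- Jensen's inequality for the weight `k`. -/
theorem lintegral_mul_rpow_le {α : Type*} [MeasurableSpace α] {μ : Measure α} {q : ℝ} (hq : 1 < q)
    {f k : α → ℝ≥0∞} (hf : AEMeasurable f μ) (hk : AEMeasurable k μ) :
    (∫⁻ x, f x * k x ∂μ) ^ q ≤ (∫⁻ x, k x ∂μ) ^ (q - 1) * ∫⁻ x, f x ^ q * k x ∂μ := by
  obtain ⟨r, hr⟩ : ∃ r : ℝ, q.HolderConjugate r := ⟨_, Real.HolderConjugate.conjExponent hq⟩
  have hq0 : 0 < q := by linarith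
  have hr0 : 0 < r := hr.symm.pos
  -- Hölder's inequality for the factorization f k = (f k^(1/q)) · k^(1/r).
  have h1 := ENNReal.lintegral_mul_le_Lp_mul_Lq μ hr (f := fun x => f x * k x ^ (1 / q))
    (g := fun x => k x ^ (1 / r)) (hf.mul (hk.pow_const _)) (hk.pow_const _)
  have h2 : ∀ x, ((fun x => f x * k x ^ (1 / q)) * (fun x => k x ^ (1 / r))) x = f x * k x := by
    intro x
    simp only [Pi.mul_apply]
    rw [mul_assoc, ← ENNReal.rpow_add_of_nonneg _ _ (by positivity) (by positivity)]
    have : 1 / q + 1 / r = 1 := by simpa using hr.inv_add_inv_eq_one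
    rw [this, ENNReal.rpow_one]
  simp only [h2] at h1
  have h3 : ∀ x, (f x * k x ^ (1 / q)) ^ q = f x ^ q * k x := by
    intro x
    rw [ENNReal.mul_rpow_of_nonneg _ _ hq0.le, ← ENNReal.rpow_mul, one_div,
      inv_mul_cancel₀ hq0.ne', ENNReal.rpow_one]
  have h4 : ∀ x, (k x ^ (1 / r)) ^ r = k x := by
    intro x
    rw [← ENNReal.rpow_mul, one_div, inv_mul_cancel₀ hr0.ne', ENNReal.rpow_one]
  simp only [h3, h4] at h1
  calc (∫⁻ x, f x * k x ∂μ) ^ q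
      ≤ ((∫⁻ x, f x ^ q * k x ∂μ) ^ (1 / q) * (∫⁻ x, k x ∂μ) ^ (1 / r)) ^ q :=
        ENNReal.rpow_le_rpow h1 hq0.le
    _ = _ := by
        rw [ENNReal.mul_rpow_of_nonneg _ _ hq0.le, ← ENNReal.rpow_mul, ← ENNReal.rpow_mul,
          one_div, inv_mul_cancel₀ hq0.ne', ENNReal.rpow_one, mul_comm]
        congr 2
        have := hr.div_conj_eq_sub_one
        rw [← this]; ring

/-- Schur's test. -/
theorem lintegral_kernel_rpow_le {α β : Type*} [MeasurableSpace α] [MeasurableSpace β]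
    {μ : Measure α} {ν : Measure β} [SFinite μ] [SFinite ν] {q : ℝ} (hq : 1 < q)
    {f : β → ℝ≥0∞} (hf : AEMeasurable f ν) {k : α → β → ℝ≥0∞} (hk : Measurable k.uncurry)
    {A B : ℝ≥0∞} (hA : ∀ x, ∫⁻ y, k x y ∂ν ≤ A) (hB : ∀ y, ∫⁻ x, k x y ∂μ ≤ B) :
    ∫⁻ x, (∫⁻ y, f y * k x y ∂ν) ^ q ∂μ ≤ A ^ (q - 1) * B * ∫⁻ y, f y ^ q ∂ν := by
  have hkx : ∀ x, Measurable (k x) := fun x => hk.comp measurable_prodMk_left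
  have hky : ∀ y, Measurable (fun x => k x y) := fun y => hk.comp measurable_prodMk_right
  -- Jensen's inequality in y for each fixed x, then Tonelli's theorem.
  calc ∫⁻ x, (∫⁻ y, f y * k x y ∂ν) ^ q ∂μ
      ≤ ∫⁻ x, A ^ (q - 1) * ∫⁻ y, f y ^ q * k x y ∂ν ∂μ := by
        refine lintegral_mono fun x => (lintegral_mul_rpow_le hq hf (hkx x).aemeasurable).trans ?_
        exact mul_le_mul_left (ENNReal.rpow_le_rpow (hA x) (by linarith)) _
    _ ≤ A ^ (q - 1) * ∫⁻ x, ∫⁻ y, f y ^ q * k x y ∂ν ∂μ := by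
        rw [lintegral_const_mul'']
        have : AEMeasurable (fun z : α × β => f z.2 ^ q * k z.1 z.2) (μ.prod ν) :=
          ((hf.comp_quasiMeasurePreserving Measure.quasiMeasurePreserving_snd).pow_const _).mul
            hk.aemeasurable
        exact this.lintegral_prod_right'
    _ = A ^ (q - 1) * ∫⁻ y, f y ^ q * ∫⁻ x, k x y ∂μ ∂ν := by
        rw [lintegral_lintegral_swap]
        · congr 1
          exact lintegral_congr fun y => lintegral_const_mul _ (hky y)
        · exact ((hf.comp_quasiMeasurePreserving Measure.quasiMeasurePreserving_snd).pow_const _).mul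
            hk.aemeasurable
    _ ≤ A ^ (q - 1) * ∫⁻ y, f y ^ q * B ∂ν := by
        gcongr with y
        exact hB y
    _ = _ := by
        rw [lintegral_mul_const'' _ (hf.pow_const _)]; ring

/-! ### A polynomial weight dominating Schwartz functions -/

/-- The integrable weight `(1 + |x|)^(-(n+1))` on `ℝⁿ`. -/
def wt {n : ℕ} (x : Rn n) : ℝ := (1 + ‖x‖) ^ (-((n : ℝ) + 1))

theorem wt_pos {n : ℕ} (x : Rn n) : 0 < wt x := Real.rpow_pos_of_pos (by positivity) _

theorem wt_le_one {n : ℕ} (x : Rn n) : wt x ≤ 1 :=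
  Real.rpow_le_one_of_one_le_of_nonpos (by linarith [norm_nonneg x]) (by linarith [n.cast_nonneg (α := ℝ)])

@[fun_prop]
theorem continuous_wt {n : ℕ} : Continuous (wt : Rn n → ℝ) := by
  unfold wt
  exact Continuous.rpow_const (by fun_prop) fun x => Or.inl (by positivity)

theorem integrable_wt {n : ℕ} : Integrable (wt : Rn n → ℝ) :=
  integrable_one_add_norm (by simp)

/-- From 1 + |x + y| ≤ (1 + R)(1 + |x|). The weight varies slowly, which makes its lattice sums
comparable with integrals. -/
theorem wt_le_mul_wt_add {n : ℕ} {x y : Rn n} {R : ℝ} (hy : ‖y‖ ≤ R) :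
    wt x ≤ (1 + R) ^ ((n : ℝ) + 1) * wt (x + y) := by
  have hR : 0 ≤ R := (norm_nonneg y).trans hy
  have h : 1 + ‖x + y‖ ≤ (1 + R) * (1 + ‖x‖) := by
    nlinarith [norm_add_le x y, norm_nonneg x, mul_nonneg hR (norm_nonneg x)]
  unfold wt
  rw [Real.rpow_neg (by positivity), Real.rpow_neg (by positivity), ← div_eq_mul_inv,
    inv_eq_one_div, div_le_div_iff₀ (by positivity) (by positivity), one_mul,
    ← Real.mul_rpow (by positivity) (by positivity)]
  exact Real.rpow_le_rpow (by positivity) h (by positivity)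

theorem exists_norm_le_wt {n : ℕ} (φ : 𝓢(Rn n, ℂ)) : ∃ C : ℝ, 0 < C ∧ ∀ x, ‖φ x‖ ≤ C * wt x := by
  have h := fun x => SchwartzMap.one_add_le_sup_seminorm_apply (𝕜 := ℝ) (m := (n + 1, 0))
    (k := n + 1) (n := 0) le_rfl le_rfl φ x
  set C := 2 ^ (n + 1, 0).1 * ((Finset.Iic (n + 1, 0)).sup
    fun m => SchwartzMap.seminorm ℝ m.1 m.2 (E := Rn n) (F := ℂ)) φ
  refine ⟨|C| + 1, by positivity, fun x => ?_⟩
  have h1 := h x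
  rw [norm_iteratedFDeriv_zero] at h1
  have h2 : wt x = ((1 + ‖x‖) ^ (n + 1))⁻¹ := by
    unfold wt
    rw [Real.rpow_neg (by positivity)]
    norm_cast
  rw [h2, ← div_eq_mul_inv, le_div_iff₀ (by positivity), mul_comm]
  linarith [le_abs_self C]

/-! ### Fourier uniqueness and the Plancherel transform -/

/-- An integrable function whose Fourier transform vanishes is zero almost everywhere. -/
theorem ae_eq_zero_of_fourier_eq_zero {n : ℕ} {u : Rn n → ℂ} (hu : Integrable u)
    (h : ∀ ξ, 𝓕 u ξ = 0) : u =ᵐ[volume] 0 := by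
  refine ae_eq_zero_of_integral_contDiff_smul_eq_zero hu.locallyIntegrable fun g hg hgc => ?_
  have hgc' : HasCompactSupport (fun x => (g x : ℂ)) := hgc.comp_left (g := ((↑) : ℝ → ℂ)) rfl
  set ψ : 𝓢(Rn n, ℂ) := hgc'.toSchwartzMap (Complex.ofRealCLM.contDiff.comp hg)
  -- The test function is itself a Fourier transform, and the transform can be moved onto u.
  have h1 : 𝓕 ((𝓕⁻ ψ : 𝓢(Rn n, ℂ)) : Rn n → ℂ) = fun x => (g x : ℂ) := by
    rw [← SchwartzMap.fourier_coe, FourierTransform.fourier_fourierInv_eq]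
    rfl
  have h2 := integral_fourier_mul_flip hu (𝓕⁻ ψ : 𝓢(Rn n, ℂ)).integrable
  simp only [h, zero_mul, integral_zero, h1] at h2
  refine Eq.trans ?_ h2.symm
  refine integral_congr_ae (Filter.Eventually.of_forall fun x => ?_)
  simp [mul_comm]

/-- The Plancherel transform agrees with the distributional one; identities in L² can therefore be
checked against Schwartz functions. -/
theorem l2_integral_fourier_mul {n : ℕ} (f : Lp ℂ 2 (volume : Measure (Rn n))) (ψ : 𝓢(Rn n, ℂ)) :
    ∫ x, ψ x * (𝓕 f : Lp ℂ 2 (volume : Measure (Rn n))) x = ∫ x, (𝓕 ψ) x * f x := by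
  have h := DFunLike.congr_fun (Lp.fourier_toTemperedDistribution_eq f) ψ
  rw [TemperedDistribution.fourier_apply, Lp.toTemperedDistribution_apply,
    Lp.toTemperedDistribution_apply] at h
  exact h.symm

theorem ae_eq_of_integral_schwartz_mul_eq {n : ℕ} {f g : Rn n → ℂ} (hf : LocallyIntegrable f)
    (hg : LocallyIntegrable g) (h : ∀ ψ : 𝓢(Rn n, ℂ), ∫ x, ψ x * f x = ∫ x, ψ x * g x) :
    f =ᵐ[volume] g := by
  refine ae_eq_of_integral_contDiff_smul_eq hf hg fun φ hφ hφc => ?_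
  have hφc' : HasCompactSupport (fun x => (φ x : ℂ)) := hφc.comp_left (g := ((↑) : ℝ → ℂ)) rfl
  exact h (hφc'.toSchwartzMap (Complex.ofRealCLM.contDiff.comp hφ))

theorem continuous_fourier {n : ℕ} {f : Rn n → ℂ} (hf : Integrable f) : Continuous (𝓕 f) :=
  VectorFourier.fourierIntegral_continuous Real.continuous_fourierChar (by exact continuous_inner) hf

theorem continuous_fourierInv {n : ℕ} {f : Rn n → ℂ} (hf : Integrable f) : Continuous (𝓕⁻ f) := by
  have : (𝓕⁻ f) = fun x => 𝓕 f (-x) := by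
    ext x
    rw [Real.fourierInv_eq_fourier_neg]
  rw [this]
  exact (continuous_fourier hf).comp continuous_neg

/-- On `L¹ ∩ L²` the Plancherel transform is given by the Fourier integral. -/
theorem l2_fourier_ae_eq {n : ℕ} {f : Lp ℂ 2 (volume : Measure (Rn n))} {f₀ : Rn n → ℂ}
    (hf : f =ᵐ[volume] f₀) (hf₀ : Integrable f₀) :
    (𝓕 f : Lp ℂ 2 (volume : Measure (Rn n))) =ᵐ[volume] 𝓕 f₀ := by
  refine ae_eq_of_integral_schwartz_mul_eq ((Lp.memLp _).locallyIntegrable (by norm_num))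
    (continuous_fourier hf₀).locallyIntegrable fun ψ => ?_
  rw [l2_integral_fourier_mul]
  have h := integral_fourier_mul_flip (ψ.integrable (μ := volume)) hf₀
  rw [← h, SchwartzMap.fourier_coe]
  refine integral_congr_ae ?_
  filter_upwards [hf] with x hx
  rw [hx]

/-- If the Plancherel transform of `f` is integrable, then `f` is given by the inversion
formula. -/
theorem l2_ae_eq_fourierInv {n : ℕ} {f : Lp ℂ 2 (volume : Measure (Rn n))} {w : Rn n → ℂ}
    (hw : Integrable w) (hf : (𝓕 f : Lp ℂ 2 (volume : Measure (Rn n))) =ᵐ[volume] w) :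
    f =ᵐ[volume] 𝓕⁻ w := by
  refine ae_eq_of_integral_schwartz_mul_eq ((Lp.memLp _).locallyIntegrable (by norm_num))
    (continuous_fourierInv hw).locallyIntegrable fun ψ => ?_
  have h1 := l2_integral_fourier_mul f (𝓕⁻ ψ)
  rw [FourierTransform.fourier_fourierInv_eq] at h1
  have h2 := integral_fourier_mul_flip (ψ.integrable (μ := volume)) hw.comp_neg
  have h3 : 𝓕 (fun x => w (-x)) = 𝓕⁻ w := (Real.fourierInv_eq_fourier_comp_neg w).symm
  rw [h3] at h2
  rw [← h1, ← h2, ← integral_neg_eq_self]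
  refine integral_congr_ae ?_
  filter_upwards [(Measure.measurePreserving_neg volume).quasiMeasurePreserving.ae_eq_comp hf]
    with x hx
  have hx' : (𝓕 f : Lp ℂ 2 (volume : Measure (Rn n))) (-x) = w (-x) := hx
  rw [hx', SchwartzMap.fourierInv_coe, Real.fourierInv_eq_fourier_neg, neg_neg]

/-! ### The integer lattice, the unit cube and lattice sums -/

instance instCountableIntLattice (n : ℕ) : Countable (intLattice n) := by
  have hf : Function.Injective (fun (x : intLattice n) (i : Fin n) => (x.2 i).choose) := by
    intro x y h
    ext i
    rw [(x.2 i).choose_spec, (y.2 i).choose_spec]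
    exact_mod_cast congrFun h i
  exact hf.countable

/-- The point of `ℤⁿ` with given integer coordinates. -/
def ofInt {n : ℕ} (m : Fin n → ℤ) : intLattice n :=
  ⟨WithLp.toLp 2 (fun i => (m i : ℝ)), fun i => ⟨m i, rfl⟩⟩

theorem ofInt_apply {n : ℕ} (m : Fin n → ℤ) (i : Fin n) : (ofInt m : Rn n) i = m i := rfl

theorem ofInt_bijective {n : ℕ} : Function.Bijective (ofInt : (Fin n → ℤ) → intLattice n) := by
  constructor
  · intro a b h
    ext i
    have : (ofInt a : Rn n) i = (ofInt b : Rn n) i := by rw [h]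
    simpa [ofInt_apply] using this
  · intro x
    refine ⟨fun i => (x.2 i).choose, ?_⟩
    ext i
    exact (x.2 i).choose_spec.symm

/-- The identification of `ℤⁿ` as a set of integer vectors and as a subgroup of `ℝⁿ`. -/
def intEquiv (n : ℕ) : (Fin n → ℤ) ≃ intLattice n := Equiv.ofBijective ofInt ofInt_bijective

@[simp] theorem intEquiv_apply {n : ℕ} (m : Fin n → ℤ) : intEquiv n m = ofInt m := rfl

theorem ec_inner_int {n : ℕ} (k l : intLattice n) : ec ⟪(k : Rn n), (l : Rn n)⟫ = 1 := by
  obtain ⟨a, rfl⟩ := ofInt_bijective.2 k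
  obtain ⟨b, rfl⟩ := ofInt_bijective.2 l
  have : ⟪(ofInt a : Rn n), (ofInt b : Rn n)⟫ = ((∑ i, a i * b i : ℤ) : ℝ) := by
    rw [PiLp.inner_apply]
    push_cast
    exact Finset.sum_congr rfl fun i _ => by simp [ofInt_apply, mul_comm]
  rw [this, ec_int]

/-- The unit cube centred at the origin. -/
def cube (n : ℕ) : Set (Rn n) := {x | ∀ i, x i ∈ Set.Ioc (-(1 / 2) : ℝ) (-(1 / 2) + 1)}

theorem measurableSet_cube (n : ℕ) : MeasurableSet (cube n) := by
  have : cube n = ⋂ i, (fun x : Rn n => x i) ⁻¹' Set.Ioc (-(1 / 2) : ℝ) (-(1 / 2) + 1) := by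
    ext x; simp [cube]
  rw [this]
  exact MeasurableSet.iInter fun i => measurableSet_Ioc.preimage
    (by fun_prop : Continuous fun x : Rn n => x i).measurable

theorem norm_le_of_mem_cube {n : ℕ} {x : Rn n} (hx : x ∈ cube n) : ‖x‖ ≤ n := by
  rw [EuclideanSpace.norm_eq, Real.sqrt_le_left (by positivity)]
  calc ∑ i, ‖x i‖ ^ 2 ≤ ∑ _i : Fin n, (1 : ℝ) := by
        refine Finset.sum_le_sum fun i _ => ?_
        have h := hx i
        rw [Real.norm_eq_abs, sq_abs]
        have h1 := h.1
        have h2 := h.2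
        nlinarith
    _ = n := by simp
    _ ≤ (n : ℝ) ^ 2 := by
        rcases Nat.eq_zero_or_pos n with rfl | h
        · simp
        · have : (1 : ℝ) ≤ n := by exact_mod_cast h
          nlinarith

theorem isAddFundamentalDomain_cube (n : ℕ) :
    IsAddFundamentalDomain (intLattice n) (cube n) volume := by
  refine IsAddFundamentalDomain.mk' (measurableSet_cube n).nullMeasurableSet fun x => ?_
  have h := fun i => existsUnique_add_zsmul_mem_Ioc (zero_lt_one (α := ℝ)) (x i) (-(1 / 2))
  choose m hm hm' using h
  refine ⟨ofInt m, fun i => ?_, fun y hy => ?_⟩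
  · have := hm i
    simp only [zsmul_eq_mul, mul_one] at this
    change (ofInt m : Rn n) i + x i ∈ _
    rw [ofInt_apply, add_comm (m i : ℝ)]
    exact this
  · obtain ⟨b, rfl⟩ := ofInt_bijective.2 y
    congr 1
    ext i
    refine hm' i (b i) ?_
    have := hy i
    change (ofInt b : Rn n) i + x i ∈ _ at this
    simpa only [zsmul_eq_mul, mul_one, ofInt_apply, add_comm] using this

theorem volume_cube (n : ℕ) : volume (cube n) = 1 := by
  have h := (EuclideanSpace.volume_preserving_symm_measurableEquiv_toLp (Fin n)).measure_preimage
    (s := Set.univ.pi fun _ => Set.Ioc (-(1 / 2) : ℝ) (-(1 / 2) + 1))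
    (MeasurableSet.univ_pi fun _ => measurableSet_Ioc).nullMeasurableSet
  have h2 : (MeasurableEquiv.toLp 2 (Fin n → ℝ)).symm ⁻¹'
      (Set.univ.pi fun _ => Set.Ioc (-(1 / 2) : ℝ) (-(1 / 2) + 1)) = cube n := by
    ext x
    simp [cube]
  rw [h2, Real.volume_pi_Ioc] at h
  rw [h]
  simp

theorem lintegral_eq_lintegral_cube_tsum {n : ℕ} {f : Rn n → ℝ≥0∞} (hf : Measurable f) :
    ∫⁻ x, f x = ∫⁻ x in cube n, ∑' l : intLattice n, f (l + x) := by
  rw [(isAddFundamentalDomain_cube n).lintegral_eq_tsum'' f, lintegral_tsum]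
  · rfl
  · exact fun l => (hf.comp (measurable_const_add _)).aemeasurable

theorem lintegral_comp_add_smul {n : ℕ} {f : Rn n → ℝ≥0∞} (hf : Measurable f) {η : ℝ}
    (hη : 0 < η) (y : Rn n) : ∫⁻ x, f (y + η • x) = ENNReal.ofReal (η ^ n)⁻¹ * ∫⁻ x, f x := by
  have h1 : ∫⁻ x, f (y + x) = ∫⁻ x, f x := lintegral_add_left_eq_self f y
  have h2 := lintegral_map (μ := (volume : Measure (Rn n))) (f := fun x => f (y + x))
    (hf.comp (measurable_const_add y)) (measurable_const_smul η)
  rw [← h2, Measure.map_addHaar_smul _ hη.ne', lintegral_smul_measure, h1]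
  simp [abs_of_pos hη]

/-- Each lattice term is at most a mean of `h` over a cube of side η around its node, because the
unit cube has volume one. -/
theorem tsum_comp_smul_le_lintegral {n : ℕ} {g h : Rn n → ℝ≥0∞} {η : ℝ}
    (hgh : ∀ z, ∀ u ∈ cube n, g z ≤ h (z + η • u)) (y : Rn n) :
    ∑' l : intLattice n, g (y + η • (l : Rn n)) ≤ ∫⁻ x, h (y + η • x) := by
  rw [(isAddFundamentalDomain_cube n).lintegral_eq_tsum'' (fun x => h (y + η • x))]
  refine ENNReal.tsum_le_tsum fun l => ?_
  calc g (y + η • (l : Rn n)) = ∫⁻ _x in cube n, g (y + η • (l : Rn n)) := by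
        rw [lintegral_const, Measure.restrict_apply_univ, volume_cube, mul_one]
    _ ≤ _ := by
        refine setLIntegral_mono' (measurableSet_cube n) fun x hx => ?_
        have := hgh (y + η • (l : Rn n)) x hx
        rwa [add_assoc, ← smul_add] at this

theorem lintegral_le_tsum_comp_smul {n : ℕ} {g h : Rn n → ℝ≥0∞} {η : ℝ}
    (hgh : ∀ z, ∀ u ∈ cube n, h (z + η • u) ≤ g z) (y : Rn n) :
    ∫⁻ x, h (y + η • x) ≤ ∑' l : intLattice n, g (y + η • (l : Rn n)) := by
  rw [(isAddFundamentalDomain_cube n).lintegral_eq_tsum'' (fun x => h (y + η • x))]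
  refine ENNReal.tsum_le_tsum fun l => ?_
  calc _ ≤ ∫⁻ _x in cube n, g (y + η • (l : Rn n)) := by
        refine setLIntegral_mono' (measurableSet_cube n) fun x hx => ?_
        have := hgh (y + η • (l : Rn n)) x hx
        rwa [add_assoc, ← smul_add] at this
    _ = g (y + η • (l : Rn n)) := by
        rw [lintegral_const, Measure.restrict_apply_univ, volume_cube, mul_one]

/-- Comparison with η⁻ⁿ ∫ wt. Uniformity in y and in η ≤ 1 comes from |η u| ≤ n for u in the cube, a
displacement that changes the weight by a factor at most (1 + n)^(n + 1). -/
theorem exists_tsum_wt_le (n : ℕ) : ∃ C : ℝ≥0, ∀ (η : ℝ), 0 < η → η ≤ 1 → ∀ y : Rn n,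
    ∑' l : intLattice n, ENNReal.ofReal (wt (y + η • (l : Rn n))) ≤
      C * ENNReal.ofReal (η ^ n)⁻¹ := by
  have hI : ∫⁻ x : Rn n, ENNReal.ofReal (wt x) ≠ ∞ := integrable_wt.lintegral_lt_top.ne
  set B : ℝ≥0∞ := ENNReal.ofReal ((1 + (n : ℝ)) ^ ((n : ℝ) + 1)) with hB
  refine ⟨(B * ∫⁻ x : Rn n, ENNReal.ofReal (wt x)).toNNReal, fun η h0 h1 y => ?_⟩
  rw [ENNReal.coe_toNNReal (ENNReal.mul_ne_top ENNReal.ofReal_ne_top hI)]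
  have hm : Measurable fun x : Rn n => ENNReal.ofReal (wt x) :=
    (continuous_wt.measurable).ennreal_ofReal
  calc _ ≤ ∫⁻ x, B * ENNReal.ofReal (wt (y + η • x)) := by
        refine tsum_comp_smul_le_lintegral (g := fun z => ENNReal.ofReal (wt z))
          (h := fun z => B * ENNReal.ofReal (wt z)) (fun z u hu => ?_) y
        rw [hB, ← ENNReal.ofReal_mul (by positivity)]
        refine ENNReal.ofReal_le_ofReal (wt_le_mul_wt_add ?_)
        rw [norm_smul, Real.norm_eq_abs, abs_of_pos h0]
        have := norm_le_of_mem_cube hu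
        nlinarith [norm_nonneg u]
    _ = B * (ENNReal.ofReal (η ^ n)⁻¹ * ∫⁻ x : Rn n, ENNReal.ofReal (wt x)) := by
        have hm2 : Measurable fun x : Rn n => ENNReal.ofReal (wt (y + η • x)) :=
          hm.comp (by fun_prop : Measurable fun x : Rn n => y + η • x)
        rw [lintegral_const_mul _ hm2, lintegral_comp_add_smul hm h0]
    _ = _ := by ring

theorem summable_wt_add {n : ℕ} (y : Rn n) :
    Summable fun l : intLattice n => wt (y + (l : Rn n)) := by
  obtain ⟨C, hC⟩ := exists_tsum_wt_le n
  have h := hC 1 one_pos le_rfl y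
  simp only [one_smul, one_pow, inv_one, ENNReal.ofReal_one, mul_one] at h
  have h2 := ENNReal.summable_toReal (h.trans_lt ENNReal.coe_lt_top).ne
  simpa only [ENNReal.toReal_ofReal (wt_pos _).le] using h2

/-- Only nodes near the origin matter: |φ| ≥ |φ 0| / 2 on a ball, and a grid of small step η,
wherever it is placed, has on the order of η⁻ⁿ nodes there. -/
theorem exists_le_tsum_norm_rpow {n : ℕ} {φ : Rn n → ℂ} (hφ : Continuous φ) (h0 : φ 0 ≠ 0)
    {q : ℝ} (hq : 0 < q) : ∃ c : ℝ≥0, 0 < c ∧ ∃ η₀ : ℝ, 0 < η₀ ∧ ∀ η, 0 < η → η ≤ η₀ → ∀ y : Rn n,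
      c * ENNReal.ofReal (η ^ n)⁻¹ ≤ ∑' l : intLattice n, ‖φ (y + η • (l : Rn n))‖ₑ ^ q := by
  obtain ⟨r, hr, hball⟩ : ∃ r > 0, ∀ x : Rn n, ‖x‖ < r → ‖φ 0‖ / 2 ≤ ‖φ x‖ := by
    have h1 : ∀ᶠ x in 𝓝 (0 : Rn n), ‖φ 0‖ / 2 < ‖φ x‖ :=
      hφ.norm.continuousAt.eventually_const_lt (half_lt_self (norm_pos_iff.2 h0))
    obtain ⟨r, hr, h⟩ := Metric.eventually_nhds_iff.1 h1
    exact ⟨r, hr, fun x hx => (h (by simpa using hx)).le⟩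
  set b : ℝ≥0∞ := ENNReal.ofReal (‖φ 0‖ / 2) ^ q with hb
  have hb0 : b ≠ 0 := by
    rw [hb]; exact (ENNReal.rpow_pos (by simpa using h0) ENNReal.ofReal_ne_top).ne'
  have hbt : b ≠ ∞ := ENNReal.rpow_ne_top_of_nonneg hq.le ENNReal.ofReal_ne_top
  set V := volume (Metric.ball (0 : Rn n) (r / 2)) with hV
  have hV0 : V ≠ 0 := (Metric.measure_ball_pos _ _ (half_pos hr)).ne'
  have hVt : V ≠ ∞ := measure_ball_lt_top.ne
  -- For η ≤ r / 2 / (n + 1) and u in the cube, |η u| ≤ r / 2; so z lies in the ball of radius r as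
  -- soon as z + η u lies in that of radius r / 2.
  refine ⟨(b * V).toNNReal, ENNReal.toNNReal_pos (mul_ne_zero hb0 hV0) (ENNReal.mul_ne_top hbt hVt),
    r / 2 / (n + 1), by positivity, fun η hη hη' y => ?_⟩
  rw [ENNReal.coe_toNNReal (ENNReal.mul_ne_top hbt hVt)]
  set h : Rn n → ℝ≥0∞ := (Metric.ball (0 : Rn n) (r / 2)).indicator fun _ => b
  have hm : Measurable h := measurable_const.indicator measurableSet_ball
  calc b * V * ENNReal.ofReal (η ^ n)⁻¹ = ∫⁻ x, h (y + η • x) := by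
        rw [lintegral_comp_add_smul hm hη, lintegral_indicator measurableSet_ball,
          lintegral_const, Measure.restrict_apply_univ]
        ring
    _ ≤ _ := by
        refine lintegral_le_tsum_comp_smul (g := fun z => ‖φ z‖ₑ ^ q) (fun z u hu => ?_) y
        by_cases hz : z + η • u ∈ Metric.ball (0 : Rn n) (r / 2)
        · simp only [h, Set.indicator_of_mem hz, hb]
          refine ENNReal.rpow_le_rpow ?_ hq.le
          rw [← ofReal_norm]
          refine ENNReal.ofReal_le_ofReal (hball z ?_)
          have h1 : ‖η • u‖ ≤ r / 2 := by
            rw [norm_smul, Real.norm_eq_abs, abs_of_pos hη]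
            calc η * ‖u‖ ≤ r / 2 / (n + 1) * (n + 1) := by
                  gcongr
                  linarith [norm_le_of_mem_cube hu]
              _ = r / 2 := by field_simp
          have h2 : ‖z‖ ≤ ‖z + η • u‖ + ‖η • u‖ := by
            simpa using norm_sub_le (z + η • u) (η • u)
          rw [mem_ball_zero_iff] at hz
          linarith
        · simp [h, Set.indicator_of_notMem hz]

/-! ### Periodization and Poisson summation -/

/-- The sum of the translates of `u` by the integer vectors. -/
def periodization {n : ℕ} (u : Rn n → ℂ) (x : Rn n) : ℂ := ∑' l : intLattice n, u (x + l)

theorem continuous_periodization {n : ℕ} {u : Rn n → ℂ} (hu : Continuous u) {C : ℝ}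
    (hC : ∀ x, ‖u x‖ ≤ C * wt x) : Continuous (periodization u) := by
  rw [continuous_iff_continuousAt]
  intro x₀
  have hC0 : 0 ≤ C := by
    have h := (norm_nonneg _).trans (hC x₀)
    exact nonneg_of_mul_nonneg_left h (wt_pos x₀)
  have hon : ContinuousOn (periodization u) (Metric.closedBall 0 (‖x₀‖ + 1)) := by
    refine continuousOn_tsum (u := fun l : intLattice n =>
      C * ((1 + (‖x₀‖ + 1)) ^ ((n : ℝ) + 1) * wt (0 + (l : Rn n)))) (fun l => by fun_prop) ?_ ?_
    · exact ((summable_wt_add 0).mul_left _).mul_left _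
    · intro l x hx
      refine (hC _).trans (mul_le_mul_of_nonneg_left ?_ hC0)
      have h := wt_le_mul_wt_add (x := x + (l : Rn n)) (y := -x) (R := ‖x₀‖ + 1) (by simpa using hx)
      simpa using h
  exact hon.continuousAt (Metric.closedBall_mem_nhds_of_mem (by simp))

theorem periodization_add_int {n : ℕ} (u : Rn n → ℂ) (x : Rn n) (k : intLattice n) :
    periodization u (x + k) = periodization u x := by
  unfold periodization
  rw [← (Equiv.addLeft k).tsum_eq (fun l : intLattice n => u (x + l))]
  refine tsum_congr fun l => ?_
  congr 1
  simp [add_assoc]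

/-- The character with frequency k is ℤⁿ-periodic, so the Fourier integral over ℝⁿ folds onto the
cube. -/
theorem setIntegral_cube_periodization {n : ℕ} {u : Rn n → ℂ} (hu : Continuous u) {C : ℝ}
    (hC : ∀ x, ‖u x‖ ≤ C * wt x) (k : intLattice n) :
    ∫ x in cube n, ec (-⟪x, (k : Rn n)⟫) * periodization u x = 𝓕 u k := by
  have hC0 : 0 ≤ C := nonneg_of_mul_nonneg_left ((norm_nonneg _).trans (hC 0)) (wt_pos 0)
  have hui : Integrable u := (integrable_wt.const_mul C).mono' hu.aestronglyMeasurable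
    (Filter.Eventually.of_forall hC)
  set g : Rn n → ℂ := fun x => ec (-⟪x, (k : Rn n)⟫) * u x with hg
  have hgi : Integrable g := integrable_ec_mul hui (by fun_prop)
  rw [fourier_eq_ec, (isAddFundamentalDomain_cube n).integral_eq_tsum'' _ hgi]
  have hgl : ∀ (l : intLattice n) x, g (l +ᵥ x) = ec (-⟪x, (k : Rn n)⟫) * u (x + l) := by
    intro l x
    change g ((l : Rn n) + x) = _
    have h1 : ec (-⟪(l : Rn n), (k : Rn n)⟫) = 1 := by
      have := ec_neg_mul ⟪(l : Rn n), (k : Rn n)⟫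
      rwa [ec_inner_int, mul_one] at this
    rw [hg]
    simp only
    rw [inner_add_left, neg_add, ec_add, h1, one_mul, add_comm]
  rw [← integral_tsum]
  · refine integral_congr_ae (Filter.Eventually.of_forall fun x => ?_)
    simp only [hgl]
    rw [tsum_mul_left, periodization]
  · exact fun l => (hgi.comp_add_left (l : Rn n)).1.restrict
  · have : ∑' l : intLattice n, ∫⁻ x in cube n, ‖g (l +ᵥ x)‖ₑ = ∫⁻ x, ‖g x‖ₑ :=
      ((isAddFundamentalDomain_cube n).lintegral_eq_tsum'' fun x => ‖g x‖ₑ).symm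
    rw [this]
    exact hgi.2.ne

/-- The projection of `ℝⁿ` onto the torus `ℝⁿ / ℤⁿ`. -/
def toTorus (n : ℕ) : C(Rn n, UnitAddTorus (Fin n)) where
  toFun x i := (x i : UnitAddCircle)
  continuous_toFun := continuous_pi fun i =>
    (AddCircle.continuous_mk' (1 : ℝ)).comp (by fun_prop : Continuous fun x : Rn n => x i)

theorem isQuotientMap_toTorus (n : ℕ) : Topology.IsQuotientMap (toTorus n) := by
  have h1 : IsOpenQuotientMap (Pi.map fun (_ : Fin n) (t : ℝ) => (t : UnitAddCircle)) :=
    IsOpenQuotientMap.piMap fun _ => QuotientAddGroup.isOpenQuotientMap_mk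
  exact h1.isQuotientMap.comp (EuclideanSpace.equiv (Fin n) ℝ).toHomeomorph.isQuotientMap

theorem toTorus_eq_iff {n : ℕ} {x y : Rn n} :
    toTorus n x = toTorus n y → ∃ k : intLattice n, y = x + k := by
  intro h
  have h1 : ∀ i, ∃ m : ℤ, y i = x i + m := by
    intro i
    have h2 : ((x i : ℝ) : UnitAddCircle) = (y i : ℝ) := congrFun h i
    obtain ⟨m, hm⟩ := AddSubgroup.mem_zmultiples_iff.1 (QuotientAddGroup.eq.1 h2)
    refine ⟨m, ?_⟩
    rw [zsmul_eq_mul, mul_one] at hm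
    linarith
  choose m hm using h1
  refine ⟨ofInt m, ?_⟩
  ext i
  rw [hm i]
  rfl

theorem mFourier_toTorus {n : ℕ} (m : Fin n → ℤ) (x : Rn n) :
    UnitAddTorus.mFourier m (toTorus n x) = ec ⟪(ofInt m : Rn n), x⟫ := by
  have h : UnitAddTorus.mFourier m (toTorus n x) = ∏ i, fourier (m i) ((x i : ℝ) : UnitAddCircle) :=
    rfl
  rw [h]
  simp only [fourier_coe_apply]
  rw [← Complex.exp_sum, ec, PiLp.inner_apply]
  congr 1
  push_cast
  rw [Finset.mul_sum, Finset.sum_mul]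
  refine Finset.sum_congr rfl fun i _ => ?_
  simp [ofInt_apply]
  ring

/-- The Poisson summation formula in `ℝⁿ`. -/
theorem hasSum_fourier_mul_ec {n : ℕ} {u : Rn n → ℂ} (hu : Continuous u) {C : ℝ}
    (hC : ∀ x, ‖u x‖ ≤ C * wt x) (hs : Summable fun k : intLattice n => 𝓕 u k) (x : Rn n) :
    HasSum (fun k : intLattice n => 𝓕 u k * ec ⟪(k : Rn n), x⟫) (periodization u x) := by
  -- The periodization descends to a continuous function on the torus, with Fourier coefficients the
  -- values of `𝓕 u` at the integers; as these are summable, its Fourier series converges to it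
  -- pointwise.
  set P : C(Rn n, ℂ) := ⟨periodization u, continuous_periodization hu hC⟩
  have hP : ∀ x y, toTorus n x = toTorus n y → P x = P y := by
    intro x y h
    obtain ⟨k, rfl⟩ := toTorus_eq_iff h
    exact (periodization_add_int u x k).symm
  set T : C(UnitAddTorus (Fin n), ℂ) := (isQuotientMap_toTorus n).lift P hP
  have hT : ∀ x, T (toTorus n x) = periodization u x := by
    intro x
    exact congrFun (congrArg DFunLike.coe ((isQuotientMap_toTorus n).lift_comp P hP)) x
  have hcoef : ∀ m : Fin n → ℤ, UnitAddTorus.mFourierCoeff T m = 𝓕 u (ofInt m) := by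
    intro m
    rw [UnitAddTorus.mFourierCoeff_eq_integral _ _ (fun _ => -(1 / 2)),
      ← setIntegral_cube_periodization hu hC]
    have hmp := EuclideanSpace.volume_preserving_symm_measurableEquiv_toLp (Fin n)
    have := hmp.setIntegral_preimage_emb (MeasurableEquiv.measurableEmbedding _)
      (fun y : Fin n → ℝ => UnitAddTorus.mFourier (-m) (fun i => (y i : UnitAddCircle)) •
        T (fun i => (y i : UnitAddCircle)))
      {x : Fin n → ℝ | ∀ i, x i ∈ Set.Ioc (-(1 / 2) : ℝ) (-(1 / 2) + 1)}
    rw [← this]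
    refine setIntegral_congr_fun (measurableSet_cube n) fun x _ => ?_
    change UnitAddTorus.mFourier (-m) (toTorus n x) • T (toTorus n x) = _
    rw [hT, mFourier_toTorus, smul_eq_mul]
    congr 2
    have : (ofInt (-m) : Rn n) = -(ofInt m : Rn n) := by
      ext i; simp [ofInt_apply]
    rw [this, inner_neg_left, real_inner_comm]
  have hsum : Summable (UnitAddTorus.mFourierCoeff T) := by
    have : UnitAddTorus.mFourierCoeff T = (fun k : intLattice n => 𝓕 u k) ∘ intEquiv n := by
      ext m
      exact hcoef m
    rw [this]
    exact (intEquiv n).summable_iff.2 hs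
  have h := UnitAddTorus.hasSum_mFourier_series_apply_of_summable hsum (toTorus n x)
  rw [hT] at h
  rw [← (intEquiv n).hasSum_iff]
  convert h using 2 with m
  simp only [Function.comp, intEquiv_apply, hcoef, mFourier_toTorus, smul_eq_mul]

/-! ### Dilates, translates and cutoffs of Schwartz functions -/

theorem enorm_ofReal_le {a : ℂ} {b : ℝ} (h : ‖a‖ ≤ b) : ‖a‖ₑ ≤ ENNReal.ofReal b := by
  rw [← ofReal_norm]
  exact ENNReal.ofReal_le_ofReal h

/-- The dilate `x ↦ φ(cx)` of a Schwartz function. -/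
def dilate {n : ℕ} (c : ℝ) (hc : c ≠ 0) (φ : 𝓢(Rn n, ℂ)) : 𝓢(Rn n, ℂ) :=
  compCLMOfContinuousLinearEquiv ℂ (ContinuousLinearEquiv.smulLeft (Units.mk0 c hc)) φ

@[simp] theorem dilate_apply {n : ℕ} {c : ℝ} (hc : c ≠ 0) (φ : 𝓢(Rn n, ℂ)) (x : Rn n) :
    dilate c hc φ x = φ (c • x) := rfl

theorem tsupport_dilate {n : ℕ} {c : ℝ} (hc : c ≠ 0) (φ : 𝓢(Rn n, ℂ)) :
    tsupport (dilate c hc φ) = (fun x => c • x) ⁻¹' tsupport φ := by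
  have h : (dilate c hc φ : Rn n → ℂ) = φ ∘ (Homeomorph.smulOfNeZero c hc : Rn n ≃ₜ Rn n) := rfl
  rw [h, tsupport_comp_eq_preimage]
  rfl

theorem hasCompactSupport_dilate {n : ℕ} {c : ℝ} (hc : c ≠ 0) {φ : 𝓢(Rn n, ℂ)}
    (hφ : HasCompactSupport φ) : HasCompactSupport (dilate c hc φ) :=
  hφ.comp_homeomorph (Homeomorph.smulOfNeZero c hc : Rn n ≃ₜ Rn n)

theorem fourier_dilate {n : ℕ} {c : ℝ} (hc : c ≠ 0) (φ : 𝓢(Rn n, ℂ)) (x : Rn n) :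
    (𝓕 (dilate c hc φ)) x = ((|(c ^ n)⁻¹| : ℝ) : ℂ) * (𝓕 φ) (c⁻¹ • x) := by
  rw [SchwartzMap.fourier_coe, SchwartzMap.fourier_coe, fourier_eq_ec, fourier_eq_ec]
  have h := Measure.integral_comp_smul volume
    (fun ξ : Rn n => ec (-⟪ξ, c⁻¹ • x⟫) * φ ξ) c
  simp only [finrank_euclideanSpace, Fintype.card_fin] at h
  rw [← Complex.real_smul, ← h]
  refine integral_congr_ae (Filter.Eventually.of_forall fun y => ?_)
  simp only [dilate_apply]
  rw [real_inner_smul_left, real_inner_smul_right, ← mul_assoc, mul_inv_cancel₀ hc, one_mul]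

theorem fourier_compSubConst {n : ℕ} (φ : 𝓢(Rn n, ℂ)) (a x : Rn n) :
    (𝓕 (compSubConstCLM ℂ a φ)) x = ec (-⟪a, x⟫) * (𝓕 φ) x := by
  rw [SchwartzMap.fourier_coe, SchwartzMap.fourier_coe, fourier_eq_ec, fourier_eq_ec,
    ← integral_const_mul, ← integral_add_right_eq_self _ a]
  refine integral_congr_ae (Filter.Eventually.of_forall fun y => ?_)
  simp only [compSubConstCLM_apply, add_sub_cancel_right]
  rw [inner_add_left, neg_add, ec_add]
  ring

theorem tsupport_compSubConst {n : ℕ} (φ : 𝓢(Rn n, ℂ)) (a : Rn n) :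
    tsupport (compSubConstCLM ℂ a φ) = (fun x => x - a) ⁻¹' tsupport φ := by
  have h : (compSubConstCLM ℂ a φ : Rn n → ℂ) = φ ∘ (Homeomorph.subRight a) := by
    ext x; simp
  rw [h, tsupport_comp_eq_preimage]
  rfl

theorem hasCompactSupport_compSubConst {n : ℕ} {φ : 𝓢(Rn n, ℂ)} (hφ : HasCompactSupport φ)
    (a : Rn n) : HasCompactSupport (compSubConstCLM ℂ a φ) := by
  have h : (compSubConstCLM ℂ a φ : Rn n → ℂ) = φ ∘ (Homeomorph.subRight a) := by
    ext x; simp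
  rw [h]
  exact hφ.comp_homeomorph _

theorem exists_cutoff {n : ℕ} {K U : Set (Rn n)} (hK : IsCompact K) (hU : IsOpen U) (hKU : K ⊆ U) :
    ∃ χ : 𝓢(Rn n, ℂ), HasCompactSupport χ ∧ tsupport χ ⊆ U ∧ ∀ᶠ x in 𝓝ˢ K, χ x = 1 := by
  obtain ⟨L, hL, hKL, hLU⟩ := exists_compact_between hK hU hKU
  obtain ⟨f, hf1, hf0, -⟩ := exists_contMDiffMap_one_nhds_of_subset_interior
    (n := ⊤) (modelWithCornersSelf ℝ (Rn n)) hK.isClosed hKL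
  have hfs : ContDiff ℝ ((⊤ : ℕ∞) : WithTop ℕ∞) f := f.contMDiff.contDiff
  have hsupp : tsupport (fun x => (f x : ℂ)) ⊆ L := by
    refine closure_minimal (fun x hx => ?_) hL.isClosed
    by_contra hn
    exact hx (by simp [hf0 x hn])
  have hc : HasCompactSupport (fun x => (f x : ℂ)) :=
    hL.of_isClosed_subset (isClosed_tsupport _) hsupp
  refine ⟨hc.toSchwartzMap (Complex.ofRealCLM.contDiff.comp hfs), hc, hsupp.trans hLU, ?_⟩
  filter_upwards [hf1] with x hx
  change (f x : ℂ) = 1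
  rw [hx]; simp

/-! ### Spectra of L^q functions and convolution with Schwartz kernels -/

/-- `f` is measurable and `|f|^q` is integrable. -/
def FinLq {n : ℕ} (q : ℝ) (f : Rn n → ℂ) : Prop :=
  AEStronglyMeasurable f volume ∧ ∫⁻ x, ‖f x‖ₑ ^ q < ∞

theorem finLq_iff_memLp {n : ℕ} {p : ℝ≥0∞} (hp : p ≠ 0) (hp' : p ≠ ∞) {f : Rn n → ℂ} :
    FinLq p.toReal f ↔ MemLp f p volume := by
  rw [FinLq, MemLp, eLpNorm_lt_top_iff_lintegral_rpow_enorm_lt_top hp hp']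

/-- A kernel that is bounded as well as integrable maps L^q to bounded functions; the convolution
estimates at a single point rest on this. -/
theorem lintegral_mul_rpow_le_of_le {α : Type*} [MeasurableSpace α] {μ : Measure α} {q : ℝ}
    (hq : 1 < q) {f k : α → ℝ≥0∞} (hf : AEMeasurable f μ) (hk : AEMeasurable k μ) {A B : ℝ≥0∞}
    (hA : ∫⁻ x, k x ∂μ ≤ A) (hB : ∀ x, k x ≤ B) :
    (∫⁻ x, f x * k x ∂μ) ^ q ≤ A ^ (q - 1) * (B * ∫⁻ x, f x ^ q ∂μ) := by
  refine (lintegral_mul_rpow_le hq hf hk).trans ?_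
  refine mul_le_mul' (ENNReal.rpow_le_rpow hA (by linarith)) ?_
  rw [← lintegral_const_mul'' _ (hf.pow_const _)]
  exact lintegral_mono fun x => by rw [mul_comm]; exact mul_le_mul_left (hB x) _

theorem exists_enorm_le {n : ℕ} (θ : 𝓢(Rn n, ℂ)) : ∃ B : ℝ≥0, ∀ x, ‖θ x‖ₑ ≤ B := by
  obtain ⟨C, hC0, hC⟩ := exists_norm_le_wt θ
  exact ⟨C.toNNReal, fun x => enorm_ofReal_le ((hC x).trans
    (mul_le_of_le_one_right hC0.le (wt_le_one x)))⟩

theorem lintegral_enorm_schwartz_lt_top {n : ℕ} (θ : 𝓢(Rn n, ℂ)) : ∫⁻ x, ‖θ x‖ₑ < ∞ :=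
  θ.integrable.2

theorem FinLq.integrable_wt_mul {n : ℕ} {q : ℝ} (hq : 1 < q) {f : Rn n → ℂ} (hf : FinLq q f)
    (x : Rn n) : Integrable fun y => wt (x - y) * ‖f y‖ := by
  refine ⟨(by fun_prop : Continuous fun y => wt (x - y)).aestronglyMeasurable.mul hf.1.norm, ?_⟩
  have h1 : ∫⁻ y : Rn n, ENNReal.ofReal (wt (x - y)) = ∫⁻ y : Rn n, ENNReal.ofReal (wt y) :=
    lintegral_sub_left_eq_self (fun y : Rn n => ENNReal.ofReal (wt y)) x
  have h := lintegral_mul_rpow_le_of_le hq hf.1.enorm (k := fun y => ENNReal.ofReal (wt (x - y)))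
    (by fun_prop : Continuous fun y => wt (x - y)).measurable.ennreal_ofReal.aemeasurable
    h1.le (B := 1) (fun y => by simpa using ENNReal.ofReal_le_ofReal (wt_le_one (x - y)))
  have h2 : (∫⁻ y, ‖f y‖ₑ * ENNReal.ofReal (wt (x - y))) ^ q < ∞ := by
    refine h.trans_lt (ENNReal.mul_ne_top ?_ (ENNReal.mul_ne_top ENNReal.one_ne_top hf.2.ne)).lt_top
    exact ENNReal.rpow_ne_top_of_nonneg (by linarith) integrable_wt.lintegral_lt_top.ne
  rw [ENNReal.rpow_lt_top_iff_of_pos (by linarith)] at h2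
  refine lt_of_le_of_lt (lintegral_congr fun y => ?_).le h2
  rw [enorm_mul, enorm_norm, Real.enorm_eq_ofReal (wt_pos _).le, mul_comm]

theorem FinLq.exists_lintegral_le {n : ℕ} {q : ℝ} (hq : 1 < q) {f : Rn n → ℂ} (hf : FinLq q f)
    (θ : 𝓢(Rn n, ℂ)) : ∃ M : ℝ≥0, ∀ x, ∫⁻ y, ‖f y‖ₑ * ‖θ (x - y)‖ₑ ≤ M := by
  obtain ⟨B, hB⟩ := exists_enorm_le θ
  set A := ∫⁻ x, ‖θ x‖ₑ
  set T := A ^ (q - 1) * (B * ∫⁻ x, ‖f x‖ₑ ^ q)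
  have hT : T ≠ ∞ := ENNReal.mul_ne_top
    (ENNReal.rpow_ne_top_of_nonneg (by linarith) (lintegral_enorm_schwartz_lt_top θ).ne)
    (ENNReal.mul_ne_top ENNReal.coe_ne_top hf.2.ne)
  have hT' : T ^ q⁻¹ ≠ ∞ := ENNReal.rpow_ne_top_of_nonneg (by positivity) hT
  refine ⟨(T ^ q⁻¹).toNNReal, fun x => ?_⟩
  rw [ENNReal.coe_toNNReal hT', ENNReal.le_rpow_inv_iff (by linarith)]
  refine lintegral_mul_rpow_le_of_le hq hf.1.enorm ?_ ?_ fun y => hB _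
  · exact (by fun_prop : Continuous fun y => θ (x - y)).enorm.measurable.aemeasurable
  · exact (lintegral_sub_left_eq_self (fun y => ‖θ y‖ₑ) x).le

theorem FinLq.integrable_mul_comp_sub {n : ℕ} {q : ℝ} (hq : 1 < q) {f : Rn n → ℂ} (hf : FinLq q f)
    (θ : 𝓢(Rn n, ℂ)) (x : Rn n) : Integrable fun y => θ (x - y) * f y := by
  obtain ⟨M, hM⟩ := hf.exists_lintegral_le hq θ
  refine ⟨(by fun_prop : Continuous fun y => θ (x - y)).aestronglyMeasurable.mul hf.1, ?_⟩
  refine lt_of_le_of_lt ?_ ((hM x).trans_lt ENNReal.coe_lt_top)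
  exact (lintegral_congr fun y => by rw [enorm_mul, mul_comm]).le

/-- The reflection `x ↦ φ(-x)` of a Schwartz function. -/
def reflect {n : ℕ} (φ : 𝓢(Rn n, ℂ)) : 𝓢(Rn n, ℂ) := dilate (-1) (by norm_num) φ

@[simp] theorem reflect_apply {n : ℕ} (φ : 𝓢(Rn n, ℂ)) (x : Rn n) : reflect φ x = φ (-x) := by
  simp [reflect]

theorem FinLq.integrable_schwartz_mul {n : ℕ} {q : ℝ} (hq : 1 < q) {f : Rn n → ℂ}
    (hf : FinLq q f) (φ : 𝓢(Rn n, ℂ)) : Integrable fun y => φ y * f y := by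
  simpa using hf.integrable_mul_comp_sub hq (reflect φ) 0

/-- The Fourier transform of `f` vanishes on `U`: `∫ φ̂ f = 0` for all test functions `φ` supported
by `U`. -/
def FVanishOn {n : ℕ} (f : Rn n → ℂ) (U : Set (Rn n)) : Prop :=
  ∀ φ : 𝓢(Rn n, ℂ), HasCompactSupport φ → tsupport φ ⊆ U → ∫ x, (𝓕 φ) x * f x = 0

/-- A Fourier transform that vanishes locally vanishes globally. -/
theorem fVanishOn_of_local {n : ℕ} {q : ℝ} (hq : 1 < q) {f : Rn n → ℂ} (hf : FinLq q f)
    {V : Set (Rn n)} (h : ∀ x ∈ V, ∃ U ∈ 𝓝 x, FVanishOn f U) : FVanishOn f V := by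
  intro φ hφ hs
  choose! U hU hUf using h
  obtain ⟨t, htV, ht⟩ := hφ.isCompact.elim_nhds_subcover (fun x => interior (U x))
    (fun x hx => interior_mem_nhds.2 (hU x (hs hx)))
  have hcov : tsupport φ ⊆ ⋃ i : t, interior (U i) := by
    intro x hx
    obtain ⟨i, hi, hxi⟩ := Set.mem_iUnion₂.1 (ht hx)
    exact Set.mem_iUnion.2 ⟨⟨i, hi⟩, hxi⟩
  -- A smooth partition of unity on the compact support cuts φ into finitely many pieces, each
  -- covered by one local hypothesis.
  obtain ⟨P, hP⟩ := SmoothPartitionOfUnity.exists_isSubordinate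
    (modelWithCornersSelf ℝ (Rn n)) (isClosed_tsupport φ) (fun i : t => interior (U i))
    (fun i => isOpen_interior) hcov
  have hc : ∀ i, HasCompactSupport (fun x => (P i x : ℂ) * φ x) := fun i => hφ.mul_left
  have hsm : ∀ i, ContDiff ℝ ((⊤ : ℕ∞) : WithTop ℕ∞) (fun x => (P i x : ℂ) * φ x) := fun i =>
    (Complex.ofRealCLM.contDiff.comp (P i).contMDiff.contDiff).mul (φ.smooth ⊤)
  set ψ : t → 𝓢(Rn n, ℂ) := fun i => (hc i).toSchwartzMap (hsm i)
  have hψ : ∀ i x, ψ i x = (P i x : ℂ) * φ x := fun i x => rfl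
  have hsum : φ = ∑ i, ψ i := by
    ext x
    simp only [_root_.sum_apply, hψ]
    rw [← Finset.sum_mul]
    by_cases hx : x ∈ tsupport φ
    · have := P.sum_eq_one hx
      rw [finsum_eq_sum_of_fintype] at this
      rw [← Complex.ofReal_sum, this]; simp
    · rw [image_eq_zero_of_notMem_tsupport hx, mul_zero]
  have hF : ∀ x, (𝓕 φ) x * f x = ∑ i, (𝓕 (ψ i)) x * f x := by
    intro x
    rw [hsum, FourierTransform.fourier_sum, _root_.sum_apply, Finset.sum_mul]
  simp only [hF]
  rw [integral_finsetSum _ fun i _ => hf.integrable_schwartz_mul hq _]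
  refine Finset.sum_eq_zero fun i _ => ?_
  refine hUf i (hs (htV i i.2)) (ψ i) (hc i) ?_
  refine (closure_mono ?_).trans ((hP i).trans interior_subset)
  intro x hx
  have : (P i x : ℂ) * φ x ≠ 0 := hx
  simpa using left_ne_zero_of_mul this

theorem exists_bump (n : ℕ) : ∃ ρ : 𝓢(Rn n, ℂ), tsupport ρ ⊆ Metric.ball 0 1 ∧
    HasCompactSupport ρ ∧ (∀ x, (starRingEnd ℂ) (ρ x) = ρ x) ∧ (𝓕 ρ) 0 ≠ 0 := by
  set b : ContDiffBump (0 : Rn n) := ⟨1 / 4, 1 / 2, by norm_num, by norm_num⟩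
  have hc : HasCompactSupport (fun x => (b x : ℂ)) :=
    b.hasCompactSupport.comp_left (g := ((↑) : ℝ → ℂ)) rfl
  have hts : tsupport (fun x => (b x : ℂ)) ⊆ tsupport b :=
    closure_mono (fun x hx => by simpa using hx)
  refine ⟨hc.toSchwartzMap (Complex.ofRealCLM.contDiff.comp b.contDiff), ?_, hc,
    fun x => Complex.conj_ofReal _, ?_⟩
  · refine hts.trans ?_
    rw [b.tsupport_eq]
    exact Metric.closedBall_subset_ball (by norm_num)
  · rw [SchwartzMap.fourier_coe, fourier_eq_ec]
    have : ∫ x : Rn n, ec (-⟪x, 0⟫) * (b x : ℂ) = ((∫ x, b x : ℝ) : ℂ) := by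
      rw [← integral_complex_ofReal]
      simp
    change ∫ x : Rn n, ec (-⟪x, 0⟫) * (b x : ℂ) ≠ 0
    rw [this]
    exact_mod_cast (b.integral_pos (μ := volume)).ne'

/-- Testing against all translates of a bump shows that f times the Fourier transform of the bump is
integrable with zero Fourier transform, hence is zero. Shrinking the bump spreads out its transform,
so each point is eventually reached where the transform is nonzero. -/
theorem FVanishOn.ae_eq_zero {n : ℕ} {q : ℝ} (hq : 1 < q) {f : Rn n → ℂ} (hf : FinLq q f)
    (h : FVanishOn f Set.univ) : f =ᵐ[volume] 0 := by
  obtain ⟨ρ, -, hρc, -, hρ0⟩ := exists_bump n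
  obtain ⟨r, hr, hball⟩ : ∃ r > 0, ∀ x : Rn n, dist x 0 < r → (𝓕 ρ) x ≠ 0 :=
    Metric.eventually_nhds_iff.1 ((𝓕 ρ).continuous.continuousAt.eventually_ne hρ0)
  have key : ∀ k : ℕ, (fun x => (𝓕 (dilate ((k : ℝ) + 1) (by positivity) ρ)) x * f x)
      =ᵐ[volume] 0 := by
    intro k
    refine ae_eq_zero_of_fourier_eq_zero (hf.integrable_schwartz_mul hq _) fun ξ => ?_
    rw [fourier_eq_ec]
    have := h (compSubConstCLM ℂ ξ (dilate ((k : ℝ) + 1) (by positivity) ρ))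
      (hasCompactSupport_compSubConst (hasCompactSupport_dilate _ hρc) _) (Set.subset_univ _)
    rw [← this]
    refine integral_congr_ae (Filter.Eventually.of_forall fun x => ?_)
    simp only [fourier_compSubConst]
    rw [real_inner_comm, mul_assoc]
  filter_upwards [ae_all_iff.2 key] with x hx
  obtain ⟨k, hk⟩ := exists_nat_gt (‖x‖ / r)
  have h1 := hx k
  rw [fourier_dilate] at h1
  have h2 : (𝓕 ρ) ((((k : ℝ) + 1))⁻¹ • x) ≠ 0 := by
    refine hball _ ?_
    rw [dist_zero_right, norm_smul, norm_inv, Real.norm_eq_abs, abs_of_pos (by positivity),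
      inv_mul_lt_iff₀ (by positivity)]
    rw [div_lt_iff₀ hr] at hk
    nlinarith
  have h3 : ((|(((k : ℝ) + 1) ^ n)⁻¹| : ℝ) : ℂ) ≠ 0 := by
    have : (((k : ℝ) + 1) ^ n)⁻¹ ≠ 0 := by positivity
    exact_mod_cast abs_ne_zero.2 this
  exact (mul_eq_zero.1 h1).resolve_left (mul_ne_zero h3 h2)

/-- The convolution of `f` with a Schwartz function. -/
def convS {n : ℕ} (θ : 𝓢(Rn n, ℂ)) (f : Rn n → ℂ) (x : Rn n) : ℂ := ∫ y, θ (x - y) * f y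

theorem continuous_convS {n : ℕ} {q : ℝ} (hq : 1 < q) {f : Rn n → ℂ} (hf : FinLq q f)
    (θ : 𝓢(Rn n, ℂ)) : Continuous (convS θ f) := by
  obtain ⟨C, hC0, hC⟩ := exists_norm_le_wt θ
  rw [continuous_iff_continuousAt]
  intro x₀
  refine continuousAt_of_dominated
    (bound := fun y => C * (1 + 1) ^ ((n : ℝ) + 1) * (wt (x₀ - y) * ‖f y‖)) ?_ ?_ ?_ ?_
  · exact Filter.Eventually.of_forall fun x => (hf.integrable_mul_comp_sub hq θ x).1
  · filter_upwards [Metric.ball_mem_nhds x₀ one_pos] with x hx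
    refine Filter.Eventually.of_forall fun y => ?_
    rw [norm_mul, ← mul_assoc]
    refine mul_le_mul_of_nonneg_right ((hC _).trans ?_) (norm_nonneg _)
    rw [mul_assoc]
    refine mul_le_mul_of_nonneg_left ?_ hC0.le
    have hd : ‖x₀ - x‖ ≤ 1 := by
      rw [← dist_eq_norm, dist_comm]
      exact (Metric.mem_ball.1 hx).le
    have := wt_le_mul_wt_add (x := x - y) hd
    rwa [show x - y + (x₀ - x) = x₀ - y by abel] at this
  · exact (hf.integrable_wt_mul hq x₀).const_mul _
  · exact Filter.Eventually.of_forall fun y => by fun_prop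

theorem enorm_convS_le {n : ℕ} (θ : 𝓢(Rn n, ℂ)) (f : Rn n → ℂ) (x : Rn n) :
    ‖convS θ f x‖ₑ ≤ ∫⁻ y, ‖f y‖ₑ * ‖θ (x - y)‖ₑ :=
  (enorm_integral_le_lintegral_enorm _).trans
    (lintegral_congr fun y => by rw [enorm_mul, mul_comm]).le

theorem exists_tsum_enorm_sub_le {n : ℕ} (θ : 𝓢(Rn n, ℂ)) :
    ∃ B : ℝ≥0, ∀ y : Rn n, ∑' l : intLattice n, ‖θ ((l : Rn n) - y)‖ₑ ≤ B := by
  obtain ⟨C, hC0, hC⟩ := exists_norm_le_wt θ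
  obtain ⟨B, hB⟩ := exists_tsum_wt_le n
  refine ⟨C.toNNReal * B, fun y => ?_⟩
  calc ∑' l : intLattice n, ‖θ ((l : Rn n) - y)‖ₑ
      ≤ ∑' l : intLattice n, ENNReal.ofReal C * ENNReal.ofReal (wt (-y + (1 : ℝ) • (l : Rn n))) := by
        refine ENNReal.tsum_le_tsum fun l => ?_
        rw [← ENNReal.ofReal_mul hC0.le, one_smul, neg_add_eq_sub]
        exact enorm_ofReal_le (hC _)
    _ ≤ _ := by
        rw [ENNReal.tsum_mul_left, ENNReal.coe_mul]
        refine mul_le_mul_right ?_ _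
        simpa using hB 1 one_pos le_rfl (-y)

/-- The Plancherel–Pólya inequality. -/
theorem exists_tsum_convS_le {n : ℕ} {q : ℝ} (hq : 1 < q) (θ : 𝓢(Rn n, ℂ)) :
    ∃ C : ℝ≥0, ∀ f : Rn n → ℂ, AEStronglyMeasurable f volume →
      ∑' k : intLattice n, ‖convS θ f k‖ₑ ^ q ≤ C * ∫⁻ x, ‖f x‖ₑ ^ q := by
  obtain ⟨B, hB⟩ := exists_tsum_enorm_sub_le θ
  set A := ∫⁻ x, ‖θ x‖ₑ
  have hA : A ≠ ∞ := (lintegral_enorm_schwartz_lt_top θ).ne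
  have hT : A ^ (q - 1) * B ≠ ∞ := ENNReal.mul_ne_top
    (ENNReal.rpow_ne_top_of_nonneg (by linarith) hA) ENNReal.coe_ne_top
  refine ⟨(A ^ (q - 1) * B).toNNReal, fun f hf => ?_⟩
  rw [ENNReal.coe_toNNReal hT, ← lintegral_count]
  have hθm : Measurable fun z : intLattice n × Rn n => ‖θ ((z.1 : Rn n) - z.2)‖ₑ :=
    (by fun_prop : Continuous fun z : intLattice n × Rn n => θ ((z.1 : Rn n) - z.2)).enorm.measurable
  have hq0 : 0 ≤ q := by linarith
  refine (lintegral_mono (g := fun k : intLattice n => (∫⁻ y, ‖f y‖ₑ * ‖θ ((k : Rn n) - y)‖ₑ) ^ q)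
    fun k => ENNReal.rpow_le_rpow (enorm_convS_le θ f k) hq0).trans ?_
  refine lintegral_kernel_rpow_le (μ := Measure.count) hq hf.enorm
    (k := fun (l : intLattice n) y => ‖θ ((l : Rn n) - y)‖ₑ) hθm (fun l => ?_) fun y => ?_
  · exact (lintegral_sub_left_eq_self (fun y => ‖θ y‖ₑ) (l : Rn n)).le
  · rw [lintegral_count]
    exact hB y

theorem lintegral_convS_le {n : ℕ} {q : ℝ} (hq : 1 < q) (θ : 𝓢(Rn n, ℂ)) {f : Rn n → ℂ}
    (hf : AEStronglyMeasurable f volume) :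
    ∫⁻ x, ‖convS θ f x‖ₑ ^ q ≤ (∫⁻ x, ‖θ x‖ₑ) ^ (q - 1) * (∫⁻ x, ‖θ x‖ₑ) * ∫⁻ x, ‖f x‖ₑ ^ q := by
  refine (lintegral_mono fun x => ENNReal.rpow_le_rpow (enorm_convS_le θ f x)
    (by linarith : (0 : ℝ) ≤ q)).trans ?_
  refine lintegral_kernel_rpow_le hq hf.enorm
    (k := fun x y => ‖θ (x - y)‖ₑ) ?_ (fun x => ?_) fun y => ?_
  · exact (by fun_prop : Continuous fun z : Rn n × Rn n => θ (z.1 - z.2)).enorm.measurable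
  · exact (lintegral_sub_left_eq_self (fun y => ‖θ y‖ₑ) x).le
  · exact (lintegral_sub_right_eq_self (fun y => ‖θ y‖ₑ) y).le

theorem FinLq.convS {n : ℕ} {q : ℝ} (hq : 1 < q) {f : Rn n → ℂ} (hf : FinLq q f)
    (θ : 𝓢(Rn n, ℂ)) : FinLq q (convS θ f) := by
  refine ⟨(continuous_convS hq hf θ).aestronglyMeasurable,
    (lintegral_convS_le hq θ hf.1).trans_lt ?_⟩
  have hA := (lintegral_enorm_schwartz_lt_top θ).ne
  exact (ENNReal.mul_ne_top (ENNReal.mul_ne_top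
    (ENNReal.rpow_ne_top_of_nonneg (by linarith) hA) hA) hf.2.ne).lt_top

theorem FinLq.sub {n : ℕ} {q : ℝ} (hq : 1 < q) {f g : Rn n → ℂ} (hf : FinLq q f)
    (hg : FinLq q g) : FinLq q (fun x => f x - g x) := by
  have h0 : ENNReal.ofReal q ≠ 0 := by simp; linarith
  have h := (ENNReal.toReal_ofReal (by linarith : 0 ≤ q))
  rw [← h] at hf hg ⊢
  rw [finLq_iff_memLp h0 ENNReal.ofReal_ne_top] at *
  exact MemLp.sub hf hg

/-- The weak form of the identity that the transform of θ * f is θ̂ f̂, obtained by Fubini's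
theorem. -/
theorem integral_mul_convS {n : ℕ} {q : ℝ} (hq : 1 < q) {f : Rn n → ℂ} (hf : FinLq q f)
    (θ φ : 𝓢(Rn n, ℂ)) :
    ∫ x, (𝓕 φ) x * convS θ f x = ∫ y, 𝓕 (fun ξ => φ ξ * (𝓕 θ) ξ) y * f y := by
  obtain ⟨M, hM⟩ := hf.exists_lintegral_le hq θ
  set ψ : 𝓢(Rn n, ℂ) := 𝓕 φ with hψ
  set F : Rn n × Rn n → ℂ := fun z => ψ z.1 * (θ (z.1 - z.2) * f z.2) with hF
  have hmeas : AEStronglyMeasurable F (volume.prod volume) :=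
    (by fun_prop : Continuous fun z : Rn n × Rn n => ψ z.1).aestronglyMeasurable.mul
      ((by fun_prop : Continuous fun z : Rn n × Rn n => θ (z.1 - z.2)).aestronglyMeasurable.mul
        hf.1.comp_snd)
  have hint : Integrable F (volume.prod volume) := by
    rw [integrable_prod_iff hmeas]
    refine ⟨Filter.Eventually.of_forall fun x =>
      (hf.integrable_mul_comp_sub hq θ x).const_mul (ψ x), ?_⟩
    refine (ψ.integrable.norm.mul_const (M : ℝ)).mono' hmeas.norm.integral_prod_right' ?_
    refine Filter.Eventually.of_forall fun x => ?_
    simp only [hF, norm_mul, integral_const_mul]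
    rw [norm_norm]
    refine mul_le_mul_of_nonneg_left ?_ (norm_nonneg _)
    have h1 : ∫ y, ‖θ (x - y)‖ * ‖f y‖ = (∫⁻ y, ‖f y‖ₑ * ‖θ (x - y)‖ₑ).toReal := by
      simp only [← norm_mul]
      rw [integral_norm_eq_lintegral_enorm (hf.integrable_mul_comp_sub hq θ x).1]
      congr 1
      exact lintegral_congr fun y => by rw [enorm_mul, mul_comm]
    rw [h1, Real.norm_eq_abs, abs_of_nonneg ENNReal.toReal_nonneg]
    exact ENNReal.toReal_le_coe_of_le_coe (hM x)
  have h1 : ∀ x, ψ x * convS θ f x = ∫ y, ψ x * (θ (x - y) * f y) := fun x =>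
    (integral_const_mul _ _).symm
  simp only [h1]
  rw [integral_integral_swap (f := fun x y => ψ x * (θ (x - y) * f y)) hint]
  refine integral_congr_ae (Filter.Eventually.of_forall fun y => ?_)
  simp only [← mul_assoc]
  rw [integral_mul_const]
  congr 1
  have h2 := integral_fourier_mul_flip (φ.integrable (μ := volume))
    ((compSubConstCLM ℂ y θ).integrable (μ := volume))
  simp only [compSubConstCLM_apply] at h2
  rw [hψ, SchwartzMap.fourier_coe, h2, fourier_eq_ec]
  refine integral_congr_ae (Filter.Eventually.of_forall fun ξ => ?_)
  have h3 := fourier_compSubConst θ y ξ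
  rw [SchwartzMap.fourier_coe] at h3
  simp only [h3]
  rw [real_inner_comm]
  ring

theorem schwartz_fourier_sub {n : ℕ} (φ ψ : 𝓢(Rn n, ℂ)) : 𝓕 (φ - ψ) = 𝓕 φ - 𝓕 ψ :=
  map_sub (fourierCLM ℂ 𝓢(Rn n, ℂ)) φ ψ

/-- A function with spectrum in `D` is reproduced by convolution with `θ` if `θ̂ = 1` near `D`. -/
theorem FVanishOn.ae_eq_convS {n : ℕ} {q : ℝ} (hq : 1 < q) {f : Rn n → ℂ} (hf : FinLq q f)
    {D : Set (Rn n)} (h : FVanishOn f Dᶜ) {θ : 𝓢(Rn n, ℂ)}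
    (hθ : ∀ᶠ ξ in 𝓝ˢ D, (𝓕 θ) ξ = 1) : f =ᵐ[volume] convS θ f := by
  have hg : FVanishOn (fun x => f x - convS θ f x) Set.univ := by
    intro φ hφ _
    have hc : HasCompactSupport fun ξ => φ ξ * (𝓕 θ) ξ := hφ.mul_right
    -- The function φ (1 - θ̂) vanishes near D, so its pairing with the transform of f is zero; that
    -- pairing is also the one of φ with the transform of f - θ * f.
    set η : 𝓢(Rn n, ℂ) := φ - hc.toSchwartzMap ((φ.smooth ⊤).mul ((𝓕 θ).smooth ⊤)) with hη
    have hη' : ∀ x, η x = φ x * (1 - (𝓕 θ) x) := by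
      intro x
      rw [hη, _root_.sub_apply, mul_sub, mul_one]
      rfl
    have hηc : HasCompactSupport η := by
      have : (η : Rn n → ℂ) = fun x => φ x * (1 - (𝓕 θ) x) := funext hη'
      rw [this]
      exact hφ.mul_right
    have hηs : tsupport η ⊆ Dᶜ := by
      intro x hx hxD
      refine notMem_tsupport_iff_eventuallyEq.2 ?_ hx
      filter_upwards [hθ.filter_mono (nhds_le_nhdsSet hxD)] with y hy
      rw [hη', hy]; simp
    have h0 := h η hηc hηs
    have hF : ∀ x, (𝓕 η) x = (𝓕 φ) x - 𝓕 (fun ξ => φ ξ * (𝓕 θ) ξ) x := by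
      intro x
      rw [hη, schwartz_fourier_sub]
      rfl
    simp only [mul_sub]
    have hi : Integrable fun y => 𝓕 (fun ξ => φ ξ * (𝓕 θ) ξ) y * f y :=
      hf.integrable_schwartz_mul hq (𝓕 (hc.toSchwartzMap ((φ.smooth ⊤).mul ((𝓕 θ).smooth ⊤))))
    rw [integral_sub (hf.integrable_schwartz_mul hq _)
      ((hf.convS hq θ).integrable_schwartz_mul hq _), integral_mul_convS hq hf,
      ← integral_sub (hf.integrable_schwartz_mul hq _) hi, ← h0]
    refine integral_congr_ae (Filter.Eventually.of_forall fun x => ?_)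
    simp only [hF]
    ring
  filter_upwards [hg.ae_eq_zero hq (hf.sub hq (hf.convS hq θ))] with x hx
  exact sub_eq_zero.1 hx

/-! ### Geometry of spectral domains -/

/-- A compact fundamental domain for `ℤⁿ` that can be pushed locally, by small translations, into
its interior, and whose complement can be pushed off it. -/
structure SpectralDomain {n : ℕ} (D : Set (Rn n)) : Prop where
  isCompact : IsCompact D
  fund : IsAddFundamentalDomain (intLattice n) D volume
  shift : ∀ x₀ ∈ frontier D, ∃ r > (0 : ℝ), ∃ v : Rn n, ∃ ε₀ > (0 : ℝ), ∀ x ∈ Metric.ball x₀ r,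
    ∀ ε : ℝ, 0 < ε → ε < ε₀ → (x ∈ D → x + ε • v ∈ interior D) ∧ (x ∉ interior D → x - ε • v ∉ D)

theorem finite_int_norm_le {n : ℕ} (R : ℝ) : {k : intLattice n | ‖(k : Rn n)‖ ≤ R}.Finite := by
  have h : {k : intLattice n | ‖(k : Rn n)‖ ≤ R} ⊆
      intEquiv n '' Set.Icc (fun _ => -⌈R⌉) (fun _ => ⌈R⌉) := by
    intro k hk
    obtain ⟨m, rfl⟩ := ofInt_bijective.2 k
    refine ⟨m, ?_, rfl⟩
    have h1 : ∀ i, |(m i : ℝ)| ≤ R := fun i => by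
      have := PiLp.norm_apply_le (ofInt m : Rn n) i
      rw [ofInt_apply, Real.norm_eq_abs] at this
      exact this.trans hk
    constructor
    · intro i
      have h2 := (abs_le.1 (h1 i)).1
      have h3 := Int.le_ceil R
      have : (-⌈R⌉ : ℝ) ≤ m i := by linarith
      exact_mod_cast this
    · intro i
      have h2 := (abs_le.1 (h1 i)).2
      have h3 := Int.le_ceil R
      have : (m i : ℝ) ≤ ⌈R⌉ := by linarith
      exact_mod_cast this
  exact ((Set.finite_Icc _ _).image _).subset h

theorem locallyFinite_translates {n : ℕ} {C : Set (Rn n)} (hC : Bornology.IsBounded C) :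
    LocallyFinite fun k : intLattice n => {x : Rn n | x + k ∈ C} := by
  obtain ⟨R, hR⟩ := hC.exists_norm_le
  intro x
  refine ⟨Metric.ball x 1, Metric.ball_mem_nhds x one_pos,
    (finite_int_norm_le (R + (‖x‖ + 1))).subset ?_⟩
  rintro k ⟨y, hy, hyx⟩
  have h1 := hR _ hy
  have h2 : ‖y‖ ≤ ‖x‖ + 1 := by
    have := norm_sub_norm_le y x
    rw [Metric.mem_ball, dist_eq_norm] at hyx
    linarith
  have h3 : ‖(k : Rn n)‖ ≤ ‖y + k‖ + ‖y‖ := by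
    simpa using norm_sub_le (y + k) y
  change ‖(k : Rn n)‖ ≤ _
  linarith

/-- The lattice translates of a compact set form a locally finite family of closed sets, whatever
vectors are allowed. -/
theorem isClosed_setOf_add_mem {n : ℕ} {C : Set (Rn n)} (hC : IsCompact C)
    (P : intLattice n → Prop) : IsClosed {x : Rn n | ∃ k : intLattice n, P k ∧ x + k ∈ C} := by
  have h1 : {x : Rn n | ∃ k : intLattice n, P k ∧ x + k ∈ C} =
      ⋃ k : {k : intLattice n // P k}, {x : Rn n | x + (k : intLattice n) ∈ C} := by
    ext x; simp
  rw [h1]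
  refine LocallyFinite.isClosed_iUnion ((locallyFinite_translates hC.isBounded).comp_injective
    Subtype.val_injective) fun k => ?_
  exact hC.isClosed.preimage (continuous_add_const _)

namespace SpectralDomain

variable {n : ℕ} {D : Set (Rn n)}

theorem subset_closure_interior (hD : SpectralDomain D) : D ⊆ closure (interior D) := by
  intro x hx
  by_cases hi : x ∈ interior D
  · exact subset_closure hi
  obtain ⟨r, hr, v, ε₀, hε₀, h⟩ := hD.shift x ⟨subset_closure hx, hi⟩
  have ht : Filter.Tendsto (fun ε : ℝ => x + ε • v) (𝓝[>] 0) (𝓝 x) := by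
    have : Continuous fun ε : ℝ => x + ε • v := by fun_prop
    have h := this.tendsto 0
    simp only [zero_smul, add_zero] at h
    exact h.mono_left nhdsWithin_le_nhds
  refine mem_closure_of_tendsto ht ?_
  filter_upwards [Ioo_mem_nhdsGT hε₀] with ε hε
  exact (h x (Metric.mem_ball_self hr) ε hε.1 hε.2).1 hx

/-- Almost disjointness becomes exact for interior points: D lies in the closure of its interior, so
a common point would give a nonempty open set contained in two distinct translates of D, of positive
measure. -/
theorem add_notMem (hD : SpectralDomain D) {x : Rn n} (hx : x ∈ interior D) {k : intLattice n}
    (hk : k ≠ 0) : x + k ∉ D := by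
  intro hxk
  have h1 : (interior D ∩ (fun y => y + (k : Rn n)) ⁻¹' interior D).Nonempty := by
    have h2 := hD.subset_closure_interior hxk
    have h3 : (fun y : Rn n => y - k) ⁻¹' interior D ∈ 𝓝 (x + (k : Rn n)) := by
      refine (isOpen_interior.preimage (by fun_prop)).mem_nhds ?_
      simpa using hx
    obtain ⟨y, hy1, hy2⟩ := mem_closure_iff_nhds.1 h2 _ h3
    exact ⟨y - k, hy1, by simpa using hy2⟩
  have h4 : IsOpen (interior D ∩ (fun y => y + (k : Rn n)) ⁻¹' interior D) :=
    isOpen_interior.inter (isOpen_interior.preimage (continuous_add_const _))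
  have h5 := h4.measure_pos volume h1
  have h6 : AEDisjoint volume ((0 : intLattice n) +ᵥ D) ((-k) +ᵥ D) :=
    hD.fund.aedisjoint (fun h => hk (by simpa using h.symm))
  have h7 : interior D ∩ (fun y => y + (k : Rn n)) ⁻¹' interior D ⊆
      ((0 : intLattice n) +ᵥ D) ∩ ((-k) +ᵥ D) := by
    rintro y ⟨hy1, hy2⟩
    refine ⟨⟨y, interior_subset hy1, by simp⟩, ⟨y + k, interior_subset hy2, ?_⟩⟩
    change ((-k : intLattice n) : Rn n) + (y + k) = y
    simp
  exact h5.ne' (measure_mono_null h7 h6)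

/-- The union of the translates is closed and of full measure, so its open complement is empty. -/
theorem exists_add_mem (hD : SpectralDomain D) (x : Rn n) : ∃ k : intLattice n, x + k ∈ D := by
  have h1 := isClosed_setOf_add_mem hD.isCompact (fun _ => True)
  by_contra hn
  have h2 : ({x : Rn n | ∃ k : intLattice n, True ∧ x + k ∈ D}ᶜ).Nonempty := ⟨x, by simpa using hn⟩
  refine (h1.isOpen_compl.measure_pos volume h2).ne' ?_
  refine measure_mono_null ?_ hD.fund.ae_covers
  rintro y hy ⟨g, hg⟩
  refine hy ⟨g, trivial, ?_⟩
  rw [add_comm]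
  exact hg

/-- Near a boundary point, small shifts along v carry ∂D into the interior, so distinct shifts of a
piece of ∂D are disjoint. Infinitely many disjoint translates within bounded distance force measure
zero. -/
theorem volume_frontier (hD : SpectralDomain D) : volume (frontier D) = 0 := by
  refine measure_null_of_locally_null _ fun x₀ hx₀ => ?_
  obtain ⟨r, hr, v, ε₀, hε₀, h⟩ := hD.shift x₀ hx₀
  refine ⟨frontier D ∩ Metric.ball x₀ r,
    inter_mem_nhdsWithin _ (Metric.ball_mem_nhds x₀ hr), ?_⟩
  -- A strictly decreasing sequence in (0, ε₀): the differences t i - t j with i < j are again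
  -- admissible shifts.
  set t : ℕ → ℝ := fun j => ε₀ / (j + 2) with ht
  have ht0 : ∀ j, 0 < t j := fun j => by positivity
  have ht1 : ∀ j, t j < ε₀ := fun j => by
    rw [ht]
    refine div_lt_self hε₀ ?_
    have : (0 : ℝ) ≤ j := j.cast_nonneg
    linarith
  have htm : ∀ i j, i < j → t j < t i := fun i j hij => by
    rw [ht]
    have : (i : ℝ) < j := by exact_mod_cast hij
    simp only
    gcongr
  refine Measure.addHaar_eq_zero_of_disjoint_translates volume (fun j => t j • v) ?_ ?_
    (isClosed_frontier.measurableSet.inter measurableSet_ball)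
  · refine (Metric.isBounded_closedBall (x := (0 : Rn n)) (r := ε₀ * ‖v‖)).subset ?_
    rintro _ ⟨j, rfl⟩
    rw [mem_closedBall_zero_iff, norm_smul, Real.norm_eq_abs, abs_of_pos (ht0 j)]
    exact mul_le_mul_of_nonneg_right (ht1 j).le (norm_nonneg _)
  · have key : ∀ i j, i < j → Disjoint ({t i • v} + (frontier D ∩ Metric.ball x₀ r))
        ({t j • v} + (frontier D ∩ Metric.ball x₀ r)) := by
      intro i j hij
      rw [Set.disjoint_left]
      rintro _ ⟨_, rfl, x, ⟨hxf, hxb⟩, rfl⟩ ⟨_, rfl, y, ⟨hyf, hyb⟩, hxy⟩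
      have hy : y = x + (t i - t j) • v := by
        rw [sub_smul]
        have : t j • v + y = t i • v + x := hxy
        rw [eq_comm, ← sub_eq_zero]
        rw [← sub_eq_zero] at this
        rw [← neg_eq_zero, ← this]
        abel
      have h1 := (h x hxb (t i - t j) (by linarith [htm i j hij])
        (by linarith [ht0 j, ht1 i])).1 (hD.isCompact.isClosed.frontier_subset hxf)
      rw [← hy] at h1
      exact hyf.2 h1
    intro i j hij
    rcases lt_or_gt_of_ne hij with h1 | h1
    · exact key i j h1
    · exact (key j i h1).symm

theorem volume_eq_one (hD : SpectralDomain D) : volume D = 1 := by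
  rw [hD.fund.measure_eq (isAddFundamentalDomain_cube n), volume_cube]

theorem exists_kernel {U : Set (Rn n)} (hU : IsOpen U) (hD : IsCompact D) (hDU : D ⊆ U) :
    ∃ θ : 𝓢(Rn n, ℂ), HasCompactSupport (𝓕 θ : 𝓢(Rn n, ℂ)) ∧
      tsupport (𝓕 θ : 𝓢(Rn n, ℂ)) ⊆ U ∧
      ∀ᶠ ξ in 𝓝ˢ D, (𝓕 θ) ξ = 1 := by
  obtain ⟨χ, h1, h2, h3⟩ := exists_cutoff hD hU hDU
  refine ⟨𝓕⁻ χ, ?_⟩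
  rw [FourierTransform.fourier_fourierInv_eq]
  exact ⟨h1, h2, h3⟩

end SpectralDomain

/-! ### Functions vanishing on the lattice have spectrum in the boundary -/

theorem summable_schwartz_int {n : ℕ} (φ : 𝓢(Rn n, ℂ)) :
    Summable fun k : intLattice n => φ (k : Rn n) := by
  obtain ⟨C, -, hC⟩ := exists_norm_le_wt φ
  refine Summable.of_norm_bounded (g := fun k : intLattice n => C * wt (0 + (k : Rn n)))
    ((summable_wt_add 0).mul_left C) fun k => ?_
  simpa using hC k

/-- If `f` has spectrum in `D` and vanishes on `ℤⁿ`, then its spectrum lies in `∂D`. -/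
theorem SpectralDomain.fVanishOn_compl_frontier {n : ℕ} {D : Set (Rn n)} (hD : SpectralDomain D)
    {q : ℝ} (hq : 1 < q) {f : Rn n → ℂ} (hf : FinLq q f) (hfc : Continuous f)
    (hfD : FVanishOn f Dᶜ) (hf0 : ∀ k : intLattice n, f k = 0) :
    FVanishOn f (frontier D)ᶜ := by
  have hDo : IsOpen Dᶜ := hD.isCompact.isClosed.isOpen_compl
  suffices hint : FVanishOn f (interior D) by
    refine fVanishOn_of_local hq hf fun x hx => ?_
    by_cases hxD : x ∈ D
    · refine ⟨interior D, isOpen_interior.mem_nhds ?_, hint⟩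
      by_contra hi
      exact hx ⟨subset_closure hxD, hi⟩
    · exact ⟨Dᶜ, hDo.mem_nhds hxD, hfD⟩
  intro φ hφ hφs
  -- T is the union of the nonzero translates of the support of φ. It misses D, so θ̂ can be 1 near
  -- D and 0 on T; multiplying the periodization of φ by θ̂ then leaves φ itself, and Poisson
  -- summation expands φ.
  set T := {x : Rn n | ∃ k : intLattice n, k ≠ 0 ∧ x + k ∈ tsupport φ} with hT
  have hTc : IsClosed T := isClosed_setOf_add_mem hφ.isCompact _
  have hDT : D ⊆ Tᶜ := by
    rintro x hx ⟨k, hk, hxk⟩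
    refine hD.add_notMem (hφs hxk) (k := -k) (by simpa using hk) ?_
    simpa using hx
  obtain ⟨θ, hθc, hθT, hθ1⟩ := SpectralDomain.exists_kernel hTc.isOpen_compl hD.isCompact hDT
  have hfθ : f = convS θ f :=
    ((hfc.ae_eq_iff_eq volume (continuous_convS hq hf θ))).1 (hfD.ae_eq_convS hq hf hθ1)
  obtain ⟨C, -, hC⟩ := exists_norm_le_wt φ
  have hsum := summable_schwartz_int (𝓕 φ)
  have hexp : ∀ ξ, HasSum (fun k : intLattice n => (𝓕 φ) k * (ec ⟪(k : Rn n), ξ⟫ * (𝓕 θ) ξ))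
      (φ ξ) := by
    intro ξ
    by_cases hξ : ξ ∈ T
    · have h1 : (𝓕 θ) ξ = 0 := image_eq_zero_of_notMem_tsupport fun h => hθT h hξ
      have h2 : φ ξ = 0 := image_eq_zero_of_notMem_tsupport
        fun h => hDT (interior_subset (hφs h)) hξ
      simp [h1, h2]
    · have h1 : periodization φ ξ = φ ξ := by
        rw [periodization, tsum_eq_single (0 : intLattice n)]
        · simp
        · intro k hk
          exact image_eq_zero_of_notMem_tsupport fun h => hξ ⟨k, hk, h⟩
      have h2 := (hasSum_fourier_mul_ec φ.continuous hC hsum ξ).mul_right ((𝓕 θ) ξ)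
      rw [h1] at h2
      have h3 : φ ξ * (𝓕 θ) ξ = φ ξ := by
        by_cases h : ξ ∈ tsupport φ
        · rw [(hθ1.filter_mono (nhds_le_nhdsSet (interior_subset (hφs h)))).self_of_nhds, mul_one]
        · rw [image_eq_zero_of_notMem_tsupport h, zero_mul]
      rw [h3] at h2
      have h4 := h2
      simp only [mul_assoc] at h4
      exact h4
  -- The Fourier transform of this expansion. When it is paired with f, the translate θ(k - y)
  -- becomes (θ * f)(k) = f(k) = 0.
  have hFφ : ∀ y, HasSum (fun k : intLattice n => (𝓕 φ) k * θ ((k : Rn n) - y)) ((𝓕 φ) y) := by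
    intro y
    have hi : ∀ k : intLattice n, Integrable fun ξ : Rn n =>
        ec (-⟪ξ, y⟫) * ((𝓕 φ) k * (ec ⟪(k : Rn n), ξ⟫ * (𝓕 θ) ξ)) := fun k =>
      integrable_ec_mul ((integrable_ec_mul (𝓕 θ).integrable (by fun_prop)).const_mul _)
        (by fun_prop)
    have h := hasSum_integral_of_summable_integral_norm hi (by
      simp only [norm_mul, norm_ec, one_mul]
      simp_rw [integral_const_mul]
      exact hsum.norm.mul_right _)
    have h1 : ∀ ξ, ∑' k : intLattice n, ec (-⟪ξ, y⟫) * ((𝓕 φ) k * (ec ⟪(k : Rn n), ξ⟫ * (𝓕 θ) ξ))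
        = ec (-⟪ξ, y⟫) * φ ξ := fun ξ => by
      rw [tsum_mul_left, (hexp ξ).tsum_eq]
    simp only [h1] at h
    rw [← fourier_eq_ec, ← SchwartzMap.fourier_coe] at h
    have hk : ∀ k : intLattice n, ∫ ξ, ec (-⟪ξ, y⟫) * ((𝓕 φ) k * (ec ⟪(k : Rn n), ξ⟫ * (𝓕 θ) ξ)) =
        (𝓕 φ) k * θ ((k : Rn n) - y) := fun k => by
      have h2 : ∀ ξ, ec (-⟪ξ, y⟫) * ((𝓕 φ) k * (ec ⟪(k : Rn n), ξ⟫ * (𝓕 θ) ξ)) =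
          (𝓕 φ) k * (ec ⟪ξ, (k : Rn n) - y⟫ * (𝓕 θ) ξ) := fun ξ => by
        rw [inner_sub_right, sub_eq_add_neg, ec_add, real_inner_comm ξ (k : Rn n)]
        ring
      simp only [h2]
      rw [integral_const_mul, ← fourierInv_eq_ec, ← SchwartzMap.fourierInv_coe,
        FourierTransform.fourierInv_fourier_eq]
    simp only [hk] at h
    exact h
  obtain ⟨M, hM⟩ := hf.exists_lintegral_le hq θ
  have hi : ∀ k : intLattice n, Integrable fun y : Rn n => (𝓕 φ) k * (θ ((k : Rn n) - y) * f y) :=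
    fun k => (hf.integrable_mul_comp_sub hq θ k).const_mul _
  have h := hasSum_integral_of_summable_integral_norm hi (by
    simp only [norm_mul]
    simp_rw [integral_const_mul]
    refine Summable.of_norm_bounded (hsum.norm.mul_right (M : ℝ)) fun k => ?_
    rw [norm_mul, norm_norm]
    refine mul_le_mul_of_nonneg_left ?_ (norm_nonneg _)
    have h1 : ∫ y, ‖θ ((k : Rn n) - y)‖ * ‖f y‖ =
        (∫⁻ y, ‖f y‖ₑ * ‖θ ((k : Rn n) - y)‖ₑ).toReal := by
      simp only [← norm_mul]
      rw [integral_norm_eq_lintegral_enorm (hf.integrable_mul_comp_sub hq θ k).1]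
      congr 1
      exact lintegral_congr fun y => by rw [enorm_mul, mul_comm]
    rw [h1, Real.norm_eq_abs, abs_of_nonneg ENNReal.toReal_nonneg]
    exact ENNReal.toReal_le_coe_of_le_coe (hM k))
  have h1 : ∀ y, ∑' k : intLattice n, (𝓕 φ) k * (θ ((k : Rn n) - y) * f y) = (𝓕 φ) y * f y :=
    fun y => by
      simp only [← mul_assoc]
      rw [tsum_mul_right, (hFφ y).tsum_eq]
  simp only [h1] at h
  have h2 : ∀ k : intLattice n, ∫ y, (𝓕 φ) k * (θ ((k : Rn n) - y) * f y) = 0 := fun k => by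
    rw [integral_const_mul]
    change (𝓕 φ) k * convS θ f k = 0
    rw [← hfθ, hf0, mul_zero]
  simp only [h2] at h
  exact (hasSum_zero.unique h).symm

/-! ### From regular compact sets to normalized spectral domains -/

/-- A shift along v changes ⟪v, x⟫ but not the projection on the hyperplane. Starting on or above
the graph it leads strictly above it, into K but off ∂K; the backward shift is treated in the same
way. -/
theorem IsRegularCompact.shift {n : ℕ} {K : Set (Rn n)} (hK : IsRegularCompact K) {x₀ : Rn n}
    (hx₀ : x₀ ∈ frontier K) : ∃ r > (0 : ℝ), ∃ v : Rn n, ∀ x ∈ Metric.ball x₀ r, ∀ ε : ℝ, 0 < ε →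
      ε < r → (x ∈ K → x + ε • v ∈ interior K) ∧ (x ∉ interior K → x - ε • v ∉ K) := by
  obtain ⟨V, hV, v, hv, A, -, h⟩ := hK.graph x₀ hx₀
  obtain ⟨R, hR, hRV⟩ := Metric.mem_nhds_iff.1 hV
  -- Half of R for the position of x and half for the length of the shift keep all points in V.
  refine ⟨R / 2, by positivity, v, fun x hx ε h0 hε => ?_⟩
  have hP : (ℝ ∙ v)ᗮ.orthogonalProjectionOnto v = 0 :=
    Submodule.orthogonalProjectionOnto_orthogonalComplement_singleton_eq_zero v
  have hvv : ⟪v, v⟫ = 1 := by rw [real_inner_self_eq_norm_sq, hv, one_pow]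
  have hball : ∀ t : ℝ, |t| < R / 2 → x + t • v ∈ V := fun t ht => hRV (by
    rw [Metric.mem_ball, dist_eq_norm] at hx ⊢
    have h1 : ‖x + t • v - x₀‖ ≤ ‖x - x₀‖ + ‖t • v‖ := by
      rw [add_sub_right_comm]; exact norm_add_le _ _
    rw [norm_smul, hv, mul_one, Real.norm_eq_abs] at h1
    linarith)
  have h0V := h x (by simpa using hball 0 (by simpa using half_pos hR))
  constructor
  · intro hxK
    have h1 := h _ (hball ε (by rwa [abs_of_pos h0]))
    rw [map_add, map_smul, hP, smul_zero, add_zero, inner_add_right, real_inner_smul_right, hvv,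
      mul_one] at h1
    have h2 := h0V.2.1 hxK
    have h3 : x + ε • v ∈ K := h1.2.2 (by linarith)
    by_contra hi
    have h4 := h1.1.1 ⟨subset_closure h3, hi⟩
    linarith
  · intro hxi hxK
    have h1 := h _ (hball (-ε) (by rwa [abs_neg, abs_of_pos h0]))
    rw [map_add, map_smul, hP, smul_zero, add_zero, inner_add_right, real_inner_smul_right, hvv,
      mul_one, neg_smul, ← sub_eq_add_neg] at h1
    have h2 := h1.2.1 hxK
    by_cases h3 : x ∈ K
    · have h4 := h0V.1.1 ⟨subset_closure h3, hxi⟩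
      linarith
    · exact h3 (h0V.2.2 (by linarith))

/-- The set `(2π)⁻¹ K`. -/
def normalize {n : ℕ} (K : Set (Rn n)) : Set (Rn n) := (fun x => (2 * Real.pi) • x) ⁻¹' K

theorem normalize_eq {n : ℕ} (K : Set (Rn n)) : normalize K =
    (Homeomorph.smulOfNeZero (2 * Real.pi) Real.two_pi_pos.ne' : Rn n ≃ₜ Rn n) ⁻¹' K := rfl

theorem isAddFundamentalDomain_normalize {n : ℕ} {K : Set (Rn n)}
    (hK : IsAddFundamentalDomain (twoPiLattice n) K volume) :
    IsAddFundamentalDomain (intLattice n) (normalize K) volume := by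
  have hpi := Real.two_pi_pos.ne'
  have hmem : ∀ g : twoPiLattice n, (2 * Real.pi)⁻¹ • (g : Rn n) ∈ intLattice n := by
    rintro ⟨_, x, hx, rfl⟩
    change (2 * Real.pi)⁻¹ • ((2 * Real.pi) • x) ∈ intLattice n
    rwa [inv_smul_smul₀ hpi]
  refine hK.preimage_of_equiv (f := fun x => (2 * Real.pi) • x) ?_
    (e := fun g => ⟨(2 * Real.pi)⁻¹ • (g : Rn n), hmem g⟩) ⟨?_, ?_⟩ ?_
  · refine ⟨measurable_const_smul _, ?_⟩
    rw [Measure.map_addHaar_smul _ hpi]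
    exact Measure.smul_absolutelyContinuous
  · intro a b hab
    have h : (2 * Real.pi)⁻¹ • (a : Rn n) = (2 * Real.pi)⁻¹ • (b : Rn n) := congrArg Subtype.val hab
    exact Subtype.ext (smul_right_injective _ (inv_ne_zero hpi) h)
  · intro k
    refine ⟨⟨(2 * Real.pi) • (k : Rn n), k, k.2, rfl⟩, Subtype.ext ?_⟩
    exact inv_smul_smul₀ hpi (k : Rn n)
  · intro g x
    change (2 * Real.pi) • ((2 * Real.pi)⁻¹ • (g : Rn n) + x) = (g : Rn n) + (2 * Real.pi) • x
    rw [smul_add, smul_inv_smul₀ hpi]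

theorem spectralDomain_normalize {n : ℕ} {K : Set (Rn n)} (hK : IsRegularCompact K)
    (hfund : IsAddFundamentalDomain (twoPiLattice n) K volume) :
    SpectralDomain (normalize K) where
  isCompact := by
    rw [normalize_eq, Homeomorph.isCompact_preimage]
    exact hK.isCompact
  fund := isAddFundamentalDomain_normalize hfund
  shift := by
    intro x₀ hx₀
    have hpi := Real.two_pi_pos
    rw [normalize_eq, ← Homeomorph.preimage_frontier] at hx₀
    obtain ⟨r, hr, v, h⟩ := hK.shift hx₀
    refine ⟨r / (2 * Real.pi), by positivity, v, r / (2 * Real.pi), by positivity,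
      fun x hx ε h0 hε => ?_⟩
    have h1 := h ((2 * Real.pi) • x) (by
      rw [Metric.mem_ball] at hx ⊢
      change dist ((2 * Real.pi) • x) ((2 * Real.pi) • x₀) < r
      rw [dist_smul₀, Real.norm_eq_abs, abs_of_pos hpi]
      rwa [lt_div_iff₀' hpi] at hx) ((2 * Real.pi) * ε) (by positivity) (by
      rwa [lt_div_iff₀' hpi] at hε)
    rw [mul_smul (2 * Real.pi) ε v, ← smul_add, ← smul_sub] at h1
    rw [normalize_eq, ← Homeomorph.preimage_interior]
    exact h1

theorem schwartzFourier_eq {n : ℕ} (φ : 𝓢(Rn n, ℂ)) (ξ : Rn n) : schwartzFourier φ ξ =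
    ((|(2 * Real.pi) ^ n| : ℝ) : ℂ) * (𝓕 (dilate (2 * Real.pi) Real.two_pi_pos.ne' φ)) ξ := by
  rw [fourier_dilate, ← mul_assoc, abs_inv, Complex.ofReal_inv, mul_inv_cancel₀, one_mul]
  · rfl
  · have := Real.pi_ne_zero
    simp [this]

/-- Trades the distributional support for a condition on test functions, in the normalization with
kernel exp(-2πi x·ξ). One direction glues local vanishing together by `fVanishOn_of_local`. -/
theorem mem_bandLimited_iff {n : ℕ} {K : Set (Rn n)} (hK : IsClosed K) {p : ℝ≥0∞} [Fact (1 ≤ p)]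
    (hp : 1 < p) (hp' : p ≠ ∞) {f : Lp ℂ p (volume : Measure (Rn n))} :
    f ∈ bandLimited K p ↔ FVanishOn f (normalize K)ᶜ := by
  have hpi := Real.two_pi_pos.ne'
  have hq : 1 < p.toReal := by
    simpa using (ENNReal.toReal_lt_toReal ENNReal.one_ne_top hp').2 hp
  have hf : FinLq p.toReal f := (finLq_iff_memLp (zero_lt_one.trans hp).ne' hp').2 (Lp.memLp f)
  have hval : ∀ φ : 𝓢(Rn n, ℂ), distributionFourier (f : 𝓢'(Rn n, ℂ)) φ =
      ((|(2 * Real.pi) ^ n| : ℝ) : ℂ) * ∫ x, (𝓕 (dilate (2 * Real.pi) hpi φ)) x * f x := by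
    intro φ
    rw [distributionFourier, Lp.toTemperedDistribution_apply, ← integral_const_mul]
    refine integral_congr_ae (Filter.Eventually.of_forall fun x => ?_)
    simp only [smul_eq_mul, schwartzFourier_eq, mul_assoc]
  rw [mem_bandLimited]
  constructor
  · intro h
    refine fVanishOn_of_local hq hf fun x hx => ?_
    have h1 : (2 * Real.pi) • x ∉ Distribution.dsupport (distributionFourier (f : 𝓢'(Rn n, ℂ))) :=
      fun h2 => hx (h h2)
    obtain ⟨s, hs, hso, hxs⟩ := (Distribution.notMem_dsupport_iff _).1 h1
    refine ⟨(fun x => (2 * Real.pi) • x) ⁻¹' s,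
      (hso.preimage (continuous_const_smul _)).mem_nhds hxs, fun φ _ hφs => ?_⟩
    have h2 := hs (dilate (2 * Real.pi)⁻¹ (inv_ne_zero hpi) φ) (by
      rw [tsupport_dilate]
      intro y hy
      have h3 := hφs hy
      rwa [Set.mem_preimage, smul_inv_smul₀ hpi] at h3)
    rw [hval] at h2
    have h3 : dilate (2 * Real.pi) hpi (dilate (2 * Real.pi)⁻¹ (inv_ne_zero hpi) φ) = φ := by
      ext y; rw [dilate_apply, dilate_apply, inv_smul_smul₀ hpi]
    rw [h3] at h2
    refine (mul_eq_zero.1 h2).resolve_left ?_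
    have := Real.pi_ne_zero
    simp [this]
  · intro h x hx
    by_contra hxK
    -- Intersecting with a ball forces the test functions to have compact support, as `FVanishOn`
    -- requires.
    refine absurd hx ((Distribution.notMem_dsupport_iff _).2
      ⟨Kᶜ ∩ Metric.ball x 1, fun φ hφ => ?_, hK.isOpen_compl.inter Metric.isOpen_ball, hxK,
        Metric.mem_ball_self one_pos⟩)
    have hφc : HasCompactSupport φ := by
      refine (isCompact_closedBall x 1).of_isClosed_subset (isClosed_tsupport φ) ?_
      exact (hφ.trans Set.inter_subset_right).trans Metric.ball_subset_closedBall
    rw [hval, h _ (hasCompactSupport_dilate hpi hφc), mul_zero]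
    rw [tsupport_dilate]
    intro y hy
    exact (hφ hy).1

/-! ### The kernel, the multiplier operator and the synthesis bound -/

/-- The indicator function of `D`. -/
def ind {n : ℕ} (D : Set (Rn n)) : Rn n → ℂ := D.indicator fun _ => 1

/-- The inverse Fourier transform of the indicator function of `D`. -/
def ker {n : ℕ} (D : Set (Rn n)) : Rn n → ℂ := 𝓕⁻ (ind D)

theorem integrable_ind {n : ℕ} {D : Set (Rn n)} (hD : IsCompact D) : Integrable (ind D) :=
  (integrable_indicator_iff hD.measurableSet).2 (integrableOn_const hD.measure_lt_top.ne)

theorem norm_ind_le {n : ℕ} (D : Set (Rn n)) (x : Rn n) : ‖ind D x‖ ≤ 1 := by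
  by_cases h : x ∈ D <;> simp [ind, h]

theorem ind_mul {n : ℕ} (D : Set (Rn n)) (f : Rn n → ℂ) :
    (fun x => ind D x * f x) = D.indicator f := by
  ext x
  by_cases h : x ∈ D <;> simp [ind, h]

theorem integrable_ind_mul {n : ℕ} {D : Set (Rn n)} (hD : IsCompact D) {f : Rn n → ℂ}
    (hf : Continuous f) : Integrable fun x => ind D x * f x := by
  rw [ind_mul, integrable_indicator_iff hD.measurableSet]
  exact hf.continuousOn.integrableOn_compact hD

theorem continuous_ker {n : ℕ} {D : Set (Rn n)} (hD : IsCompact D) : Continuous (ker D) :=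
  continuous_fourierInv (integrable_ind hD)

theorem ker_sub {n : ℕ} (D : Set (Rn n)) (x z : Rn n) :
    ker D (x - z) = ∫ ξ, ec ⟪ξ, x⟫ * (ec (-⟪z, ξ⟫) * ind D ξ) := by
  rw [ker, fourierInv_eq_ec]
  refine integral_congr_ae (Filter.Eventually.of_forall fun ξ => ?_)
  simp only
  rw [inner_sub_right, sub_eq_add_neg, ec_add, real_inner_comm ξ z, mul_assoc]

/-- The linear combination `∑ a(k) h(x - k)` of translates of `h = ker D`. -/
def kerSum {n : ℕ} (D : Set (Rn n)) (s : Finset (intLattice n)) (a : intLattice n → ℂ)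
    (x : Rn n) : ℂ := ∑ k ∈ s, a k * ker D (x - k)

theorem continuous_kerSum {n : ℕ} {D : Set (Rn n)} (hD : IsCompact D) (s : Finset (intLattice n))
    (a : intLattice n → ℂ) : Continuous (kerSum D s a) := by
  have := continuous_ker hD
  unfold kerSum
  fun_prop

theorem kerSum_eq {n : ℕ} {D : Set (Rn n)} (hD : IsCompact D) (s : Finset (intLattice n))
    (a : intLattice n → ℂ) :
    kerSum D s a = 𝓕⁻ (fun ξ => ind D ξ * ∑ k ∈ s, a k * ec (-⟪(k : Rn n), ξ⟫)) := by
  ext x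
  rw [fourierInv_eq_ec, kerSum]
  simp only [ker_sub, ← integral_const_mul]
  rw [← integral_finsetSum]
  · refine integral_congr_ae (Filter.Eventually.of_forall fun ξ => ?_)
    simp only [Finset.mul_sum]
    exact Finset.sum_congr rfl fun k _ => by ring
  · intro k _
    exact (integrable_ec_mul (integrable_ec_mul (integrable_ind hD) (by fun_prop))
      (by fun_prop)).const_mul _

/-- The Fourier multiplier operator with symbol the indicator function of `D`. -/
def op {n : ℕ} (D : Set (Rn n)) (g : Rn n → ℂ) : Rn n → ℂ := 𝓕⁻ (fun ξ => ind D ξ * 𝓕 g ξ)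

/-- The multiplier operator is convolution with the kernel: the Fourier transform is moved from g
onto the indicator function times a character. -/
theorem op_eq {n : ℕ} {D : Set (Rn n)} (hD : IsCompact D) {g : Rn n → ℂ} (hg : Integrable g)
    (x : Rn n) : op D g x = ∫ z, g z * ker D (x - z) := by
  have h := integral_fourier_mul_flip hg
    (integrable_ec_mul (integrable_ind hD) (by fun_prop : Continuous fun ξ : Rn n => ⟪ξ, x⟫))
  rw [op, fourierInv_eq_ec]
  convert h using 1
  · refine integral_congr_ae (Filter.Eventually.of_forall fun ξ => ?_)
    simp only
    ring
  · refine integral_congr_ae (Filter.Eventually.of_forall fun z => ?_)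
    simp only
    rw [fourier_eq_ec, ker_sub]
    congr 1
    refine integral_congr_ae (Filter.Eventually.of_forall fun ξ => ?_)
    simp only
    rw [real_inner_comm z ξ]
    ring

/-- The translates of `ker D` satisfy the upper `ℓ^q` bound with constant `C`. -/
def KerBound {n : ℕ} (D : Set (Rn n)) (q : ℝ) (C : ℝ≥0) : Prop :=
  ∀ (s : Finset (intLattice n)) (a : intLattice n → ℂ),
    ∫⁻ x, ‖kerSum D s a x‖ₑ ^ q ≤ C * ∑ k ∈ s, ‖a k‖ₑ ^ q

/-- The indicator function of `D` is an `L^p` Fourier multiplier with constant `C`. -/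
def MultiplierBound {n : ℕ} (D : Set (Rn n)) (p : ℝ≥0∞) (C : ℝ≥0) : Prop :=
  ∀ f : Lp ℂ 2 (volume : Measure (Rn n)), MemLp f p volume →
    ∃ g : Lp ℂ 2 (volume : Measure (Rn n)),
      (𝓕 g : Lp ℂ 2 (volume : Measure (Rn n))) =ᵐ[volume]
        (fun ξ => ind D ξ * (𝓕 f : Lp ℂ 2 (volume : Measure (Rn n))) ξ) ∧
      MemLp g p volume ∧ eLpNorm g p volume ≤ C * eLpNorm f p volume

theorem ae_comp_smul_iff {n : ℕ} {c : ℝ} (hc : c ≠ 0) {P : Rn n → Prop} :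
    (∀ᵐ x, P (c • x)) ↔ ∀ᵐ x, P x := by
  have hq : ∀ c : ℝ, c ≠ 0 → Measure.QuasiMeasurePreserving (fun x : Rn n => c • x) volume volume :=
    fun c hc => ⟨measurable_const_smul _, by
      rw [Measure.map_addHaar_smul _ hc]; exact Measure.smul_absolutelyContinuous⟩
  refine ⟨fun h => ?_, fun h => (hq c hc).ae h⟩
  have h1 := (hq c⁻¹ (inv_ne_zero hc)).ae h
  simpa only [smul_inv_smul₀ hc] using h1

theorem isFLpMultiplier_indicator_iff {n : ℕ} {K : Set (Rn n)} (hK : IsCompact K) {p : ℝ≥0∞} :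
    IsFLpMultiplier (K.indicator fun _ => (1 : ℂ)) p ↔ ∃ C, MultiplierBound (normalize K) p C := by
  have hpi := Real.two_pi_pos.ne'
  have key : ∀ f g : Lp ℂ 2 (volume : Measure (Rn n)),
      l2Fourier g =ᵐ[volume] (fun ξ => K.indicator (fun _ => (1 : ℂ)) ξ * l2Fourier f ξ) ↔
      (𝓕 g : Lp ℂ 2 (volume : Measure (Rn n))) =ᵐ[volume]
        (fun ξ => ind (normalize K) ξ * (𝓕 f : Lp ℂ 2 (volume : Measure (Rn n))) ξ) := by
    intro f g
    rw [Filter.EventuallyEq, Filter.EventuallyEq, ← ae_comp_smul_iff hpi]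
    simp only [l2Fourier, inv_smul_smul₀ hpi]
    rfl
  rw [IsFLpMultiplier]
  simp only [key]
  exact and_iff_right (measurable_const.indicator hK.measurableSet)

/-! ### Equivalence of the multiplier property and the synthesis bound -/

/-- If θ̂ = 1 near D, the multiplier turns θ(· - k) into `ker D` translated by k. For combinations
of translates of the Schwartz function θ the required bound is Schur's test. -/
theorem KerBound.of_multiplierBound {n : ℕ} {D : Set (Rn n)} (hD : IsCompact D) {p : ℝ≥0∞}
    (hp : 1 < p) (hp' : p ≠ ∞) {C : ℝ≥0} (h : MultiplierBound D p C) :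
    ∃ C', KerBound D p.toReal C' := by
  have hq : 1 < p.toReal := by
    simpa using (ENNReal.toReal_lt_toReal ENNReal.one_ne_top hp').2 hp
  have hp0 : p ≠ 0 := (zero_lt_one.trans hp).ne'
  obtain ⟨θ, -, -, hθ⟩ := SpectralDomain.exists_kernel isOpen_univ hD (Set.subset_univ D)
  obtain ⟨B, hB⟩ := exists_tsum_enorm_sub_le (reflect θ)
  set A := ∫⁻ x, ‖θ x‖ₑ
  have hA : A ≠ ∞ := (lintegral_enorm_schwartz_lt_top θ).ne
  have hT : (B : ℝ≥0∞) ^ (p.toReal - 1) * A ≠ ∞ := ENNReal.mul_ne_top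
    (ENNReal.rpow_ne_top_of_nonneg (by linarith) ENNReal.coe_ne_top) hA
  refine ⟨C ^ p.toReal * ((B : ℝ≥0∞) ^ (p.toReal - 1) * A).toNNReal, fun s a => ?_⟩
  set g₀ : 𝓢(Rn n, ℂ) := ∑ k ∈ s, a k • compSubConstCLM ℂ (k : Rn n) θ with hg₀
  have hg₀x : ∀ x, g₀ x = ∑ k ∈ s, a k * θ (x - k) := fun x => by
    simp [hg₀, _root_.sum_apply]
  have hbound : ∫⁻ x, ‖g₀ x‖ₑ ^ p.toReal ≤
      (B : ℝ≥0∞) ^ (p.toReal - 1) * A * ∑ k ∈ s, ‖a k‖ₑ ^ p.toReal := by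
    -- Schur's test between counting measure on the indices and Lebesgue measure.
    have h1 := lintegral_kernel_rpow_le (μ := (volume : Measure (Rn n)))
      (ν := (Measure.count : Measure (intLattice n)).restrict s) hq
      (f := fun k => ‖a k‖ₑ) (measurable_of_countable _).aemeasurable
      (k := fun x k => ‖θ (x - (k : Rn n))‖ₑ)
      (by exact measurable_from_prod_countable_left fun k =>
        (by fun_prop : Continuous fun x : Rn n => θ (x - (k : Rn n))).enorm.measurable)
      (A := B) (B := A) (fun x => ?_) (fun k => ?_)
    · refine le_trans (lintegral_mono fun x => ?_) (h1.trans (le_of_eq ?_))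
      · refine ENNReal.rpow_le_rpow ?_ (by linarith)
        rw [hg₀x, lintegral_finset s]
        refine (enorm_sum_le _ _).trans (Finset.sum_le_sum fun k _ => ?_)
        simp [enorm_mul]
      · rw [lintegral_finset s]
        simp
    · refine (setLIntegral_le_lintegral _ _).trans ?_
      rw [lintegral_count]
      simpa using hB x
    · exact (lintegral_sub_right_eq_self (fun y => ‖θ y‖ₑ) (k : Rn n)).le
  set f : Lp ℂ 2 (volume : Measure (Rn n)) := g₀.toLp 2 with hf
  have hfg : f =ᵐ[volume] g₀ := g₀.coeFn_toLp 2
  have hfin : ∑ k ∈ s, ‖a k‖ₑ ^ p.toReal ≠ ∞ := by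
    rw [ENNReal.sum_ne_top]
    exact fun k _ => ENNReal.rpow_ne_top_of_nonneg (by linarith) enorm_ne_top
  have hmem : MemLp f p volume :=
    (memLp_congr_ae hfg).2 ((finLq_iff_memLp hp0 hp').1
      ⟨g₀.continuous.aestronglyMeasurable, hbound.trans_lt (ENNReal.mul_ne_top hT hfin).lt_top⟩)
  obtain ⟨g, hg1, -, hg3⟩ := h f hmem
  have hFf := l2_fourier_ae_eq hfg g₀.integrable
  have hFg₀ : ∀ ξ ∈ D, 𝓕 (g₀ : Rn n → ℂ) ξ = ∑ k ∈ s, a k * ec (-⟪(k : Rn n), ξ⟫) := by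
    intro ξ hξ
    have h2 : 𝓕 g₀ = ∑ k ∈ s, a k • 𝓕 (compSubConstCLM ℂ (k : Rn n) θ) := by
      have := map_sum (fourierCLM ℂ 𝓢(Rn n, ℂ)) (fun k : intLattice n =>
        a k • compSubConstCLM ℂ (k : Rn n) θ) s
      simp only [map_smul] at this
      exact this
    rw [← SchwartzMap.fourier_coe, h2, _root_.sum_apply]
    refine Finset.sum_congr rfl fun k _ => ?_
    rw [_root_.smul_apply, fourier_compSubConst,
      (hθ.filter_mono (nhds_le_nhdsSet hξ)).self_of_nhds, mul_one, smul_eq_mul]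
  have hFg : (𝓕 g : Lp ℂ 2 (volume : Measure (Rn n))) =ᵐ[volume]
      (fun ξ => ind D ξ * ∑ k ∈ s, a k * ec (-⟪(k : Rn n), ξ⟫)) := by
    filter_upwards [hg1, hFf] with ξ h2 h3
    rw [h2, h3]
    by_cases hξ : ξ ∈ D
    · rw [hFg₀ ξ hξ]
    · simp [ind, hξ]
  have hgk : g =ᵐ[volume] kerSum D s a := by
    rw [kerSum_eq hD]
    refine l2_ae_eq_fourierInv (integrable_ind_mul hD ?_) hFg
    have := continuous_ec
    fun_prop
  have hrp : ∀ u : Rn n → ℂ, eLpNorm u p volume ^ p.toReal = ∫⁻ x, ‖u x‖ₑ ^ p.toReal := fun u => by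
    rw [eLpNorm_eq_lintegral_rpow_enorm_toReal hp0 hp', ← ENNReal.rpow_mul,
      one_div_mul_cancel (by linarith), ENNReal.rpow_one]
  rw [eLpNorm_congr_ae hgk, eLpNorm_congr_ae hfg] at hg3
  have h4 := ENNReal.rpow_le_rpow hg3 (by linarith : 0 ≤ p.toReal)
  rw [ENNReal.mul_rpow_of_nonneg _ _ (by linarith), hrp, hrp] at h4
  refine h4.trans ?_
  rw [ENNReal.coe_mul, ENNReal.coe_toNNReal hT, ENNReal.coe_rpow_of_nonneg _ (by linarith), mul_assoc]
  gcongr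

theorem norm_ker_le {n : ℕ} {D : Set (Rn n)} (x : Rn n) :
    ‖ker D x‖ ≤ ∫ ξ, ‖ind D ξ‖ := by
  rw [ker, fourierInv_eq_ec]
  refine (norm_integral_le_integral_norm _).trans (le_of_eq ?_)
  simp

/-- Cutting ℝⁿ into unit cubes turns convolution with the kernel into the mean over y in the cube of
the sums ∑ g(k + y) h(x - y - k). Jensen's inequality over the cube and the hypothesis for each y
give the bound, and the cubes are then reassembled. -/
theorem KerBound.lintegral_op_le {n : ℕ} {D : Set (Rn n)} (hD : IsCompact D) {q : ℝ} (hq : 1 < q)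
    {C : ℝ≥0} (h : KerBound D q C) {g : Rn n → ℂ} (hgm : Measurable g) (hg : Integrable g) {R : ℝ}
    (hR : ∀ x, g x ≠ 0 → ‖x‖ ≤ R) : ∫⁻ x, ‖op D g x‖ₑ ^ q ≤ C * ∫⁻ x, ‖g x‖ₑ ^ q := by
  have hq0 : (0 : ℝ) ≤ q := by linarith
  -- If g(k + y) ≠ 0 with y in the cube, then |k| ≤ R + n; only finitely many translates contribute.
  set s : Finset (intLattice n) := (finite_int_norm_le (R + n)).toFinset with hs
  have hg0 : ∀ y ∈ cube n, ∀ k : intLattice n, k ∉ s → g ((k : Rn n) + y) = 0 := by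
    intro y hy k hk
    by_contra h0
    refine hk ?_
    rw [hs, Set.Finite.mem_toFinset]
    have h1 := hR _ h0
    have h2 := norm_le_of_mem_cube hy
    have h3 : ‖(k : Rn n)‖ ≤ ‖(k : Rn n) + y‖ + ‖y‖ := by simpa using norm_sub_le ((k : Rn n) + y) y
    change ‖(k : Rn n)‖ ≤ R + n
    linarith
  have hkc := continuous_ker hD
  have hop : ∀ x, op D g x = ∫ y in cube n, kerSum D s (fun k => g ((k : Rn n) + y)) (x - y) := by
    intro x
    have hF : Integrable fun z => g z * ker D (x - z) :=
      hg.mul_bdd (c := ∫ ξ, ‖ind D ξ‖)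
        (by fun_prop : Continuous fun z => ker D (x - z)).aestronglyMeasurable
        (Filter.Eventually.of_forall fun z => norm_ker_le _)
    have hFk : ∀ k : intLattice n, Integrable (fun y => g ((k : Rn n) + y) *
        ker D (x - ((k : Rn n) + y))) (volume.restrict (cube n)) := fun k =>
      (hF.comp_add_left (k : Rn n)).integrableOn
    rw [op_eq hD hg, (isAddFundamentalDomain_cube n).integral_eq_tsum'' _ hF,
      tsum_eq_sum (s := s)]
    · rw [← integral_finsetSum]
      · refine integral_congr_ae (Filter.Eventually.of_forall fun y => ?_)
        refine Finset.sum_congr rfl fun k _ => ?_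
        change g ((k : Rn n) + y) * ker D (x - ((k : Rn n) + y)) = _
        rw [sub_sub, add_comm y]
      · exact fun k _ => hFk k
    · intro k hk
      refine setIntegral_eq_zero_of_forall_eq_zero fun y hy => ?_
      change g ((k : Rn n) + y) * _ = 0
      rw [hg0 y hy k hk, zero_mul]
  have hmeas : Measurable fun z : Rn n × Rn n =>
      kerSum D s (fun k => g ((k : Rn n) + z.2)) (z.1 - z.2) := by
    unfold kerSum
    refine Finset.measurable_fun_sum _ fun k _ => ?_
    refine (hgm.comp (measurable_const.add measurable_snd)).mul ?_
    exact (by fun_prop : Continuous fun z : Rn n × Rn n => ker D (z.1 - z.2 - k)).measurable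
  have hjensen : ∀ x, ‖op D g x‖ₑ ^ q ≤
      ∫⁻ y in cube n, ‖kerSum D s (fun k => g ((k : Rn n) + y)) (x - y)‖ₑ ^ q := by
    intro x
    have h1 := lintegral_mul_rpow_le_of_le (μ := volume.restrict (cube n)) hq
      (f := fun y => ‖kerSum D s (fun k => g ((k : Rn n) + y)) (x - y)‖ₑ)
      (k := fun _ => 1) (hmeas.comp measurable_prodMk_left).enorm.aemeasurable
      aemeasurable_const (A := 1) (B := 1) (by simp [volume_cube]) (fun _ => le_rfl)
    simp only [mul_one, ENNReal.one_rpow, one_mul] at h1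
    refine (ENNReal.rpow_le_rpow ?_ hq0).trans h1
    rw [hop]
    exact enorm_integral_le_lintegral_enorm _
  calc ∫⁻ x, ‖op D g x‖ₑ ^ q
      ≤ ∫⁻ x, ∫⁻ y in cube n, ‖kerSum D s (fun k => g ((k : Rn n) + y)) (x - y)‖ₑ ^ q :=
        lintegral_mono hjensen
    _ = ∫⁻ y in cube n, ∫⁻ x, ‖kerSum D s (fun k => g ((k : Rn n) + y)) (x - y)‖ₑ ^ q :=
        lintegral_lintegral_swap (hmeas.enorm.pow_const q).aemeasurable
    _ ≤ ∫⁻ y in cube n, C * ∑' k : intLattice n, ‖g ((k : Rn n) + y)‖ₑ ^ q := by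
        refine lintegral_mono fun y => ?_
        rw [lintegral_sub_right_eq_self
          (fun x => ‖kerSum D s (fun k => g ((k : Rn n) + y)) x‖ₑ ^ q) y]
        refine (h s _).trans ?_
        gcongr
        exact ENNReal.sum_le_tsum s
    _ = C * ∫⁻ x, ‖g x‖ₑ ^ q := by
        rw [lintegral_const_mul' _ _ ENNReal.coe_ne_top,
          lintegral_eq_lintegral_cube_tsum (hgm.enorm.pow_const q)]

/-- Multiplication of the Plancherel transform by the indicator function of `D`. -/
def l2op {n : ℕ} {D : Set (Rn n)} (hD : IsCompact D) (f : Lp ℂ 2 (volume : Measure (Rn n))) :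
    Lp ℂ 2 (volume : Measure (Rn n)) :=
  𝓕⁻ (((Lp.memLp (𝓕 f : Lp ℂ 2 (volume : Measure (Rn n)))).indicator hD.measurableSet).toLp _)

theorem fourier_l2op {n : ℕ} {D : Set (Rn n)} (hD : IsCompact D)
    (f : Lp ℂ 2 (volume : Measure (Rn n))) :
    (𝓕 (l2op hD f) : Lp ℂ 2 (volume : Measure (Rn n))) =ᵐ[volume]
      fun ξ => ind D ξ * (𝓕 f : Lp ℂ 2 (volume : Measure (Rn n))) ξ := by
  rw [l2op, FourierTransform.fourier_fourierInv_eq, ind_mul]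
  exact MemLp.coeFn_toLp _

theorem dist_l2op_le {n : ℕ} {D : Set (Rn n)} (hD : IsCompact D)
    (f g : Lp ℂ 2 (volume : Measure (Rn n))) : dist (l2op hD f) (l2op hD g) ≤ dist f g := by
  have h1 : dist (l2op hD f) (l2op hD g) =
      dist (𝓕 (l2op hD f) : Lp ℂ 2 (volume : Measure (Rn n))) (𝓕 (l2op hD g)) :=
    ((Lp.fourierTransformₗᵢ (Rn n) ℂ).dist_map _ _).symm
  have h2 : dist f g = dist (𝓕 f : Lp ℂ 2 (volume : Measure (Rn n))) (𝓕 g) :=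
    ((Lp.fourierTransformₗᵢ (Rn n) ℂ).dist_map _ _).symm
  rw [h1, h2, dist_eq_norm, dist_eq_norm]
  refine Lp.norm_le_norm_of_ae_le ?_
  filter_upwards [fourier_l2op hD f, fourier_l2op hD g,
    Lp.coeFn_sub (𝓕 (l2op hD f) : Lp ℂ 2 (volume : Measure (Rn n))) (𝓕 (l2op hD g)),
    Lp.coeFn_sub (𝓕 f : Lp ℂ 2 (volume : Measure (Rn n))) (𝓕 g)] with x hx1 hx2 hx3 hx4
  rw [hx3, hx4, Pi.sub_apply, Pi.sub_apply, hx1, hx2, ← mul_sub, norm_mul]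
  exact mul_le_of_le_one_left (norm_nonneg _) (norm_ind_le D x)

theorem l2op_ae_eq_op {n : ℕ} {D : Set (Rn n)} (hD : IsCompact D)
    {f : Lp ℂ 2 (volume : Measure (Rn n))} {f₀ : Rn n → ℂ} (hf : f =ᵐ[volume] f₀)
    (hf₀ : Integrable f₀) : l2op hD f =ᵐ[volume] op D f₀ := by
  refine l2_ae_eq_fourierInv (integrable_ind_mul hD (continuous_fourier hf₀)) ?_
  filter_upwards [fourier_l2op hD f, l2_fourier_ae_eq hf hf₀] with ξ h1 h2
  rw [h1, h2]

theorem tendsto_toLp_indicator_closedBall {n : ℕ} (f : Lp ℂ 2 (volume : Measure (Rn n))) :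
    Filter.Tendsto (fun j : ℕ => ((Lp.memLp f).indicator
      (measurableSet_closedBall (x := (0 : Rn n)) (ε := (j : ℝ)))).toLp _) Filter.atTop (𝓝 f) := by
  rw [Lp.tendsto_Lp_iff_tendsto_eLpNorm']
  have h1 : ∀ j : ℕ, eLpNorm (⇑(((Lp.memLp f).indicator (measurableSet_closedBall (x := (0 : Rn n))
      (ε := (j : ℝ)))).toLp _) - ⇑f) 2 volume =
      (∫⁻ x, ‖(Metric.closedBall (0 : Rn n) j).indicator f x - f x‖ₑ ^ (2 : ℝ)) ^ (1 / (2 : ℝ)) := by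
    intro j
    rw [eLpNorm_congr_ae ((MemLp.coeFn_toLp _).sub Filter.EventuallyEq.rfl),
      eLpNorm_eq_lintegral_rpow_enorm_toReal (by norm_num) (by norm_num)]
    simp
  simp only [h1]
  have h2 : Filter.Tendsto (fun j : ℕ =>
      ∫⁻ x, ‖(Metric.closedBall (0 : Rn n) j).indicator f x - f x‖ₑ ^ (2 : ℝ))
      Filter.atTop (𝓝 (∫⁻ _x : Rn n, 0)) := by
    refine tendsto_lintegral_of_dominated_convergence' (fun x => ‖f x‖ₑ ^ (2 : ℝ)) (fun j => ?_)
      (fun j => Filter.Eventually.of_forall fun x => ?_) ?_ (Filter.Eventually.of_forall fun x => ?_)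
    · exact ((((Lp.stronglyMeasurable f).measurable.indicator measurableSet_closedBall).sub
        (Lp.stronglyMeasurable f).measurable).enorm.pow_const _).aemeasurable
    · refine ENNReal.rpow_le_rpow ?_ (by norm_num)
      by_cases hx : x ∈ Metric.closedBall (0 : Rn n) j <;> simp [hx]
    · have := (Lp.memLp f).eLpNorm_lt_top
      rw [eLpNorm_lt_top_iff_lintegral_rpow_enorm_lt_top (by norm_num) (by norm_num)] at this
      simpa using this.ne
    · refine tendsto_const_nhds.congr' ?_
      filter_upwards [Filter.eventually_ge_atTop ⌈‖x‖⌉₊] with j hj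
      have hx : x ∈ Metric.closedBall (0 : Rn n) j := by
        rw [mem_closedBall_zero_iff]
        exact (Nat.le_ceil _).trans (by exact_mod_cast hj)
      simp [hx]
  rw [lintegral_zero] at h2
  have h3 := (ENNReal.continuous_rpow_const (y := 1 / (2 : ℝ))).tendsto 0
  rw [ENNReal.zero_rpow_of_pos (by norm_num)] at h3
  exact h3.comp h2

/-- The bound holds for the truncations of f to balls. These converge in L², where the multiplier is
a contraction, and Fatou's lemma along an almost everywhere convergent subsequence preserves the L^p
bound. -/
theorem MultiplierBound.of_kerBound {n : ℕ} {D : Set (Rn n)} (hD : IsCompact D) {p : ℝ≥0∞}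
    (hp : 1 < p) (hp' : p ≠ ∞) {C : ℝ≥0} (h : KerBound D p.toReal C) :
    MultiplierBound D p (C ^ (1 / p.toReal)) := by
  have hq : 1 < p.toReal := by
    simpa using (ENNReal.toReal_lt_toReal ENNReal.one_ne_top hp').2 hp
  have hp0 : p ≠ 0 := (zero_lt_one.trans hp).ne'
  intro f hf
  set f₀ : ℕ → Rn n → ℂ := fun j => (Metric.closedBall (0 : Rn n) j).indicator f with hf₀
  set F : ℕ → Lp ℂ 2 (volume : Measure (Rn n)) := fun j => ((Lp.memLp f).indicator
    (measurableSet_closedBall (x := (0 : Rn n)) (ε := (j : ℝ)))).toLp _ with hF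
  have hFf : ∀ j, F j =ᵐ[volume] f₀ j := fun j => MemLp.coeFn_toLp _
  have hf₀i : ∀ j, Integrable (f₀ j) := fun j => by
    rw [hf₀, integrable_indicator_iff measurableSet_closedBall]
    exact ((Lp.memLp f).locallyIntegrable (by norm_num)).integrableOn_isCompact
      (isCompact_closedBall _ _)
  have hbound : ∀ j, eLpNorm (l2op hD (F j)) p volume ≤
      (C ^ (1 / p.toReal) : ℝ≥0) * eLpNorm f p volume := by
    intro j
    rw [eLpNorm_congr_ae (l2op_ae_eq_op hD (hFf j) (hf₀i j)),
      eLpNorm_eq_lintegral_rpow_enorm_toReal hp0 hp', eLpNorm_eq_lintegral_rpow_enorm_toReal hp0 hp',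
      ENNReal.coe_rpow_of_nonneg _ (by positivity), ← ENNReal.mul_rpow_of_nonneg _ _ (by positivity)]
    refine ENNReal.rpow_le_rpow ?_ (by positivity)
    refine (h.lintegral_op_le hD hq
      ((Lp.stronglyMeasurable f).measurable.indicator measurableSet_closedBall) (hf₀i j)
      (R := j) fun x hx => ?_).trans ?_
    · by_contra hn
      refine hx (Set.indicator_of_notMem ?_ _)
      rwa [mem_closedBall_zero_iff]
    · gcongr with x
      by_cases hx : x ∈ Metric.closedBall (0 : Rn n) j <;> simp [hx]
  have htend : Filter.Tendsto (fun j => l2op hD (F j)) Filter.atTop (𝓝 (l2op hD f)) := by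
    rw [tendsto_iff_dist_tendsto_zero]
    exact squeeze_zero (fun _ => dist_nonneg) (fun j => dist_l2op_le hD _ _)
      (tendsto_iff_dist_tendsto_zero.1 (tendsto_toLp_indicator_closedBall f))
  obtain ⟨ns, -, hns⟩ := (tendstoInMeasure_of_tendsto_Lp htend).exists_seq_tendsto_ae
  have hlim := Lp.eLpNorm_lim_le_liminf_eLpNorm (p := p) (fun j => (Lp.aestronglyMeasurable
    (l2op hD (F (ns j))))) _ hns
  have hle : eLpNorm (l2op hD f) p volume ≤ (C ^ (1 / p.toReal) : ℝ≥0) * eLpNorm f p volume :=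
    hlim.trans (Filter.liminf_le_of_frequently_le'
      (Filter.Eventually.of_forall fun j => hbound (ns j)).frequently)
  exact ⟨l2op hD f, fourier_l2op hD f, ⟨Lp.aestronglyMeasurable _,
    hle.trans_lt (ENNReal.mul_lt_top ENNReal.coe_lt_top hf.2)⟩, hle⟩

/-! ### Uniqueness for functions vanishing on the lattice -/

theorem integral_fourier_mul_fourierInv {n : ℕ} (φ : 𝓢(Rn n, ℂ)) {w : Rn n → ℂ}
    (hw : Integrable w) : ∫ x, (𝓕 φ) x * 𝓕⁻ w x = ∫ x, φ x * w x := by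
  have h := integral_fourier_mul_flip (𝓕 φ).integrable hw.comp_neg
  have h3 : 𝓕 (fun x => w (-x)) = 𝓕⁻ w := (Real.fourierInv_eq_fourier_comp_neg w).symm
  rw [h3] at h
  rw [← h, ← integral_neg_eq_self]
  refine integral_congr_ae (Filter.Eventually.of_forall fun x => ?_)
  simp only
  rw [neg_neg, ← Real.fourierInv_eq_fourier_neg, ← SchwartzMap.fourierInv_coe,
    FourierTransform.fourierInv_fourier_eq]

theorem fVanishOn_kerSum {n : ℕ} {D : Set (Rn n)} (hD : IsCompact D) (s : Finset (intLattice n))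
    (a : intLattice n → ℂ) : FVanishOn (kerSum D s a) Dᶜ := by
  intro φ _ hφD
  rw [kerSum_eq hD, integral_fourier_mul_fourierInv]
  · refine integral_eq_zero_of_ae (Filter.Eventually.of_forall fun x => ?_)
    by_cases hx : x ∈ D
    · have : φ x = 0 := image_eq_zero_of_notMem_tsupport fun h => hφD h hx
      simp [this]
    · simp [ind, hx]
  · have := continuous_ec
    exact integrable_ind_mul hD (by fun_prop)

theorem exists_schwartz_convolution {n : ℕ} {w : Rn n → ℂ} (hw : Integrable w) {C : Set (Rn n)}
    (hC : IsCompact C) (hwC : ∀ x ∉ C, w x = 0) {ρ : 𝓢(Rn n, ℂ)} {δ : ℝ} (hρc : HasCompactSupport ρ)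
    (hρ : tsupport ρ ⊆ Metric.closedBall 0 δ) : ∃ φ : 𝓢(Rn n, ℂ), HasCompactSupport φ ∧
      tsupport φ ⊆ Metric.cthickening δ C ∧ ∀ ξ, (𝓕 φ) ξ = 𝓕 w ξ * (𝓕 ρ) ξ := by
  have hwc : HasCompactSupport w := HasCompactSupport.intro hC hwC
  set u : Rn n → ℂ := convolution w ρ (ContinuousLinearMap.mul ℝ ℂ) volume with hu
  have huc : HasCompactSupport u := hwc.convolution _ hρc
  have hus : ContDiff ℝ ((⊤ : ℕ∞) : WithTop ℕ∞) u :=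
    hρc.contDiff_convolution_right _ hw.locallyIntegrable (ρ.smooth ⊤)
  have hval : ∀ x, u x = ∫ t, w t * ρ (x - t) := fun x => rfl
  have hfour : ∀ ξ, 𝓕 u ξ = 𝓕 w ξ * 𝓕 (ρ : Rn n → ℂ) ξ := fun ξ =>
    Real.fourier_mul_convolution_eq hw ρ.integrable ξ
  clear_value u
  refine ⟨huc.toSchwartzMap hus, huc, ?_, fun ξ => ?_⟩
  · refine closure_minimal (fun x hx => ?_) Metric.isClosed_cthickening
    by_contra hn
    refine hx ?_
    change u x = 0
    rw [hval]
    refine integral_eq_zero_of_ae (Filter.Eventually.of_forall fun t => ?_)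
    by_cases ht : t ∈ C
    · have : ρ (x - t) = 0 := image_eq_zero_of_notMem_tsupport fun h => hn <|
        Metric.mem_cthickening_of_dist_le x t δ C ht (by simpa [dist_eq_norm] using hρ h)
      simp [this]
    · simp [hwC t ht]
  · rw [SchwartzMap.fourier_coe, SchwartzMap.fourier_coe]
    exact hfour ξ

/-- Extends the vanishing from smooth to merely integrable test functions. Convolving w with a bump
of scale 1/c keeps the support in U and multiplies `𝓕 w` by a constant times 𝓕 ρ (x / c); dominated
convergence as c → ∞ concludes. -/
theorem FVanishOn.integral_eq_zero {n : ℕ} {F : Rn n → ℂ} {U C : Set (Rn n)} (hF : FVanishOn F U)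
    (hU : IsOpen U) (hC : IsCompact C) (hCU : C ⊆ U) {w : Rn n → ℂ} (hw : Integrable w)
    (hwC : ∀ x ∉ C, w x = 0) (hwF : Integrable fun x => 𝓕 w x * F x) :
    ∫ x, 𝓕 w x * F x = 0 := by
  obtain ⟨ρ, hρ, hρc, -, hρ0⟩ := exists_bump n
  obtain ⟨δ, hδ, hδU⟩ := hC.exists_cthickening_subset_open hU hCU
  obtain ⟨B, hB0, hB⟩ := exists_norm_le_wt (𝓕 ρ)
  have hzero : ∀ᶠ c : ℝ in Filter.atTop, ∫ x, (𝓕 ρ) (c⁻¹ • x) * (𝓕 w x * F x) = 0 := by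
    filter_upwards [Filter.eventually_ge_atTop δ⁻¹, Filter.eventually_gt_atTop 0] with c hc hc0
    have hρδ : tsupport (dilate c hc0.ne' ρ) ⊆ Metric.closedBall 0 δ := by
      rw [tsupport_dilate]
      intro x hx
      have h1 := hρ hx
      rw [mem_ball_zero_iff, norm_smul, Real.norm_eq_abs, abs_of_pos hc0] at h1
      rw [mem_closedBall_zero_iff]
      have h2 : δ⁻¹ * ‖x‖ ≤ 1 := (mul_le_mul_of_nonneg_right hc (norm_nonneg x)).trans h1.le
      rwa [inv_mul_le_iff₀ hδ, mul_one] at h2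
    obtain ⟨φ, hφ1, hφ2, hφ3⟩ := exists_schwartz_convolution hw hC hwC
      (hasCompactSupport_dilate hc0.ne' hρc) hρδ
    have h3 := hF φ hφ1 (hφ2.trans hδU)
    have h4 : ∫ x, (𝓕 φ) x * F x =
        ((|(c ^ n)⁻¹| : ℝ) : ℂ) * ∫ x, (𝓕 ρ) (c⁻¹ • x) * (𝓕 w x * F x) := by
      rw [← integral_const_mul]
      refine integral_congr_ae (Filter.Eventually.of_forall fun x => ?_)
      simp only [hφ3, fourier_dilate]
      ring
    rw [h4] at h3
    refine (mul_eq_zero.1 h3).resolve_left ?_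
    exact_mod_cast abs_ne_zero.2 (inv_ne_zero (pow_ne_zero n hc0.ne'))
  have hlim : Filter.Tendsto (fun c : ℝ => ∫ x, (𝓕 ρ) (c⁻¹ • x) * (𝓕 w x * F x)) Filter.atTop
      (𝓝 (∫ x, (𝓕 ρ) 0 * (𝓕 w x * F x))) := by
    refine tendsto_integral_filter_of_dominated_convergence (fun x => B * ‖𝓕 w x * F x‖) ?_ ?_
      (hwF.norm.const_mul B) ?_
    · exact Filter.Eventually.of_forall fun c =>
        (by fun_prop : Continuous fun x : Rn n => (𝓕 ρ) (c⁻¹ • x)).aestronglyMeasurable.mul hwF.1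
    · refine Filter.Eventually.of_forall fun c => Filter.Eventually.of_forall fun x => ?_
      rw [norm_mul]
      exact mul_le_mul_of_nonneg_right
        ((hB _).trans (mul_le_of_le_one_right hB0.le (wt_le_one _))) (norm_nonneg _)
    · refine Filter.Eventually.of_forall fun x => ?_
      have h1 : Filter.Tendsto (fun c : ℝ => c⁻¹ • x) Filter.atTop (𝓝 0) := by
        have := (tendsto_inv_atTop_zero (𝕜 := ℝ)).smul_const x
        simpa using this
      exact (((𝓕 ρ).continuous.tendsto 0).comp h1).mul_const _
  have h := tendsto_nhds_unique (hlim.congr' hzero) tendsto_const_nhds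
  rw [integral_const_mul] at h
  exact (mul_eq_zero.1 h).resolve_left hρ0

theorem fourier_comp_sub {n : ℕ} (w : Rn n → ℂ) (a x : Rn n) :
    𝓕 (fun y => w (y - a)) x = ec (-⟪a, x⟫) * 𝓕 w x := by
  rw [fourier_eq_ec, fourier_eq_ec, ← integral_const_mul, ← integral_add_right_eq_self _ a]
  refine integral_congr_ae (Filter.Eventually.of_forall fun y => ?_)
  simp only [add_sub_cancel_right]
  rw [inner_add_left, neg_add, ec_add]
  ring

/-- If `w` can be pushed by small translations into compact subsets of `U`, then `F` annihilates its
Fourier transform. -/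
theorem FVanishOn.integral_eq_zero_of_shift {n : ℕ} {F : Rn n → ℂ} {U : Set (Rn n)}
    (hF : FVanishOn F U) (hU : IsOpen U) {C : Set (Rn n)} (hC : IsCompact C) {v : Rn n} {ε₀ : ℝ}
    (hε₀ : 0 < ε₀) (hCU : ∀ x ∈ C, ∀ ε, 0 < ε → ε < ε₀ → x + ε • v ∈ U) {w : Rn n → ℂ}
    (hw : Integrable w) (hwC : ∀ x ∉ C, w x = 0) (hwF : Integrable fun x => 𝓕 w x * F x) :
    ∫ x, 𝓕 w x * F x = 0 := by
  -- Translating w by ε v multiplies its transform by a factor of modulus one that tends to 1 with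
  -- ε, so the passage to the limit is dominated.
  have hzero : ∀ᶠ ε : ℝ in 𝓝[>] 0, ∫ x, ec (-⟪ε • v, x⟫) * (𝓕 w x * F x) = 0 := by
    filter_upwards [Ioo_mem_nhdsGT hε₀] with ε hε
    have h1 : ∀ x, 𝓕 (fun y => w (y - ε • v)) x * F x = ec (-⟪ε • v, x⟫) * (𝓕 w x * F x) :=
      fun x => by rw [fourier_comp_sub, mul_assoc]
    have h2 := hF.integral_eq_zero hU (hC.image (continuous_add_const (ε • v))) ?_
      (hw.comp_sub_right (ε • v)) ?_ ?_
    · simpa only [h1] using h2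
    · rintro _ ⟨x, hx, rfl⟩
      exact hCU x hx ε hε.1 hε.2
    · intro x hx
      exact hwC _ fun h => hx ⟨_, h, by simp⟩
    · simp only [h1]
      exact integrable_ec_mul hwF (by fun_prop)
  have hlim : Filter.Tendsto (fun ε : ℝ => ∫ x, ec (-⟪ε • v, x⟫) * (𝓕 w x * F x)) (𝓝[>] 0)
      (𝓝 (∫ x, 𝓕 w x * F x)) := by
    refine tendsto_integral_filter_of_dominated_convergence (fun x => ‖𝓕 w x * F x‖) ?_ ?_
      hwF.norm ?_
    · exact Filter.Eventually.of_forall fun ε => (integrable_ec_mul hwF (by fun_prop)).1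
    · refine Filter.Eventually.of_forall fun ε => Filter.Eventually.of_forall fun x => ?_
      rw [norm_mul, norm_ec, one_mul]
    · refine Filter.Eventually.of_forall fun x => ?_
      have := continuous_ec
      have h1 : Continuous fun ε : ℝ => ec (-⟪ε • v, x⟫) * (𝓕 w x * F x) := by fun_prop
      have h2 := (h1.tendsto 0).mono_left (nhdsWithin_le_nhds (s := Set.Ioi 0))
      simpa using h2
  exact tendsto_nhds_unique (tendsto_const_nhds.congr' (hzero.mono fun _ h => h.symm)) hlim |>.symm

/-- Duality without the conjugate exponent: on a ball S choose g with |g| ≤ |F| and 𝓕 w · g = |𝓕 w ·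
F|, where w is the truncated test function. The integral of 𝓕 w · g equals that of 𝓕 φ · op D g,
which the L^q bound for `op D` controls independently of S. -/
theorem KerBound.integrable_fourier_ind_mul {n : ℕ} {D : Set (Rn n)} (hD : IsCompact D) {q : ℝ}
    (hq : 1 < q) {C : ℝ≥0} (h : KerBound D q C) {F : Rn n → ℂ} (hF : FinLq q F)
    (hFc : Continuous F) (φ : 𝓢(Rn n, ℂ)) :
    Integrable fun x => 𝓕 (fun ξ => ind D ξ * φ ξ) x * F x := by
  set w : Rn n → ℂ := fun ξ => ind D ξ * φ ξ with hw
  have hwi : Integrable w := integrable_ind_mul hD φ.continuous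
  have hwc : Continuous (𝓕 w) := continuous_fourier hwi
  obtain ⟨B, hB⟩ := exists_enorm_le (𝓕 φ)
  set A := ∫⁻ x, ‖(𝓕 φ) x‖ₑ
  have hA : A ≠ ∞ := (lintegral_enorm_schwartz_lt_top (𝓕 φ)).ne
  set T : ℝ≥0∞ := A ^ (q - 1) * (B * (C * ∫⁻ x, ‖F x‖ₑ ^ q))
  have hT : T ≠ ∞ := ENNReal.mul_ne_top (ENNReal.rpow_ne_top_of_nonneg (by linarith) hA)
    (ENNReal.mul_ne_top ENNReal.coe_ne_top (ENNReal.mul_ne_top ENNReal.coe_ne_top hF.2.ne))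
  have hT' : T ^ q⁻¹ ≠ ∞ := ENNReal.rpow_ne_top_of_nonneg (by positivity) hT
  have hcover : AECover (volume : Measure (Rn n)) Filter.atTop
      fun j : ℕ => Metric.closedBall (0 : Rn n) (j : ℝ) :=
    aecover_closedBall tendsto_natCast_atTop_atTop
  refine hcover.integrable_of_lintegral_enorm_bounded' (T ^ q⁻¹).toNNReal
    (hwc.mul hFc).aestronglyMeasurable (Filter.Eventually.of_forall fun j => ?_)
  rw [ENNReal.coe_toNNReal hT']
  set S := Metric.closedBall (0 : Rn n) (j : ℝ) with hS
  have hSm : MeasurableSet S := measurableSet_closedBall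
  -- At zeros of `𝓕 w` the quotient is 0 by the convention for division, which is harmless.
  set g : Rn n → ℂ := S.indicator fun x => (starRingEnd ℂ) (𝓕 w x) / ‖𝓕 w x‖ * ‖F x‖ with hg
  have hgm : Measurable g := by
    refine Measurable.indicator ?_ hSm
    exact ((Complex.continuous_conj.measurable.comp hwc.measurable).div
      (Complex.measurable_ofReal.comp hwc.norm.measurable)).mul
      (Complex.measurable_ofReal.comp hFc.norm.measurable)
  have hgF : ∀ x, ‖g x‖ ≤ ‖F x‖ := by
    intro x
    by_cases hx : x ∈ S
    · rw [hg, Set.indicator_of_mem hx, norm_mul, norm_div]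
      simp only [RCLike.norm_conj, Complex.norm_real, norm_norm]
      exact mul_le_of_le_one_left (norm_nonneg _) (div_self_le_one _)
    · rw [hg, Set.indicator_of_notMem hx, norm_zero]
      exact norm_nonneg _
  have hgi : Integrable g := by
    have h1 : Integrable (S.indicator F) :=
      (integrable_indicator_iff hSm).2 (hFc.continuousOn.integrableOn_compact (isCompact_closedBall _ _))
    refine h1.mono hgm.aestronglyMeasurable (Filter.Eventually.of_forall fun x => ?_)
    by_cases hx : x ∈ S
    · rw [Set.indicator_of_mem hx]
      exact hgF x
    · simp [hg, hx]
  have hval : ∀ x, 𝓕 w x * g x = ((S.indicator (fun x => ‖𝓕 w x * F x‖) x : ℝ) : ℂ) := by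
    intro x
    by_cases hx : x ∈ S
    · rw [hg, Set.indicator_of_mem hx, Set.indicator_of_mem hx, norm_mul]
      by_cases h0 : 𝓕 w x = 0
      · simp [h0]
      · have h1 : (‖𝓕 w x‖ : ℂ) ≠ 0 := by exact_mod_cast norm_ne_zero_iff.2 h0
        push_cast
        rw [← mul_assoc, mul_div_assoc', Complex.mul_conj, Complex.normSq_eq_norm_sq]
        push_cast
        field_simp
    · simp [hg, hx]
  have hSi : Integrable (S.indicator fun x => ‖𝓕 w x * F x‖) :=
    (integrable_indicator_iff hSm).2
      ((hwc.mul hFc).norm.continuousOn.integrableOn_compact (isCompact_closedBall _ _))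
  have h1 : ∫⁻ x in S, ‖𝓕 w x * F x‖ₑ = ‖∫ x, 𝓕 w x * g x‖ₑ := by
    simp only [hval]
    rw [integral_complex_ofReal, integral_indicator hSm]
    have h2 := ofReal_integral_norm_eq_lintegral_enorm
      ((hwc.mul hFc).continuousOn.integrableOn_compact (isCompact_closedBall (0 : Rn n) j)
        (μ := volume))
    refine h2.symm.trans ?_
    rw [← ofReal_norm, Complex.norm_real, Real.norm_of_nonneg (integral_nonneg fun x => norm_nonneg _)]
    rfl
  have h2 : ∫ x, 𝓕 w x * g x = ∫ x, (𝓕 φ) x * op D g x := by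
    rw [op, integral_fourier_mul_fourierInv φ (integrable_ind_mul hD (continuous_fourier hgi)),
      integral_fourier_mul_flip hwi hgi]
    refine integral_congr_ae (Filter.Eventually.of_forall fun x => ?_)
    simp only [hw]
    ring
  have hopc : Continuous (op D g) :=
    continuous_fourierInv (integrable_ind_mul hD (continuous_fourier hgi))
  have h3 : ‖∫ x, (𝓕 φ) x * op D g x‖ₑ ^ q ≤ T := by
    have h4 := lintegral_mul_rpow_le_of_le (μ := (volume : Measure (Rn n))) hq
      (f := fun x => ‖op D g x‖ₑ) (k := fun x => ‖(𝓕 φ) x‖ₑ) hopc.enorm.measurable.aemeasurable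
      (𝓕 φ).continuous.enorm.measurable.aemeasurable (A := A) (B := B) le_rfl hB
    refine (ENNReal.rpow_le_rpow ((enorm_integral_le_lintegral_enorm _).trans
      (lintegral_congr fun x => ?_).le) (by linarith)).trans (h4.trans ?_)
    · rw [enorm_mul, mul_comm]
    · refine mul_le_mul' le_rfl (mul_le_mul' le_rfl ?_)
      refine (h.lintegral_op_le hD hq hgm hgi (R := j) fun x hx => ?_).trans ?_
      · by_contra hn
        exact hx (Set.indicator_of_notMem (by rwa [hS, mem_closedBall_zero_iff]) _)
      · exact mul_le_mul' le_rfl (lintegral_mono fun x =>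
          ENNReal.rpow_le_rpow (enorm_le_iff_norm_le.2 (hgF x)) (by linarith))
  rw [h1, h2]
  have h5 := ENNReal.rpow_le_rpow h3 (by positivity : 0 ≤ q⁻¹)
  rwa [← ENNReal.rpow_mul, mul_inv_cancel₀ (by linarith), ENNReal.rpow_one] at h5

/-- Uniqueness: a function with spectrum in `D` that vanishes on `ℤⁿ` is zero. -/
theorem KerBound.ae_eq_zero {n : ℕ} {D : Set (Rn n)} (hD : SpectralDomain D) {q : ℝ}
    (hq : 1 < q) {C : ℝ≥0} (h : KerBound D q C) {F : Rn n → ℂ} (hF : FinLq q F)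
    (hFc : Continuous F) (hFD : FVanishOn F Dᶜ) (hF0 : ∀ k : intLattice n, F k = 0) :
    F =ᵐ[volume] 0 := by
  have hfr := hD.fVanishOn_compl_frontier hq hF hFc hFD hF0
  have hfro : IsOpen (frontier D)ᶜ := isClosed_frontier.isOpen_compl
  refine FVanishOn.ae_eq_zero hq hF (fVanishOn_of_local hq hF fun x₀ _ => ?_)
  by_cases hx₀ : x₀ ∈ frontier D
  swap
  · exact ⟨_, hfro.mem_nhds hx₀, hfr⟩
  obtain ⟨r, hr, v, ε₀, hε₀, hsh⟩ := hD.shift x₀ hx₀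
  refine ⟨Metric.ball x₀ r, Metric.ball_mem_nhds x₀ hr, fun φ hφ hφr => ?_⟩
  have hφi : Integrable fun x => (𝓕 φ) x * F x := hF.integrable_schwartz_mul hq (𝓕 φ)
  -- The test function is split into its parts inside and outside D. The first is pushed along v
  -- into the interior, the second along -v out of D, so both leave ∂D, which carries the spectrum.
  -- The splitting of the pairing is legitimate because 𝓕 w₁ · F is integrable, and this is where
  -- `KerBound` enters.
  set w₁ : Rn n → ℂ := fun ξ => ind D ξ * φ ξ with hw₁
  set w₂ : Rn n → ℂ := fun ξ => φ ξ - w₁ ξ with hw₂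
  have hw₁i : Integrable w₁ := integrable_ind_mul hD.isCompact φ.continuous
  have hw₂i : Integrable w₂ := φ.integrable.sub hw₁i
  have hi₁ := h.integrable_fourier_ind_mul hD.isCompact hq hF hFc φ
  have hsub : ∀ x, 𝓕 w₂ x = (𝓕 φ) x - 𝓕 w₁ x := by
    intro x
    rw [SchwartzMap.fourier_coe, fourier_eq_ec, fourier_eq_ec, fourier_eq_ec, ← integral_sub]
    · refine integral_congr_ae (Filter.Eventually.of_forall fun y => ?_)
      simp only [hw₂, mul_sub]
    · exact integrable_ec_mul φ.integrable (by fun_prop)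
    · exact integrable_ec_mul hw₁i (by fun_prop)
  have hi₂ : Integrable fun x => 𝓕 w₂ x * F x := by
    simp only [hsub, sub_mul]
    exact hφi.sub hi₁
  have h1 : ∫ x, 𝓕 w₁ x * F x = 0 := by
    refine hfr.integral_eq_zero_of_shift hfro (hφ.isCompact.inter_right hD.isCompact.isClosed) hε₀
      (v := v) (fun x hx ε h0 hε => ?_) hw₁i (fun x hx => ?_) hi₁
    · exact fun hn => hn.2 ((hsh x (hφr hx.1) ε h0 hε).1 hx.2)
    · by_cases hxD : x ∈ D
      · have : φ x = 0 := image_eq_zero_of_notMem_tsupport fun hx' => hx ⟨hx', hxD⟩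
        simp [hw₁, this]
      · simp [hw₁, ind, hxD]
  have h2 : ∫ x, 𝓕 w₂ x * F x = 0 := by
    refine hfr.integral_eq_zero_of_shift hfro (hφ.isCompact.inter_right
      (isOpen_interior (s := D)).isClosed_compl) hε₀
      (v := -v) (fun x hx ε h0 hε => ?_) hw₂i (fun x hx => ?_) hi₂
    · rw [smul_neg, ← sub_eq_add_neg]
      exact fun hn => (hsh x (hφr hx.1) ε h0 hε).2 hx.2 (hD.isCompact.isClosed.frontier_subset hn)
    · by_cases hxD : x ∈ D
      · simp [hw₂, hw₁, ind, hxD]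
      · have : φ x = 0 := image_eq_zero_of_notMem_tsupport fun hx' =>
          hx ⟨hx', fun hn => hxD (interior_subset hn)⟩
        simp [hw₂, hw₁, this]
  simp only [hsub, sub_mul] at h2
  rwa [integral_sub hφi hi₁, h1, sub_zero] at h2

/-! ### The sampling operator and its inverse -/

theorem one_lt_toReal {p : ℝ≥0∞} (hp : 1 < p) (hp' : p ≠ ∞) : 1 < p.toReal := by
  simpa using (ENNReal.toReal_lt_toReal ENNReal.one_ne_top hp').2 hp

/-- For k ≠ 0 this is the integral of a nontrivial periodic character over D. Moving D by y with ⟪y,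
k⟫ = 1/2 changes its sign, whereas the integral is the same over every fundamental domain. -/
theorem SpectralDomain.ker_int {n : ℕ} {D : Set (Rn n)} (hD : SpectralDomain D)
    (k : intLattice n) : ker D k = if k = 0 then 1 else 0 := by
  have h0 : ker D k = ∫ ξ in D, ec ⟪ξ, (k : Rn n)⟫ := by
    rw [ker, fourierInv_eq_ec, ← integral_indicator hD.isCompact.measurableSet, ← ind_mul]
    simp only [mul_comm]
  rw [h0]
  split_ifs with hk
  · subst hk
    simp [Measure.real, hD.volume_eq_one]
  have hkn : (k : Rn n) ≠ 0 := fun h => hk (Subtype.ext h)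
  set y : Rn n := (1 / (2 * ‖(k : Rn n)‖ ^ 2)) • (k : Rn n) with hy
  have hyk : ⟪y, (k : Rn n)⟫ = 1 / 2 := by
    have := norm_ne_zero_iff.2 hkn
    rw [hy, real_inner_smul_left, real_inner_self_eq_norm_sq]
    field_simp
  have hec : ec (1 / 2) = -1 := by
    rw [ec, ← Complex.exp_pi_mul_I]
    congr 1
    push_cast
    ring
  have h1 : ∫ ξ in y +ᵥ D, ec ⟪ξ, (k : Rn n)⟫ = ∫ ξ in D, ec ⟪ξ, (k : Rn n)⟫ := by
    refine (hD.fund.vadd_of_comm y).setIntegral_eq hD.fund fun l x => ?_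
    change ec ⟪(l : Rn n) + x, (k : Rn n)⟫ = _
    rw [inner_add_left, ec_add, ec_inner_int, one_mul]
  have h2 : ∫ ξ in y +ᵥ D, ec ⟪ξ, (k : Rn n)⟫ = -∫ ξ in D, ec ⟪ξ, (k : Rn n)⟫ := by
    rw [← integral_indicator (hD.isCompact.vadd y).measurableSet, ← integral_add_left_eq_self _ y,
      ← integral_neg, ← integral_indicator hD.isCompact.measurableSet]
    refine integral_congr_ae (Filter.Eventually.of_forall fun ξ => ?_)
    have hmem : y + ξ ∈ y +ᵥ D ↔ ξ ∈ D := Set.vadd_mem_vadd_set_iff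
    by_cases hξ : ξ ∈ D
    · simp only [Set.indicator_of_mem (hmem.2 hξ), Set.indicator_of_mem hξ]
      rw [inner_add_left, ec_add, hyk, hec, neg_one_mul]
    · simp only [Set.indicator_of_notMem (mt hmem.1 hξ), Set.indicator_of_notMem hξ]
  rw [h1] at h2
  exact self_eq_neg.1 h2

theorem SpectralDomain.kerSum_int {n : ℕ} {D : Set (Rn n)} (hD : SpectralDomain D)
    (s : Finset (intLattice n)) (a : intLattice n → ℂ) (j : intLattice n) :
    kerSum D s a j = if j ∈ s then a j else 0 := by
  have h : ∀ k : intLattice n, ker D ((j : Rn n) - k) = if j = k then 1 else 0 := fun k => by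
    have := hD.ker_int (j - k)
    simpa [sub_eq_zero] using this
  rw [kerSum]
  simp [h]

theorem enorm_rpow_eq_lintegral {n : ℕ} {p : ℝ≥0∞} (hp : 1 < p) (hp' : p ≠ ∞)
    (f : Lp ℂ p (volume : Measure (Rn n))) : ‖f‖ₑ ^ p.toReal = ∫⁻ x, ‖f x‖ₑ ^ p.toReal := by
  rw [Lp.enorm_def, eLpNorm_eq_lintegral_rpow_enorm_toReal (zero_lt_one.trans hp).ne' hp',
    ← ENNReal.rpow_mul, one_div_mul_cancel (by linarith [one_lt_toReal hp hp']), ENNReal.rpow_one]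

theorem lp_enorm_rpow_eq_tsum {ι : Type*} {p : ℝ≥0∞} [Fact (1 ≤ p)] (hp : 1 < p) (hp' : p ≠ ∞)
    (a : lp (fun _ : ι => ℂ) p) : ‖a‖ₑ ^ p.toReal = ∑' i, ‖a i‖ₑ ^ p.toReal := by
  have hq := one_lt_toReal hp hp'
  have hs := (memℓp_gen_iff (by linarith)).1 (lp.memℓp a)
  have h := lp.norm_rpow_eq_tsum (by linarith : 0 < p.toReal) a
  simp only [← ofReal_norm]
  rw [ENNReal.ofReal_rpow_of_nonneg (norm_nonneg _) (by linarith), h, ENNReal.ofReal_tsum_of_nonneg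
    (fun i => by positivity) hs]
  exact tsum_congr fun i => (ENNReal.ofReal_rpow_of_nonneg (norm_nonneg _) (by linarith)).symm

theorem memℓp_of_tsum_ne_top {ι : Type*} {p : ℝ≥0∞} (hp : 1 < p) (hp' : p ≠ ∞) {a : ι → ℂ}
    (h : ∑' i, ‖a i‖ₑ ^ p.toReal ≠ ∞) : Memℓp a p := by
  have hq := one_lt_toReal hp hp'
  rw [memℓp_gen_iff (by linarith)]
  refine (ENNReal.summable_toReal h).congr fun i => ?_
  rw [← ENNReal.toReal_rpow, toReal_enorm]

section Sampling

variable {n : ℕ} {p : ℝ≥0∞} [Fact (1 ≤ p)] {K : Set (Rn n)}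

theorem isCompact_normalize (hK : IsCompact K) : IsCompact (normalize K) := by
  rw [normalize_eq, Homeomorph.isCompact_preimage]
  exact hK

/-- One kernel θ reproduces all of E^p_K, so the sampling estimates have constants independent of f.
-/
theorem exists_contRep_eq_convS (hK : IsCompact K) (hp : 1 < p) (hp' : p ≠ ∞) :
    ∃ θ : 𝓢(Rn n, ℂ), ∀ f ∈ bandLimited K p, contRep f = convS θ f ∧ f =ᵐ[volume] convS θ f := by
  obtain ⟨θ, -, -, hθ⟩ := SpectralDomain.exists_kernel isOpen_univ (isCompact_normalize hK)
    (Set.subset_univ _)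
  have hq := one_lt_toReal hp hp'
  refine ⟨θ, fun f hf => ?_⟩
  have hfin : FinLq p.toReal f := (finLq_iff_memLp (zero_lt_one.trans hp).ne' hp').2 (Lp.memLp f)
  have h := ((mem_bandLimited_iff hK.isClosed hp hp').1 hf).ae_eq_convS hq hfin hθ
  exact ⟨contRep_eq (continuous_convS hq hfin θ) h, h⟩

theorem ae_eq_contRep (hK : IsCompact K) (hp : 1 < p) (hp' : p ≠ ∞)
    {f : Lp ℂ p (volume : Measure (Rn n))} (hf : f ∈ bandLimited K p) :
    f =ᵐ[volume] contRep f := by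
  obtain ⟨θ, hθ⟩ := exists_contRep_eq_convS hK hp hp'
  rw [(hθ f hf).1]
  exact (hθ f hf).2

theorem continuous_contRep (hK : IsCompact K) (hp : 1 < p) (hp' : p ≠ ∞)
    {f : Lp ℂ p (volume : Measure (Rn n))} (hf : f ∈ bandLimited K p) :
    Continuous (contRep f) := by
  obtain ⟨θ, hθ⟩ := exists_contRep_eq_convS hK hp hp'
  rw [(hθ f hf).1]
  exact continuous_convS (one_lt_toReal hp hp')
    ((finLq_iff_memLp (zero_lt_one.trans hp).ne' hp').2 (Lp.memLp f)) θ

theorem FVanishOn.congr {f g : Rn n → ℂ} {U : Set (Rn n)} (h : FVanishOn f U)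
    (hfg : f =ᵐ[volume] g) : FVanishOn g U := fun φ h1 h2 => by
  rw [← h φ h1 h2]
  refine integral_congr_ae ?_
  filter_upwards [hfg] with x hx
  rw [hx]

theorem lintegral_contRep (hK : IsCompact K) (hp : 1 < p) (hp' : p ≠ ∞)
    {f : Lp ℂ p (volume : Measure (Rn n))} (hf : f ∈ bandLimited K p) :
    ∫⁻ x, ‖contRep f x‖ₑ ^ p.toReal = ‖f‖ₑ ^ p.toReal := by
  rw [enorm_rpow_eq_lintegral hp hp']
  refine lintegral_congr_ae ?_
  filter_upwards [ae_eq_contRep hK hp hp' hf] with x hx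
  rw [hx]

theorem finLq_contRep (hK : IsCompact K) (hp : 1 < p) (hp' : p ≠ ∞)
    {f : Lp ℂ p (volume : Measure (Rn n))} (hf : f ∈ bandLimited K p) :
    FinLq p.toReal (contRep f) := by
  rw [finLq_iff_memLp (zero_lt_one.trans hp).ne' hp', ← memLp_congr_ae (ae_eq_contRep hK hp hp' hf)]
  exact Lp.memLp f

theorem fVanishOn_contRep (hK : IsCompact K) (hp : 1 < p) (hp' : p ≠ ∞)
    {f : Lp ℂ p (volume : Measure (Rn n))} (hf : f ∈ bandLimited K p) :
    FVanishOn (contRep f) (normalize K)ᶜ :=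
  ((mem_bandLimited_iff hK.isClosed hp hp').1 hf).congr (ae_eq_contRep hK hp hp' hf)

theorem exists_bandLimited_contRep_eq (hK : IsCompact K) (hp : 1 < p) (hp' : p ≠ ∞) {g : Rn n → ℂ}
    (hg : FinLq p.toReal g) (hgc : Continuous g) (hgK : FVanishOn g (normalize K)ᶜ) :
    ∃ f ∈ bandLimited K p, contRep f = g := by
  have hm := (finLq_iff_memLp (zero_lt_one.trans hp).ne' hp').1 hg
  exact ⟨hm.toLp g, (mem_bandLimited_iff hK.isClosed hp hp').2 (hgK.congr hm.coeFn_toLp.symm),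
    contRep_eq hgc hm.coeFn_toLp⟩

theorem contRep_add (hK : IsCompact K) (hp : 1 < p) (hp' : p ≠ ∞)
    {f g : Lp ℂ p (volume : Measure (Rn n))} (hf : f ∈ bandLimited K p) (hg : g ∈ bandLimited K p)
    (x : Rn n) : contRep (f + g) x = contRep f x + contRep g x := by
  have h : contRep (f + g) = contRep f + contRep g :=
    contRep_eq ((continuous_contRep hK hp hp' hf).add (continuous_contRep hK hp hp' hg))
      ((Lp.coeFn_add f g).trans ((ae_eq_contRep hK hp hp' hf).add (ae_eq_contRep hK hp hp' hg)))
  rw [h, Pi.add_apply]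

theorem contRep_smul (hK : IsCompact K) (hp : 1 < p) (hp' : p ≠ ∞)
    {f : Lp ℂ p (volume : Measure (Rn n))} (hf : f ∈ bandLimited K p) (c : ℂ)
    (x : Rn n) : contRep (c • f) x = c * contRep f x := by
  have h : contRep (c • f) = c • contRep f :=
    contRep_eq ((continuous_contRep hK hp hp' hf).const_smul c)
      ((Lp.coeFn_smul c f).trans ((ae_eq_contRep hK hp hp' hf).const_smul c))
  rw [h, Pi.smul_apply, smul_eq_mul]

theorem exists_tsum_contRep_le (hK : IsCompact K) (hp : 1 < p) (hp' : p ≠ ∞) :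
    ∃ C : ℝ≥0, ∀ f ∈ bandLimited K p,
      ∑' k : intLattice n, ‖contRep f k‖ₑ ^ p.toReal ≤ C * ‖f‖ₑ ^ p.toReal := by
  obtain ⟨θ, hθ⟩ := exists_contRep_eq_convS hK hp hp'
  obtain ⟨C, hC⟩ := exists_tsum_convS_le (one_lt_toReal hp hp') θ
  refine ⟨C, fun f hf => ?_⟩
  rw [(hθ f hf).1, enorm_rpow_eq_lintegral hp hp']
  exact hC f (Lp.aestronglyMeasurable f)

/-- Provides the completeness of E^p_K behind the convergence of series and the open mapping
theorem. -/
theorem isClosed_bandLimited (hK : IsCompact K) (hp : 1 < p) (hp' : p ≠ ∞) :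
    IsClosed (bandLimited K p : Set (Lp ℂ p (volume : Measure (Rn n)))) := by
  have h : (bandLimited K p : Set (Lp ℂ p (volume : Measure (Rn n)))) =
      ⋂ φ : 𝓢(Rn n, ℂ), ⋂ _ : HasCompactSupport φ, ⋂ _ : tsupport φ ⊆ (normalize K)ᶜ,
        {f | (Lp.toTemperedDistributionCLM ℂ (volume : Measure (Rn n)) p f) (𝓕 φ) = 0} := by
    ext f
    simp only [SetLike.mem_coe, mem_bandLimited_iff hK.isClosed hp hp', Set.mem_iInter]
    refine forall_congr' fun φ => forall_congr' fun _ => forall_congr' fun _ => ?_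
    change _ ↔ (f : 𝓢'(Rn n, ℂ)) (𝓕 φ) = 0
    rw [Lp.toTemperedDistribution_apply]
    rfl
  rw [h]
  refine isClosed_iInter fun φ => isClosed_iInter fun _ => isClosed_iInter fun _ => ?_
  refine isClosed_eq ?_ continuous_const
  exact (PointwiseConvergenceCLM.evalCLM (RingHom.id ℂ) ℂ (𝓕 φ)).continuous.comp
    (Lp.toTemperedDistributionCLM ℂ (volume : Measure (Rn n)) p).continuous

/-- The sampling operator `f ↦ (f(k))_{k ∈ ℤⁿ}`. -/
theorem exists_sampling (hK : IsCompact K) (hp : 1 < p) (hp' : p ≠ ∞) :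
    ∃ S : bandLimited K p →L[ℂ] lp (fun _ : intLattice n => ℂ) p,
      ∀ (f : bandLimited K p) (k : intLattice n), S f k = contRep (f : Lp ℂ p volume) (k : Rn n) := by
  have hq := one_lt_toReal hp hp'
  obtain ⟨C, hC⟩ := exists_tsum_contRep_le (K := K) hK hp hp'
  have hmem : ∀ f : bandLimited K p,
      Memℓp (fun k : intLattice n => contRep (f : Lp ℂ p volume) (k : Rn n)) p := fun f =>
    memℓp_of_tsum_ne_top hp hp' ((hC f f.2).trans_lt (ENNReal.mul_lt_top ENNReal.coe_lt_top
      (ENNReal.rpow_lt_top_of_nonneg (by linarith) enorm_ne_top))).ne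
  let L : bandLimited K p →ₗ[ℂ] lp (fun _ : intLattice n => ℂ) p :=
    { toFun := fun f => ⟨_, hmem f⟩
      map_add' := fun f g => by
        ext k
        exact contRep_add hK hp hp' f.2 g.2 k
      map_smul' := fun c f => by
        ext k
        exact contRep_smul hK hp hp' f.2 c k }
  refine ⟨L.mkContinuous ((C : ℝ) ^ (1 / p.toReal)) fun f => ?_, fun f k => rfl⟩
  have h1 : ‖L f‖ₑ ^ p.toReal ≤ C * ‖f‖ₑ ^ p.toReal := by
    rw [lp_enorm_rpow_eq_tsum hp hp']
    exact hC f f.2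
  have h2 := ENNReal.rpow_le_rpow h1 (by positivity : 0 ≤ 1 / p.toReal)
  rw [ENNReal.mul_rpow_of_nonneg _ _ (by positivity), ← ENNReal.rpow_mul, ← ENNReal.rpow_mul,
    mul_one_div_cancel (by linarith), ENNReal.rpow_one, ENNReal.rpow_one,
    ← ENNReal.coe_rpow_of_nonneg _ (by positivity)] at h2
  have h3 := ENNReal.toReal_mono (ENNReal.mul_ne_top ENNReal.coe_ne_top enorm_ne_top) h2
  simpa using h3

/-- The interpolant is ∑ a(k) h(· - k). `KerBound` applied to finite blocks gives the Cauchy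
criterion in E^p_K, and h(j - k) is 1 for j = k and 0 otherwise. -/
theorem KerBound.surjective_sampling (hK : IsCompact K) (hD : SpectralDomain (normalize K))
    (hp : 1 < p) (hp' : p ≠ ∞) {C : ℝ≥0} (h : KerBound (normalize K) p.toReal C)
    {S : bandLimited K p →L[ℂ] lp (fun _ : intLattice n => ℂ) p}
    (hS : ∀ (f : bandLimited K p) (k : intLattice n),
      S f k = contRep (f : Lp ℂ p volume) (k : Rn n)) : Function.Surjective S := by
  have hq := one_lt_toReal hp hp'
  have hD' := hD.isCompact
  have : CompleteSpace (bandLimited K p) := (isClosed_bandLimited hK hp hp').completeSpace_coe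
  have hex : ∀ k : intLattice n, ∃ f : bandLimited K p,
      contRep (f : Lp ℂ p volume) = kerSum (normalize K) {k} 1 := by
    intro k
    obtain ⟨f, hf, hfe⟩ := exists_bandLimited_contRep_eq hK hp hp'
      ⟨(continuous_kerSum hD' {k} 1).aestronglyMeasurable, (h {k} 1).trans_lt
        (ENNReal.mul_lt_top ENNReal.coe_lt_top (by simp))⟩
      (continuous_kerSum hD' {k} 1) (fVanishOn_kerSum hD' {k} 1)
    exact ⟨⟨f, hf⟩, hfe⟩
  choose e he using hex
  have hsum : ∀ (s : Finset (intLattice n)) (a : intLattice n → ℂ),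
      contRep ((∑ k ∈ s, a k • e k : bandLimited K p) : Lp ℂ p volume) =
        kerSum (normalize K) s a := by
    classical
    intro s a
    induction s using Finset.induction_on with
    | empty =>
      ext x
      have h0 : contRep ((0 : ℂ) • (0 : Lp ℂ p (volume : Measure (Rn n)))) x = 0 := by
        rw [contRep_smul hK hp hp' (bandLimited K p).zero_mem, zero_mul]
      rw [smul_zero] at h0
      simpa [kerSum] using h0
    | insert k s hk ih =>
      ext x
      rw [Finset.sum_insert hk, Submodule.coe_add,
        contRep_add hK hp hp' (Submodule.coe_mem _) (Submodule.coe_mem _), ih, Submodule.coe_smul,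
        contRep_smul hK hp hp' (Submodule.coe_mem _), he, kerSum, kerSum, kerSum,
        Finset.sum_insert hk]
      simp
  have hnorm : ∀ (s : Finset (intLattice n)) (a : intLattice n → ℂ),
      ‖∑ k ∈ s, a k • e k‖ ^ p.toReal ≤ C * ∑ k ∈ s, ‖a k‖ ^ p.toReal := by
    intro s a
    have h1 := h s a
    rw [← hsum, lintegral_contRep hK hp hp' (Submodule.coe_mem _)] at h1
    have hfin : (C : ℝ≥0∞) * ∑ k ∈ s, ‖a k‖ₑ ^ p.toReal ≠ ∞ := by
      refine ENNReal.mul_ne_top ENNReal.coe_ne_top ?_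
      rw [ENNReal.sum_ne_top]
      exact fun k _ => ENNReal.rpow_ne_top_of_nonneg (by linarith) enorm_ne_top
    have h2 := ENNReal.toReal_mono hfin h1
    rw [ENNReal.toReal_mul, ENNReal.toReal_sum] at h2
    · simpa [← ENNReal.toReal_rpow] using h2
    · exact fun k _ => ENNReal.rpow_ne_top_of_nonneg (by linarith) enorm_ne_top
  intro a
  have hsa := (memℓp_gen_iff (by linarith)).1 (lp.memℓp a)
  have hsum' : Summable fun k => a k • e k := by
    rw [summable_iff_vanishing_norm]
    intro ε hε
    have hδ : 0 < ε ^ p.toReal / (C + 1) := by positivity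
    obtain ⟨s, hs⟩ := summable_iff_vanishing_norm.1 hsa _ hδ
    refine ⟨s, fun t ht => ?_⟩
    have h1 := hs t ht
    rw [Real.norm_of_nonneg (Finset.sum_nonneg fun k _ => by positivity),
      lt_div_iff₀ (by positivity)] at h1
    have h2 : ‖∑ k ∈ t, a k • e k‖ ^ p.toReal < ε ^ p.toReal := by
      refine lt_of_le_of_lt ((hnorm t a).trans ?_) h1
      rw [mul_comm]
      refine mul_le_mul_of_nonneg_left (by linarith) (Finset.sum_nonneg fun k _ => by positivity)
    exact (Real.rpow_lt_rpow_iff (norm_nonneg _) hε.le (by linarith)).1 h2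
  refine ⟨∑' k, a k • e k, ?_⟩
  ext j
  have h1 := hsum'.hasSum.mapL S
  have h2 : Filter.Tendsto (fun s : Finset (intLattice n) => (∑ k ∈ s, S (a k • e k)) j)
      Filter.atTop (𝓝 (S (∑' k, a k • e k) j)) := by
    rw [tendsto_iff_norm_sub_tendsto_zero]
    refine squeeze_zero (fun _ => norm_nonneg _) (fun s => ?_)
      (tendsto_iff_norm_sub_tendsto_zero.1 h1)
    exact lp.norm_apply_le_norm (zero_lt_one.trans hp).ne'
      (∑ k ∈ s, S (a k • e k) - S (∑' k, a k • e k)) j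
  have h3 : ∀ᶠ s : Finset (intLattice n) in Filter.atTop, (∑ k ∈ s, S (a k • e k)) j = a j := by
    filter_upwards [Filter.eventually_ge_atTop {j}] with s hs
    rw [← map_sum, hS, hsum, hD.kerSum_int, if_pos (hs (Finset.mem_singleton_self j))]
  exact tendsto_nhds_unique (h2.congr' h3) tendsto_const_nhds

theorem KerBound.injective_sampling (hK : IsCompact K) (hD : SpectralDomain (normalize K))
    (hp : 1 < p) (hp' : p ≠ ∞) {C : ℝ≥0} (h : KerBound (normalize K) p.toReal C)
    {S : bandLimited K p →L[ℂ] lp (fun _ : intLattice n => ℂ) p}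
    (hS : ∀ (f : bandLimited K p) (k : intLattice n),
      S f k = contRep (f : Lp ℂ p volume) (k : Rn n)) : Function.Injective S := by
  rw [injective_iff_map_eq_zero]
  intro f hf
  have h0 : ∀ k : intLattice n, contRep (f : Lp ℂ p volume) (k : Rn n) = 0 := fun k => by
    rw [← hS, hf]
    rfl
  have h1 := h.ae_eq_zero hD (one_lt_toReal hp hp') (finLq_contRep hK hp hp' f.2)
    (continuous_contRep hK hp hp' f.2) (fVanishOn_contRep hK hp hp' f.2) h0
  refine Subtype.ext (Lp.ext ?_)
  exact ((ae_eq_contRep hK hp hp' f.2).trans h1).trans (Lp.coeFn_zero _ _ _).symm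

theorem KerBound.samplingIsIsomorphism (hK : IsCompact K) (hD : SpectralDomain (normalize K))
    (hp : 1 < p) (hp' : p ≠ ∞) {C : ℝ≥0} (h : KerBound (normalize K) p.toReal C) :
    SamplingIsIsomorphism (intLattice n : Set (Rn n)) K p := by
  have : CompleteSpace (bandLimited K p) := (isClosed_bandLimited hK hp hp').completeSpace_coe
  obtain ⟨S, hS⟩ := exists_sampling (K := K) hK hp hp'
  exact ⟨ContinuousLinearEquiv.ofBijective S
    (LinearMap.ker_eq_bot.2 (h.injective_sampling hK hD hp hp' hS))
    (LinearMap.range_eq_top.2 (h.surjective_sampling hK hD hp hp' hS)), hS⟩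

theorem SamplingIsIsomorphism.isStableInterpolation {Γ : Set (Rn n)}
    (h : SamplingIsIsomorphism Γ K p) : IsStableInterpolation Γ K p := by
  obtain ⟨S, hS⟩ := h
  intro a
  refine ⟨S.symm a, (S.symm a).2, fun γ => ?_⟩
  rw [← hS, S.apply_symm_apply]

theorem SamplingIsIsomorphism.isStableSampling (hp : 1 < p) (hp' : p ≠ ∞) {Γ : Set (Rn n)}
    (h : SamplingIsIsomorphism Γ K p) : IsStableSampling Γ K p := by
  have hq := one_lt_toReal hp hp'
  obtain ⟨S, hS⟩ := h
  set B := ‖(S.symm : lp (fun _ : Γ => ℂ) p →L[ℂ] bandLimited K p)‖₊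
  refine ⟨B ^ p.toReal, fun f hf => ?_⟩
  have h1 := (S.symm : lp (fun _ : Γ => ℂ) p →L[ℂ] bandLimited K p).le_opENorm (S ⟨f, hf⟩)
  have h2 : (S.symm : lp (fun _ : Γ => ℂ) p →L[ℂ] bandLimited K p) (S ⟨f, hf⟩) = ⟨f, hf⟩ :=
    S.symm_apply_apply _
  rw [h2] at h1
  have h3 := ENNReal.rpow_le_rpow h1 (by linarith : 0 ≤ p.toReal)
  rw [ENNReal.mul_rpow_of_nonneg _ _ (by linarith), lp_enorm_rpow_eq_tsum hp hp'] at h3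
  simp only [hS] at h3
  rw [ENNReal.coe_rpow_of_nonneg _ (by linarith)]
  exact h3

end Sampling

/-! ### Riemann sums for the kernel -/

theorem tendsto_riemannSum_real {n : ℕ} {D : Set (Rn n)} (hD : IsCompact D)
    (hfr : volume (frontier D) = 0) {s : Rn n} {P : ℕ → Finset (intLattice n)}
    (hP : ∀ N : ℕ, N ≠ 0 → ∀ k : intLattice n, k ∈ P N ↔ s + (N : ℝ)⁻¹ • (k : Rn n) ∈ D)
    {F : Rn n → ℝ} (hF : Continuous F) :
    Filter.Tendsto (fun N : ℕ => (∑ k ∈ P N, F (s + (N : ℝ)⁻¹ • (k : Rn n))) / (N : ℝ) ^ n)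
      Filter.atTop (𝓝 (∫ ξ in D, F ξ)) := by
  -- The shift s is absorbed into a measure preserving change of variables, which makes the grid a
  -- multiple of the standard one.
  set e : (Fin n → ℝ) ≃ₜ Rn n := (EuclideanSpace.equiv (Fin n) ℝ).toHomeomorph.symm.trans
    (Homeomorph.addLeft s) with he
  have hev : ∀ x, e x = s + WithLp.toLp 2 x := fun x => rfl
  have hmp : MeasurePreserving e volume volume :=
    (measurePreserving_add_left volume s).comp (PiLp.volume_preserving_toLp (Fin n))
  have hme : MeasurableEmbedding e := e.measurableEmbedding
  have h := tendsto_tsum_div_pow_atTop_integral (e ⁻¹' D) (F ∘ e) (hF.comp e.continuous)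
    ((e.isCompact_preimage.2 hD).isBounded) (hD.measurableSet.preimage e.continuous.measurable) (by
      rw [← e.preimage_frontier, hmp.measure_preimage_emb hme, hfr])
  have h1 : ∫ x in e ⁻¹' D, (F ∘ e) x = ∫ ξ in D, F ξ := hmp.setIntegral_preimage_emb hme F D
  rw [h1] at h
  refine h.congr' ?_
  filter_upwards [Filter.eventually_ne_atTop 0] with N hN
  have hN' : (N : ℝ) ≠ 0 := by exact_mod_cast hN
  classical
  set t : intLattice n → Fin n → ℝ := fun k => (N : ℝ)⁻¹ • WithLp.ofLp (k : Rn n) with ht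
  have het : ∀ k, e (t k) = s + (N : ℝ)⁻¹ • (k : Rn n) := fun k => rfl
  have htinj : Function.Injective t := by
    intro a b hab
    have h2 := congrArg e hab
    rw [het, het] at h2
    exact Subtype.ext (smul_right_injective _ (inv_ne_zero hN') (add_left_cancel h2))
  have : NeZero N := ⟨hN⟩
  have hset : e ⁻¹' D ∩ (((N : ℝ)⁻¹ • Submodule.span ℤ (Set.range (Pi.basisFun ℝ (Fin n))) :
      Submodule ℤ (Fin n → ℝ)) : Set (Fin n → ℝ)) = ((P N).image t : Set (Fin n → ℝ)) := by
    ext x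
    simp only [Set.mem_inter_iff, Set.mem_preimage, Finset.coe_image, Set.mem_image,
      hP N hN, SetLike.mem_coe, BoxIntegral.unitPartition.mem_smul_span_iff]
    constructor
    · rintro ⟨hxD, hx⟩
      choose m hm using hx
      have hx : t (ofInt m) = x := by
        ext i
        change (N : ℝ)⁻¹ * (m i : ℝ) = x i
        have h2 : (m i : ℝ) = N * x i := hm i
        rw [h2, inv_mul_cancel_left₀ hN']
      refine ⟨ofInt m, ?_, hx⟩
      rwa [← het, hx]
    · rintro ⟨k, hk, rfl⟩
      refine ⟨by rwa [het], fun i => ?_⟩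
      obtain ⟨m, hm⟩ := k.2 i
      refine ⟨m, ?_⟩
      change (m : ℝ) = N * ((N : ℝ)⁻¹ * (k : Rn n) i)
      rw [mul_inv_cancel_left₀ hN', hm]
  rw [← Submodule.coe_pointwise_smul, hset, Finset.tsum_subtype' ((P N).image t) (F ∘ e), Finset.sum_image htinj.injOn,
    Fintype.card_fin]
  rfl

theorem tendsto_riemannSum {n : ℕ} {D : Set (Rn n)} (hD : IsCompact D)
    (hfr : volume (frontier D) = 0) {s : Rn n} {P : ℕ → Finset (intLattice n)}
    (hP : ∀ N : ℕ, N ≠ 0 → ∀ k : intLattice n, k ∈ P N ↔ s + (N : ℝ)⁻¹ • (k : Rn n) ∈ D)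
    {F : Rn n → ℂ} (hF : Continuous F) :
    Filter.Tendsto (fun N : ℕ => ((N : ℂ) ^ n)⁻¹ * ∑ k ∈ P N, F (s + (N : ℝ)⁻¹ • (k : Rn n)))
      Filter.atTop (𝓝 (∫ ξ in D, F ξ)) := by
  have h1 := tendsto_riemannSum_real hD hfr hP (Complex.continuous_re.comp hF)
  have h2 := tendsto_riemannSum_real hD hfr hP (Complex.continuous_im.comp hF)
  have h3 := (((Complex.continuous_ofReal.tendsto _).comp h1).add
    (((Complex.continuous_ofReal.tendsto _).comp h2).mul_const Complex.I))
  have h4 : ((∫ ξ in D, (Complex.re ∘ F) ξ : ℝ) : ℂ) + (∫ ξ in D, (Complex.im ∘ F) ξ : ℝ) * Complex.I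
      = ∫ ξ in D, F ξ := by
    have hi : IntegrableOn F D volume := hF.continuousOn.integrableOn_compact hD
    exact integral_re_add_im (𝕜 := ℂ) hi
  rw [h4] at h3
  refine h3.congr fun N => ?_
  simp only [Function.comp_apply]
  push_cast
  rw [div_eq_inv_mul, div_eq_inv_mul, mul_assoc, ← mul_add, Finset.sum_mul, ← Finset.sum_add_distrib]
  congr 1
  exact Finset.sum_congr rfl fun k _ => Complex.re_add_im _

/-- The Riemann sum of step `1 / N` for `ker D`, where `P` lists the nodes `s + k / N` in `D`. -/
def latKer {n : ℕ} (P : Finset (intLattice n)) (s : Rn n) (N : ℕ) (y : Rn n) : ℂ :=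
  ((N : ℂ) ^ n)⁻¹ * ∑ k ∈ P, ec ⟪y, s + (N : ℝ)⁻¹ • (k : Rn n)⟫

theorem tendsto_latKer {n : ℕ} {D : Set (Rn n)} (hD : SpectralDomain D) {s : Rn n}
    {P : ℕ → Finset (intLattice n)}
    (hP : ∀ N : ℕ, N ≠ 0 → ∀ k : intLattice n, k ∈ P N ↔ s + (N : ℝ)⁻¹ • (k : Rn n) ∈ D) (y : Rn n) :
    Filter.Tendsto (fun N => latKer (P N) s N y) Filter.atTop (𝓝 (ker D y)) := by
  have := continuous_ec
  have h := tendsto_riemannSum hD.isCompact hD.volume_frontier hP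
    (F := fun ξ => ec ⟪y, ξ⟫) (by fun_prop)
  have h1 : ker D y = ∫ ξ in D, ec ⟪y, ξ⟫ := by
    rw [ker, fourierInv_eq_ec, ← integral_indicator hD.isCompact.measurableSet, ← ind_mul]
    simp only [mul_comm, real_inner_comm y]
  rw [h1]
  exact h

/-- The products ⟪N l, k / N⟫ are integers, so N l interacts only with the shift s. In particular
the modulus is periodic under Nℤⁿ. -/
theorem latKer_add {n : ℕ} (P : Finset (intLattice n)) (s : Rn n) {N : ℕ} (hN : N ≠ 0) (y : Rn n)
    (l : intLattice n) : latKer P s N (y + (N : ℝ) • (l : Rn n)) =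
      ec ⟪(N : ℝ) • (l : Rn n), s⟫ * latKer P s N y := by
  have hN' : (N : ℝ) ≠ 0 := by exact_mod_cast hN
  rw [latKer, latKer, mul_left_comm]
  congr 1
  rw [Finset.mul_sum]
  refine Finset.sum_congr rfl fun k _ => ?_
  rw [inner_add_left, ec_add, mul_comm, inner_add_right ((N : ℝ) • (l : Rn n)), ec_add,
    real_inner_smul_left (l : Rn n) ((N : ℝ)⁻¹ • (k : Rn n)), real_inner_smul_right, ← mul_assoc (N : ℝ),
    mul_inv_cancel₀ hN', one_mul, ec_inner_int, mul_one]

theorem coe_nsmul_int {n : ℕ} (N : ℕ) (l : intLattice n) :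
    ((N • l : intLattice n) : Rn n) = (N : ℝ) • (l : Rn n) := by
  rw [AddSubgroup.coe_nsmul, Nat.cast_smul_eq_nsmul]

theorem exists_int_of_ec_eq_one {t : ℝ} (h : ec t = 1) : ∃ m : ℤ, t = m := by
  obtain ⟨m, hm⟩ := Complex.exp_eq_one_iff.1 h
  refine ⟨m, ?_⟩
  have h1 : (2 * Real.pi * Complex.I : ℂ) ≠ 0 := Complex.two_pi_I_ne_zero
  have h2 : (t : ℂ) * (2 * Real.pi * Complex.I) = m * (2 * Real.pi * Complex.I) := by
    rw [← hm]; ring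
  exact_mod_cast mul_right_cancel₀ h1 h2

theorem exists_eq_smul_of_forall_ec_eq_one {n N : ℕ} (hN : N ≠ 0) (m : intLattice n)
    (h : ∀ k : intLattice n, ec ⟪(m : Rn n), (N : ℝ)⁻¹ • (k : Rn n)⟫ = 1) :
    ∃ l : intLattice n, (m : Rn n) = (N : ℝ) • (l : Rn n) := by
  have hN' : (N : ℝ) ≠ 0 := by exact_mod_cast hN
  refine ⟨⟨(N : ℝ)⁻¹ • (m : Rn n), fun i => ?_⟩, (smul_inv_smul₀ hN' _).symm⟩
  have h1 := h (ofInt (Pi.single i 1))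
  obtain ⟨a, ha⟩ := exists_int_of_ec_eq_one h1
  refine ⟨a, ?_⟩
  rw [← ha, real_inner_smul_right, PiLp.inner_apply, Finset.sum_eq_single i]
  · simp [ofInt_apply]
  · intro j _ hj
    simp [ofInt_apply, hj]
  · simp

/-- The nodes in D represent each class of the shifted grid modulo ℤⁿ exactly once. The sum is thus,
up to a factor, that of a character of the finite group N⁻¹ℤⁿ/ℤⁿ, nontrivial since m is not in Nℤⁿ.
-/
theorem SpectralDomain.latKer_eq_zero {n : ℕ} {D : Set (Rn n)} (hD : SpectralDomain D) {s : Rn n}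
    {N : ℕ} (hN : N ≠ 0) (hs : ∀ k : intLattice n, s + (N : ℝ)⁻¹ • (k : Rn n) ∉ frontier D)
    {P : Finset (intLattice n)}
    (hP : ∀ k : intLattice n, k ∈ P ↔ s + (N : ℝ)⁻¹ • (k : Rn n) ∈ D) {m : intLattice n}
    (hm : ¬∃ l : intLattice n, (m : Rn n) = (N : ℝ) • (l : Rn n)) : latKer P s N m = 0 := by
  have hN' : (N : ℝ) ≠ 0 := by exact_mod_cast hN
  obtain ⟨k₀, hk₀⟩ : ∃ k : intLattice n, ec ⟪(m : Rn n), (N : ℝ)⁻¹ • (k : Rn n)⟫ ≠ 1 := by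
    by_contra! hn
    exact hm (exists_eq_smul_of_forall_ec_eq_one hN m hn)
  choose l hl using fun k : intLattice n => hD.exists_add_mem (s + (N : ℝ)⁻¹ • (k : Rn n))
  have hnode : ∀ k j : intLattice n, s + (N : ℝ)⁻¹ • ((k + N • j : intLattice n) : Rn n) =
      s + (N : ℝ)⁻¹ • (k : Rn n) + j := fun k j => by
    rw [AddSubgroup.coe_add, coe_nsmul_int, smul_add, inv_smul_smul₀ hN', add_assoc]
  -- Nodes in D are interior to D, since they avoid ∂D, and no other point congruent to an interior
  -- point lies in D.
  have huniq : ∀ k j : intLattice n, k ∈ P → k + N • j ∈ P → j = 0 := by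
    intro k j hk hkj
    rw [hP] at hk hkj
    rw [hnode] at hkj
    by_contra hj
    refine hD.add_notMem ?_ hj hkj
    by_contra hi
    exact hs k ⟨subset_closure hk, hi⟩
  -- Translation by k₀ in the quotient group, brought back to D. It permutes P and multiplies each
  -- term by b k₀ ≠ 1.
  set σ : intLattice n → intLattice n := fun k => k + k₀ + N • l (k + k₀) with hσ
  have hσP : ∀ k ∈ P, σ k ∈ P := fun k _ => by
    rw [hP, hσ, hnode]
    exact hl _
  have hσi : Set.InjOn σ P := by
    intro a ha b hb hab
    have h1 : b = a + N • (l (a + k₀) - l (b + k₀)) := by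
      have h2 : a + k₀ + N • l (a + k₀) = b + k₀ + N • l (b + k₀) := hab
      rw [smul_sub, ← add_sub_assoc, eq_sub_iff_add_eq]
      have h3 := congrArg (fun z => z - k₀) h2
      beta_reduce at h3
      rw [add_right_comm, add_sub_cancel_right, add_right_comm b, add_sub_cancel_right] at h3
      exact h3.symm
    rw [h1] at hb
    have h4 := huniq a _ ha hb
    rw [h4, smul_zero, add_zero] at h1
    exact h1.symm
  have hσs : Set.SurjOn σ P P :=
    Finset.surjOn_of_injOn_of_card_le σ hσP hσi le_rfl
  set b : intLattice n → ℂ := fun k => ec ⟪(m : Rn n), (N : ℝ)⁻¹ • (k : Rn n)⟫ with hb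
  have hbσ : ∀ k, b (σ k) = b k₀ * b k := by
    intro k
    have h1 : (N : ℝ)⁻¹ • ((σ k : intLattice n) : Rn n) =
        (N : ℝ)⁻¹ • (k₀ : Rn n) + (N : ℝ)⁻¹ • (k : Rn n) + (l (k + k₀) : Rn n) := by
      rw [hσ, AddSubgroup.coe_add, coe_nsmul_int, smul_add, inv_smul_smul₀ hN', AddSubgroup.coe_add,
        smul_add, add_comm ((N : ℝ)⁻¹ • (k : Rn n))]
    simp only [hb]
    rw [h1, inner_add_right, inner_add_right, ec_add, ec_add, ec_inner_int, mul_one]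
  have hsum : b k₀ * ∑ k ∈ P, b k = ∑ k ∈ P, b k := by
    rw [Finset.mul_sum]
    exact Finset.sum_nbij σ hσP hσi hσs fun k _ => (hbσ k).symm
  have hzero : ∑ k ∈ P, b k = 0 := by
    have h1 : (b k₀ - 1) * ∑ k ∈ P, b k = 0 := by rw [sub_mul, one_mul, hsum, sub_self]
    exact (mul_eq_zero.1 h1).resolve_left (sub_ne_zero.2 hk₀)
  have h2 : ∀ k : intLattice n, ec ⟪(m : Rn n), s + (N : ℝ)⁻¹ • (k : Rn n)⟫ =
      ec ⟪(m : Rn n), s⟫ * b k := fun k => by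
    rw [inner_add_right, ec_add]
  rw [latKer]
  simp only [h2]
  rw [← Finset.mul_sum, hzero, mul_zero, mul_zero]

/-- The linear combination `∑ a(k) h_N(x - k)` of translates of the Riemann sum for `ker D`. -/
def latSum {n : ℕ} (P : Finset (intLattice n)) (s : Rn n) (N : ℕ) (A : Finset (intLattice n))
    (a : intLattice n → ℂ) (x : Rn n) : ℂ := ∑ k ∈ A, a k * latKer P s N (x - k)

theorem latSum_add {n : ℕ} (P : Finset (intLattice n)) (s : Rn n) {N : ℕ} (hN : N ≠ 0)
    (A : Finset (intLattice n)) (a : intLattice n → ℂ) (x : Rn n) (l : intLattice n) :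
    latSum P s N A a (x + (N : ℝ) • (l : Rn n)) =
      ec ⟪(N : ℝ) • (l : Rn n), s⟫ * latSum P s N A a x := by
  rw [latSum, latSum, Finset.mul_sum]
  refine Finset.sum_congr rfl fun k _ => ?_
  rw [add_sub_right_comm, latKer_add P s hN]
  ring

@[fun_prop]
theorem continuous_latKer {n : ℕ} (P : Finset (intLattice n)) (s : Rn n) (N : ℕ) :
    Continuous (latKer P s N) := by
  have := continuous_ec
  unfold latKer
  fun_prop

@[fun_prop]
theorem continuous_latSum {n : ℕ} (P : Finset (intLattice n)) (s : Rn n) (N : ℕ)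
    (A : Finset (intLattice n)) (a : intLattice n → ℂ) : Continuous (latSum P s N A a) := by
  unfold latSum
  fun_prop

/-- A set of indices all of whose elements are incongruent modulo `N`. -/
def Incongruent {n : ℕ} (N : ℕ) (A : Finset (intLattice n)) : Prop :=
  ∀ k ∈ A, ∀ j ∈ A, ∀ l : intLattice n, k = j + N • l → l = 0

/-- Among the indices in A at most one is congruent to m modulo N, and the other terms vanish. The
surviving one is a(k) times a number with the modulus of `latKer P s N 0`, at most 2. -/
theorem SpectralDomain.enorm_latSum_le {n : ℕ} {D : Set (Rn n)} (hD : SpectralDomain D) {s : Rn n}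
    {N : ℕ} (hN : N ≠ 0) (hs : ∀ k : intLattice n, s + (N : ℝ)⁻¹ • (k : Rn n) ∉ frontier D)
    {P : Finset (intLattice n)}
    (hP : ∀ k : intLattice n, k ∈ P ↔ s + (N : ℝ)⁻¹ • (k : Rn n) ∈ D)
    (h0 : ‖latKer P s N 0‖ ≤ 2) {A : Finset (intLattice n)} (hA : Incongruent N A)
    (a : intLattice n → ℂ) {q : ℝ} (hq : 0 < q) (m : intLattice n) :
    ‖latSum P s N A a m‖ₑ ^ q ≤ ∑ k ∈ A, 2 ^ q * ‖a k‖ₑ ^ q *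
      (Set.range fun l : intLattice n => k + N • l).indicator 1 m := by
  have hzero : ∀ k : intLattice n, m ∉ Set.range (fun l : intLattice n => k + N • l) →
      latKer P s N ((m : Rn n) - k) = 0 := by
    intro k hk
    rw [← AddSubgroup.coe_sub]
    refine hD.latKer_eq_zero hN hs hP fun ⟨l, hl⟩ => hk ⟨l, Subtype.ext ?_⟩
    rw [← coe_nsmul_int, AddSubgroup.coe_sub] at hl
    change (k : Rn n) + ((N • l : intLattice n) : Rn n) = m
    rw [← hl, add_sub_cancel]
  by_cases hm : ∃ k ∈ A, m ∈ Set.range (fun l : intLattice n => k + N • l)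
  · obtain ⟨k, hk, hmk⟩ := hm
    refine le_trans ?_ (Finset.single_le_sum (fun _ _ => zero_le) hk)
    rw [Set.indicator_of_mem hmk, Pi.one_apply, mul_one, ← ENNReal.mul_rpow_of_nonneg _ _ hq.le]
    refine ENNReal.rpow_le_rpow ?_ hq.le
    obtain ⟨l, rfl⟩ := hmk
    rw [latSum, Finset.sum_eq_single k]
    · rw [enorm_mul, mul_comm]
      refine mul_le_mul' ?_ le_rfl
      have h1 : ((k + N • l : intLattice n) : Rn n) - k = 0 + (N : ℝ) • (l : Rn n) := by
        rw [AddSubgroup.coe_add, coe_nsmul_int, add_sub_cancel_left, zero_add]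
      simp only [h1]
      rw [latKer_add P s hN, enorm_mul, enorm_ec, one_mul]
      simpa using enorm_ofReal_le h0
    · intro j hj hjk
      rw [hzero j, mul_zero]
      rintro ⟨l', hl'⟩
      have h2 : k = j + N • (l' - l) := by
        rw [smul_sub, ← add_sub_assoc, eq_sub_iff_add_eq]
        exact hl'.symm
      have h3 := hA k hk j hj _ h2
      rw [h3, smul_zero, add_zero] at h2
      exact hjk h2.symm
    · exact fun hn => absurd hk hn
  · push Not at hm
    rw [latSum, Finset.sum_eq_zero fun k hk => by rw [hzero k (hm k hk), mul_zero], enorm_zero,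
      ENNReal.zero_rpow_of_pos hq]
    exact zero_le

theorem SpectralDomain.tsum_mul_latSum_le {n : ℕ} {D : Set (Rn n)} (hD : SpectralDomain D) {s : Rn n}
    {N : ℕ} (hN : N ≠ 0) (hs : ∀ k : intLattice n, s + (N : ℝ)⁻¹ • (k : Rn n) ∉ frontier D)
    {P : Finset (intLattice n)}
    (hP : ∀ k : intLattice n, k ∈ P ↔ s + (N : ℝ)⁻¹ • (k : Rn n) ∈ D)
    (h0 : ‖latKer P s N 0‖ ≤ 2) {A : Finset (intLattice n)} (hA : Incongruent N A)
    (a : intLattice n → ℂ) {q : ℝ} (hq : 0 < q) {w : Rn n → ℝ≥0∞} {B : ℝ≥0∞}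
    (hw : ∀ k : intLattice n, ∑' l : intLattice n, w ((k : Rn n) + (N : ℝ) • (l : Rn n)) ≤ B) :
    ∑' m : intLattice n, w m * ‖latSum P s N A a m‖ₑ ^ q ≤ 2 ^ q * B * ∑ k ∈ A, ‖a k‖ₑ ^ q := by
  calc ∑' m : intLattice n, w m * ‖latSum P s N A a m‖ₑ ^ q
      ≤ ∑' m : intLattice n, ∑ k ∈ A, 2 ^ q * ‖a k‖ₑ ^ q *
          (w m * (Set.range fun l : intLattice n => k + N • l).indicator 1 m) := by
        refine ENNReal.tsum_le_tsum fun m => ?_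
        refine (mul_le_mul' le_rfl (hD.enorm_latSum_le hN hs hP h0 hA a hq m)).trans (le_of_eq ?_)
        rw [Finset.mul_sum]
        exact Finset.sum_congr rfl fun k _ => by ring
    _ = ∑ k ∈ A, 2 ^ q * ‖a k‖ₑ ^ q * ∑' m : intLattice n,
          (w m * (Set.range fun l : intLattice n => k + N • l).indicator 1 m) := by
        rw [Summable.tsum_finsetSum fun _ _ => ENNReal.summable]
        exact Finset.sum_congr rfl fun k _ => ENNReal.tsum_mul_left
    _ ≤ ∑ k ∈ A, 2 ^ q * ‖a k‖ₑ ^ q * B := by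
        refine Finset.sum_le_sum fun k _ => mul_le_mul' le_rfl ?_
        have hinj : Function.Injective fun l : intLattice n => k + N • l := by
          intro x y hxy
          have h1 : N • x = N • y := add_left_cancel hxy
          refine Subtype.ext (smul_right_injective _ (by exact_mod_cast hN : (N : ℝ) ≠ 0) ?_)
          change (N : ℝ) • (x : Rn n) = (N : ℝ) • (y : Rn n)
          rw [← coe_nsmul_int, ← coe_nsmul_int, h1]
        rw [← hinj.tsum_eq (f := fun m : intLattice n =>
          w m * (Set.range fun l : intLattice n => k + N • l).indicator 1 m)]
        · refine le_trans (le_of_eq (tsum_congr fun l => ?_)) (hw k)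
          rw [Set.indicator_of_mem (Set.mem_range_self l), Pi.one_apply, mul_one, AddSubgroup.coe_add, coe_nsmul_int]
        · intro m hm
          by_contra hn
          refine hm ?_
          simp only
          rw [Set.indicator_of_notMem hn, mul_zero]
    _ = 2 ^ q * B * ∑ k ∈ A, ‖a k‖ₑ ^ q := by
        rw [Finset.mul_sum]
        exact Finset.sum_congr rfl fun k _ => by ring

/-- Countably many translates of the null set ∂D are avoided by almost every s. -/
theorem SpectralDomain.exists_shift {n : ℕ} {D : Set (Rn n)} (hD : SpectralDomain D) :
    ∃ s : Rn n, ∀ (N : ℕ) (k : intLattice n), s + (N : ℝ)⁻¹ • (k : Rn n) ∉ frontier D := by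
  have h : ∀ᵐ s : Rn n, ∀ (N : ℕ) (k : intLattice n), s + (N : ℝ)⁻¹ • (k : Rn n) ∉ frontier D := by
    refine ae_all_iff.2 fun N => ae_all_iff.2 fun k => ?_
    rw [ae_iff]
    simp only [not_not]
    change volume ((fun s : Rn n => s + (N : ℝ)⁻¹ • (k : Rn n)) ⁻¹' frontier D) = 0
    rw [measure_preimage_add_right, hD.volume_frontier]
  exact h.exists

theorem exists_nodes {n : ℕ} {D : Set (Rn n)} (hD : IsCompact D) (s : Rn n) :
    ∃ P : ℕ → Finset (intLattice n), ∀ N : ℕ, N ≠ 0 → ∀ k : intLattice n,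
      k ∈ P N ↔ s + (N : ℝ)⁻¹ • (k : Rn n) ∈ D := by
  obtain ⟨R, hR⟩ := hD.isBounded.exists_norm_le
  have hfin : ∀ N : ℕ, N ≠ 0 → {k : intLattice n | s + (N : ℝ)⁻¹ • (k : Rn n) ∈ D}.Finite := by
    intro N hN
    have hN' : (0 : ℝ) < N := by exact_mod_cast Nat.pos_of_ne_zero hN
    refine (finite_int_norm_le (N * (R + ‖s‖))).subset fun k hk => ?_
    have h1 := hR _ hk
    have h2 : ‖(N : ℝ)⁻¹ • (k : Rn n)‖ ≤ ‖s + (N : ℝ)⁻¹ • (k : Rn n)‖ + ‖s‖ := by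
      simpa using norm_sub_le (s + (N : ℝ)⁻¹ • (k : Rn n)) s
    rw [norm_smul, norm_inv, Real.norm_of_nonneg hN'.le, inv_mul_le_iff₀ hN'] at h2
    exact h2.trans (mul_le_mul_of_nonneg_left (by linarith) hN'.le)
  refine ⟨fun N => if hN : N ≠ 0 then (hfin N hN).toFinset else ∅, fun N hN k => ?_⟩
  beta_reduce
  rw [dif_pos hN, Set.Finite.mem_toFinset]
  rfl

theorem eventually_mem_cube {n : ℕ} (x : Rn n) :
    ∀ᶠ N : ℕ in Filter.atTop, (N : ℝ)⁻¹ • x ∈ cube n := by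
  have h1 : ∀ i, ∀ᶠ N : ℕ in Filter.atTop, (N : ℝ)⁻¹ * x i ∈ Set.Ioo (-(1 / 2) : ℝ) (1 / 2) := by
    intro i
    have h2 : Filter.Tendsto (fun N : ℕ => (N : ℝ)⁻¹ * x i) Filter.atTop (𝓝 (0 * x i)) :=
      (tendsto_inv_atTop_zero.comp tendsto_natCast_atTop_atTop).mul_const _
    rw [zero_mul] at h2
    exact h2.eventually_mem (Ioo_mem_nhds (by norm_num) (by norm_num))
  filter_upwards [Filter.eventually_all.2 h1] with N hN i
  have := hN i
  exact ⟨this.1, by norm_num; simpa using this.2.le⟩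

/-- The dilated cubes N · `cube n` exhaust ℝⁿ and the Riemann sums converge pointwise to the kernel,
so Fatou's lemma transfers a bound over one period to all of ℝⁿ. -/
theorem KerBound.of_latSum {n : ℕ} {D : Set (Rn n)} (hD : SpectralDomain D) {s : Rn n}
    {P : ℕ → Finset (intLattice n)}
    (hP : ∀ N : ℕ, N ≠ 0 → ∀ k : intLattice n, k ∈ P N ↔ s + (N : ℝ)⁻¹ • (k : Rn n) ∈ D)
    {q : ℝ} {C : ℝ≥0}
    (h : ∀ (A : Finset (intLattice n)) (a : intLattice n → ℂ), ∀ᶠ N : ℕ in Filter.atTop,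
      ENNReal.ofReal ((N : ℝ) ^ n) *
        ∫⁻ x in cube n, ‖latSum (P N) s N A a ((N : ℝ) • x)‖ₑ ^ q ≤ C * ∑ k ∈ A, ‖a k‖ₑ ^ q) :
    KerBound D q C := by
  intro A a
  set u : ℕ → Rn n → ℝ≥0∞ := fun N x => (cube n).indicator
    (fun y => ‖latSum (P N) s N A a ((N : ℝ) • y)‖ₑ ^ q) ((N : ℝ)⁻¹ • x) with hu
  have hvm : ∀ N, Measurable ((cube n).indicator
      (fun y => ‖latSum (P N) s N A a ((N : ℝ) • y)‖ₑ ^ q)) := fun N =>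
    (((by fun_prop : Continuous fun y => latSum (P N) s N A a ((N : ℝ) • y)).enorm.measurable).pow_const
      q).indicator (measurableSet_cube n)
  have hum : ∀ N, Measurable (u N) := fun N => (hvm N).comp (measurable_const_smul _)
  have hlim : ∀ x, Filter.Tendsto (fun N => u N x) Filter.atTop (𝓝 (‖kerSum D A a x‖ₑ ^ q)) := by
    intro x
    have h1 : Filter.Tendsto (fun N => latSum (P N) s N A a x) Filter.atTop (𝓝 (kerSum D A a x)) :=
      tendsto_finsetSum _ fun k _ => (tendsto_latKer hD hP _).const_mul _
    have h2 := (ENNReal.continuous_rpow_const (y := q)).tendsto _ |>.comp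
      ((continuous_enorm.tendsto _).comp h1)
    refine h2.congr' ?_
    filter_upwards [eventually_mem_cube x, Filter.eventually_ne_atTop 0] with N hN hN0
    have hN' : (N : ℝ) ≠ 0 := by exact_mod_cast hN0
    simp only [hu, Set.indicator_of_mem hN, smul_inv_smul₀ hN', Function.comp_apply]
  have hint : ∀ᶠ N in Filter.atTop, ∫⁻ x, u N x ≤ C * ∑ k ∈ A, ‖a k‖ₑ ^ q := by
    filter_upwards [h A a, Filter.eventually_ne_atTop 0] with N hN hN0
    have hN' : (0 : ℝ) < N := by exact_mod_cast Nat.pos_of_ne_zero hN0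
    have h3 := lintegral_comp_add_smul (hvm N) (inv_pos.2 hN') 0
    simp only [zero_add] at h3
    rw [hu]
    simp only
    rw [h3, lintegral_indicator (measurableSet_cube n), inv_pow, inv_inv]
    exact hN
  calc ∫⁻ x, ‖kerSum D A a x‖ₑ ^ q = ∫⁻ x, Filter.liminf (fun N => u N x) Filter.atTop :=
        lintegral_congr fun x => (hlim x).liminf_eq.symm
    _ ≤ Filter.liminf (fun N => ∫⁻ x, u N x) Filter.atTop := lintegral_liminf_le hum
    _ ≤ _ := Filter.liminf_le_of_frequently_le' hint.frequently

/-! ### Band-limited functions built from the Riemann sums -/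

theorem exists_tsum_enorm_rpow_le {n : ℕ} (φ : 𝓢(Rn n, ℂ)) {q : ℝ} (hq : 1 ≤ q) :
    ∃ B : ℝ≥0, ∀ η : ℝ, 0 < η → η ≤ 1 → ∀ y : Rn n,
      ∑' l : intLattice n, ‖φ (y + η • (l : Rn n))‖ₑ ^ q ≤ B * ENNReal.ofReal (η ^ n)⁻¹ := by
  obtain ⟨C, hC0, hC⟩ := exists_norm_le_wt φ
  obtain ⟨B, hB⟩ := exists_tsum_wt_le n
  refine ⟨C.toNNReal ^ q * B, fun η h0 h1 y => ?_⟩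
  calc ∑' l : intLattice n, ‖φ (y + η • (l : Rn n))‖ₑ ^ q
      ≤ ∑' l : intLattice n, ENNReal.ofReal C ^ q * ENNReal.ofReal (wt (y + η • (l : Rn n))) := by
        refine ENNReal.tsum_le_tsum fun l => ?_
        refine (ENNReal.rpow_le_rpow (enorm_ofReal_le (hC _)) (by linarith)).trans ?_
        rw [ENNReal.ofReal_mul hC0.le, ENNReal.mul_rpow_of_nonneg _ _ (by linarith)]
        refine mul_le_mul' le_rfl (ENNReal.rpow_le_self_of_le_one ?_ hq)
        simpa using ENNReal.ofReal_le_ofReal (wt_le_one (y + η • (l : Rn n)))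
    _ ≤ _ := by
        rw [ENNReal.tsum_mul_left, ENNReal.coe_mul, ENNReal.coe_rpow_of_nonneg _ (by linarith),
          mul_assoc]
        exact mul_le_mul' le_rfl (hB η h0 h1 y)

theorem one_le_norm_int {n : ℕ} {l : intLattice n} (hl : l ≠ 0) : 1 ≤ ‖(l : Rn n)‖ := by
  obtain ⟨m, rfl⟩ := ofInt_bijective.2 l
  obtain ⟨i, hi⟩ : ∃ i, m i ≠ 0 := by
    by_contra! hn
    refine hl (Subtype.ext ?_)
    ext i
    simp [ofInt_apply, hn i]
  have h1 := PiLp.norm_apply_le (ofInt m : Rn n) i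
  rw [ofInt_apply, Real.norm_eq_abs] at h1
  refine le_trans ?_ h1
  exact_mod_cast Int.one_le_abs hi

theorem eventually_incongruent {n : ℕ} (A : Finset (intLattice n)) :
    ∀ᶠ N : ℕ in Filter.atTop, Incongruent N A := by
  set M : ℝ := ∑ k ∈ A, ∑ j ∈ A, ‖(k : Rn n) - j‖ with hM
  filter_upwards [Filter.eventually_gt_atTop ⌈M⌉₊] with N hN k hk j hj l hl
  by_contra hl0
  have h1 : ‖(k : Rn n) - j‖ ≤ M := by
    refine le_trans ?_ (Finset.single_le_sum (f := fun k : intLattice n => ∑ j ∈ A, ‖(k : Rn n) - j‖)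
      (fun i _ => Finset.sum_nonneg fun _ _ => norm_nonneg _) hk)
    exact Finset.single_le_sum (f := fun j : intLattice n => ‖(k : Rn n) - j‖)
      (fun i _ => norm_nonneg _) hj
  have h2 : (k : Rn n) - j = (N : ℝ) • (l : Rn n) := by
    rw [hl, AddSubgroup.coe_add, coe_nsmul_int, add_sub_cancel_left]
  rw [h2, norm_smul, Real.norm_natCast] at h1
  have h3 : M < N := (Nat.le_ceil M).trans_lt (by exact_mod_cast hN)
  have h4 := mul_le_mul_of_nonneg_left (one_le_norm_int hl0) (Nat.cast_nonneg (α := ℝ) N)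
  linarith

/-- The grid is closed and the boundary compact; being disjoint they are a positive distance apart,
which gives a radius valid for all nodes. -/
theorem exists_ball_disjoint_frontier {n : ℕ} {D : Set (Rn n)} (hD : IsCompact D) {s : Rn n} {N : ℕ}
    (hN : N ≠ 0) (hs : ∀ k : intLattice n, s + (N : ℝ)⁻¹ • (k : Rn n) ∉ frontier D) :
    ∃ δ > (0 : ℝ), ∀ k : intLattice n, ∀ x ∈ Metric.closedBall (s + (N : ℝ)⁻¹ • (k : Rn n)) δ,
      x ∉ frontier D := by
  have hN' : (N : ℝ) ≠ 0 := by exact_mod_cast hN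
  -- T is the grid s + N⁻¹ℤⁿ.
  set T : Set (Rn n) := (fun x => (N : ℝ) • (x - s)) ⁻¹' {x | ∃ k : intLattice n, True ∧ x + k ∈ ({0} : Set (Rn n))}
    with hT
  have hTc : IsClosed T := (isClosed_setOf_add_mem isCompact_singleton _).preimage (by fun_prop)
  have hTk : ∀ k : intLattice n, s + (N : ℝ)⁻¹ • (k : Rn n) ∈ T := fun k =>
    ⟨-k, trivial, by simp [smul_inv_smul₀ hN']⟩
  have hdis : Disjoint (frontier D) T := by
    rw [Set.disjoint_right]
    rintro x ⟨k, -, hk⟩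
    have h1 : (N : ℝ) • (x - s) = ((-k : intLattice n) : Rn n) := by
      rw [AddSubgroup.coe_neg]
      exact eq_neg_of_add_eq_zero_left hk
    have h2 : x = s + (N : ℝ)⁻¹ • ((-k : intLattice n) : Rn n) := by
      rw [← h1, inv_smul_smul₀ hN', add_sub_cancel]
    rw [h2]
    exact hs _
  obtain ⟨δ, hδ, hd⟩ := hdis.exists_cthickenings (hD.of_isClosed_subset isClosed_frontier
    hD.isClosed.frontier_subset) hTc
  refine ⟨δ, hδ, fun k x hx hxf => ?_⟩
  exact Set.disjoint_left.1 hd (Metric.self_subset_cthickening _ hxf)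
    (Metric.mem_cthickening_of_dist_le x _ δ T (hTk k) hx)

theorem closedBall_subset_of_disjoint_frontier {n : ℕ} {D : Set (Rn n)} {x : Rn n} {δ : ℝ}
    (hδ : 0 ≤ δ) (hx : x ∈ D) (h : ∀ y ∈ Metric.closedBall x δ, y ∉ frontier D) :
    Metric.closedBall x δ ⊆ D := by
  by_contra hn
  obtain ⟨y, hy, hyD⟩ := Set.not_subset.1 hn
  obtain ⟨z, -, hz1, hz2⟩ := (convex_closedBall x δ).isPreconnected (interior D) (closure D)ᶜ
    isOpen_interior isClosed_closure.isOpen_compl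
    (fun z hz => by
      by_contra hz'
      rw [Set.mem_union, not_or, Set.notMem_compl_iff] at hz'
      exact h z hz ⟨hz'.2, hz'.1⟩)
    ⟨x, Metric.mem_closedBall_self hδ, by
      by_contra hx'
      exact h x (Metric.mem_closedBall_self hδ) ⟨subset_closure hx, hx'⟩⟩
    ⟨y, hy, fun hy' => h y hy ⟨hy', fun hy'' => hyD (interior_subset hy'')⟩⟩
  exact hz2 (interior_subset_closure hz1)

/-- A bump function `ρ` moved to `ξ` and shrunk to the scale `δ`. -/
def nodeBump {n : ℕ} (ρ : 𝓢(Rn n, ℂ)) {δ : ℝ} (hδ : δ ≠ 0) (ξ : Rn n) : 𝓢(Rn n, ℂ) :=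
  compSubConstCLM ℂ ξ (dilate δ⁻¹ (inv_ne_zero hδ) ρ)

theorem hasCompactSupport_nodeBump {n : ℕ} {ρ : 𝓢(Rn n, ℂ)} (hρ : HasCompactSupport ρ) {δ : ℝ}
    (hδ : δ ≠ 0) (ξ : Rn n) : HasCompactSupport (nodeBump ρ hδ ξ) :=
  hasCompactSupport_compSubConst (hasCompactSupport_dilate _ hρ) ξ

theorem tsupport_nodeBump_subset {n : ℕ} {ρ : 𝓢(Rn n, ℂ)} (hρ : tsupport ρ ⊆ Metric.ball 0 1) {δ : ℝ}
    (hδ : 0 < δ) (ξ : Rn n) : tsupport (nodeBump ρ hδ.ne' ξ) ⊆ Metric.closedBall ξ δ := by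
  rw [nodeBump, tsupport_compSubConst, tsupport_dilate]
  intro x hx
  have h1 := hρ hx
  rw [mem_ball_zero_iff, norm_smul, norm_inv, Real.norm_of_nonneg hδ.le, inv_mul_lt_iff₀ hδ,
    mul_one] at h1
  rw [Metric.mem_closedBall, dist_eq_norm]
  exact h1.le

theorem fourier_nodeBump {n : ℕ} (ρ : 𝓢(Rn n, ℂ)) {δ : ℝ} (hδ : 0 < δ) (ξ x : Rn n) :
    (𝓕 (nodeBump ρ hδ.ne' ξ)) x = ((δ ^ n : ℝ) : ℂ) * (ec (-⟪ξ, x⟫) * (𝓕 ρ) (δ • x)) := by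
  rw [nodeBump, fourier_compSubConst, fourier_dilate, inv_inv, inv_pow, inv_inv,
    abs_of_pos (by positivity)]
  ring

theorem fourierInv_nodeBump {n : ℕ} (ρ : 𝓢(Rn n, ℂ)) {δ : ℝ} (hδ : 0 < δ) (ξ x : Rn n) :
    (𝓕⁻ (nodeBump ρ hδ.ne' ξ)) x = ((δ ^ n : ℝ) : ℂ) * (ec ⟪ξ, x⟫ * (𝓕⁻ ρ) (δ • x)) := by
  have h : ∀ (ψ : 𝓢(Rn n, ℂ)) y, (𝓕⁻ ψ) y = (𝓕 ψ) (-y) := fun ψ y => by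
    rw [SchwartzMap.fourierInv_coe, SchwartzMap.fourier_coe, Real.fourierInv_eq_fourier_neg]
  rw [h, h, fourier_nodeBump ρ hδ, inner_neg_right, neg_neg, smul_neg]

/-- The frequencies of `latSum` are the nodes. Multiplication by (𝓕⁻ ρ)(δ x) spreads each of them
into a bump of radius δ, which still fits in D. -/
theorem exists_schwartz_latSum {n : ℕ} {D : Set (Rn n)} {ρ : 𝓢(Rn n, ℂ)}
    (hρ : tsupport ρ ⊆ Metric.ball 0 1) {s : Rn n} {N : ℕ} {P : Finset (intLattice n)} {δ : ℝ}
    (hδ : 0 < δ) (hPD : ∀ k ∈ P, Metric.closedBall (s + (N : ℝ)⁻¹ • (k : Rn n)) δ ⊆ D)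
    (A : Finset (intLattice n)) (a : intLattice n → ℂ) :
    ∃ Ψ : 𝓢(Rn n, ℂ), (∀ x ∉ D, Ψ x = 0) ∧
      ∀ x, (𝓕⁻ Ψ) x = (𝓕⁻ ρ) (δ • x) * latSum P s N A a x := by
  set ξ : intLattice n → Rn n := fun k => s + (N : ℝ)⁻¹ • (k : Rn n) with hξ
  -- The coefficient of the frequency ξ k in `latSum`, with δ⁻ⁿ to compensate the factor in
  -- `fourierInv_nodeBump`.
  set c : intLattice n → ℂ := fun k => ((δ ^ n : ℝ) : ℂ)⁻¹ * (((N : ℂ) ^ n)⁻¹ *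
    ∑ j ∈ A, a j * ec (-⟪(j : Rn n), ξ k⟫)) with hc
  have hδ' : ((δ ^ n : ℝ) : ℂ) ≠ 0 := by exact_mod_cast (pow_pos hδ n).ne'
  refine ⟨∑ k ∈ P, c k • nodeBump ρ hδ.ne' (ξ k), fun x hx => ?_, fun x => ?_⟩
  · rw [_root_.sum_apply]
    refine Finset.sum_eq_zero fun k hk => ?_
    have : nodeBump ρ hδ.ne' (ξ k) x = 0 := image_eq_zero_of_notMem_tsupport fun h =>
      hx (hPD k hk (tsupport_nodeBump_subset hρ hδ (ξ k) h))
    rw [_root_.smul_apply, this, smul_zero]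
  · have h1 : 𝓕⁻ (∑ k ∈ P, c k • nodeBump ρ hδ.ne' (ξ k)) =
        ∑ k ∈ P, c k • 𝓕⁻ (nodeBump ρ hδ.ne' (ξ k)) := by
      have := map_sum (fourierInvCLM ℂ 𝓢(Rn n, ℂ)) (fun k => c k • nodeBump ρ hδ.ne' (ξ k)) P
      simp only [map_smul] at this
      exact this
    rw [h1, _root_.sum_apply]
    simp only [_root_.smul_apply, fourierInv_nodeBump ρ hδ, smul_eq_mul, latSum, latKer]
    have h2 : ∀ k ∈ P, c k * (((δ ^ n : ℝ) : ℂ) * (ec ⟪ξ k, x⟫ * (𝓕⁻ ρ) (δ • x))) =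
        ∑ j ∈ A, (𝓕⁻ ρ) (δ • x) * (a j * (((N : ℂ) ^ n)⁻¹ * ec ⟪x - (j : Rn n), ξ k⟫)) := by
      intro k _
      have h3 : c k * (((δ ^ n : ℝ) : ℂ) * (ec ⟪ξ k, x⟫ * (𝓕⁻ ρ) (δ • x))) =
          (((N : ℂ) ^ n)⁻¹ * (ec ⟪ξ k, x⟫ * (𝓕⁻ ρ) (δ • x))) *
            ∑ j ∈ A, a j * ec (-⟪(j : Rn n), ξ k⟫) := by
        rw [hc]
        field_simp
      rw [h3, Finset.mul_sum]
      refine Finset.sum_congr rfl fun j _ => ?_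
      rw [inner_sub_left, sub_eq_add_neg, ec_add, real_inner_comm x (ξ k)]
      ring
    rw [Finset.sum_congr rfl h2, Finset.sum_comm, Finset.mul_sum]
    refine Finset.sum_congr rfl fun j _ => ?_
    rw [Finset.mul_sum, Finset.mul_sum, Finset.mul_sum]

section

variable {n : ℕ} {p : ℝ≥0∞} [Fact (1 ≤ p)] {K : Set (Rn n)}

/-- These are the functions to which sampling and interpolation are applied. Each class modulo N
carries at most one coefficient, and the factor (𝓕⁻ ρ)(δ ·) sampled along that class contributes at
most a constant times (δN)⁻ⁿ. -/
theorem exists_bandLimited_contRep_eq_mul_latSum (hK : IsCompact K)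
    (hD : SpectralDomain (normalize K)) (hp : 1 < p) (hp' : p ≠ ∞) {ρ : 𝓢(Rn n, ℂ)}
    (hρ : tsupport ρ ⊆ Metric.ball 0 1) {B : ℝ≥0}
    (hB : ∀ η : ℝ, 0 < η → η ≤ 1 → ∀ y : Rn n,
      ∑' l : intLattice n, ‖(𝓕⁻ ρ) (y + η • (l : Rn n))‖ₑ ^ p.toReal ≤ B * ENNReal.ofReal (η ^ n)⁻¹)
    {s : Rn n} {N : ℕ} (hN : N ≠ 0)
    (hs : ∀ k : intLattice n, s + (N : ℝ)⁻¹ • (k : Rn n) ∉ frontier (normalize K))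
    {P : Finset (intLattice n)}
    (hP : ∀ k : intLattice n, k ∈ P ↔ s + (N : ℝ)⁻¹ • (k : Rn n) ∈ normalize K)
    (h0 : ‖latKer P s N 0‖ ≤ 2) {A : Finset (intLattice n)} (hA : Incongruent N A)
    (a : intLattice n → ℂ) {δ : ℝ} (hδ : 0 < δ) (hδN : δ * N ≤ 1)
    (hball : ∀ k : intLattice n, ∀ x ∈ Metric.closedBall (s + (N : ℝ)⁻¹ • (k : Rn n)) δ,
      x ∉ frontier (normalize K)) :
    ∃ f ∈ bandLimited K p, (∀ x, contRep f x = (𝓕⁻ ρ) (δ • x) * latSum P s N A a x) ∧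
      ∑' m : intLattice n, ‖contRep f m‖ₑ ^ p.toReal ≤
        2 ^ p.toReal * (B * ENNReal.ofReal ((δ * N) ^ n)⁻¹) * ∑ k ∈ A, ‖a k‖ₑ ^ p.toReal := by
  have hq := one_lt_toReal hp hp'
  have hN' : (0 : ℝ) < N := by exact_mod_cast Nat.pos_of_ne_zero hN
  obtain ⟨Ψ, hΨ, hΨ'⟩ := exists_schwartz_latSum hρ hδ (fun k hk =>
    closedBall_subset_of_disjoint_frontier hδ.le ((hP k).1 hk) (hball k)) A a
  have hfin : FinLq p.toReal (𝓕⁻ Ψ : 𝓢(Rn n, ℂ)) :=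
    (finLq_iff_memLp (zero_lt_one.trans hp).ne' hp').2 ((𝓕⁻ Ψ).memLp p volume)
  have hvan : FVanishOn (𝓕⁻ Ψ : 𝓢(Rn n, ℂ)) (normalize K)ᶜ := by
    intro φ _ hφ
    rw [SchwartzMap.fourierInv_coe, integral_fourier_mul_fourierInv φ Ψ.integrable]
    refine integral_eq_zero_of_ae (Filter.Eventually.of_forall fun x => ?_)
    by_cases hx : x ∈ normalize K
    · simp [image_eq_zero_of_notMem_tsupport fun h => hφ h hx]
    · simp [hΨ x hx]
  obtain ⟨f, hf, hfe⟩ := exists_bandLimited_contRep_eq hK hp hp' hfin (𝓕⁻ Ψ).continuous hvan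
  refine ⟨f, hf, fun x => by rw [hfe, hΨ'], ?_⟩
  rw [hfe]
  simp only [hΨ', enorm_mul]
  simp only [ENNReal.mul_rpow_of_nonneg _ _ (zero_le_one.trans hq.le)]
  refine hD.tsum_mul_latSum_le (w := fun x => ‖(𝓕⁻ ρ) (δ • x)‖ₑ ^ p.toReal) hN hs hP h0 hA a
    (by linarith) fun k => ?_
  have h1 := hB (δ * N) (by positivity) hδN (δ • (k : Rn n))
  simpa only [smul_add, smul_smul] using h1

/-! ### Stable sampling implies the synthesis bound -/

theorem SpectralDomain.eventually_latKer_zero {D : Set (Rn n)} (hD : SpectralDomain D) {s : Rn n}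
    {P : ℕ → Finset (intLattice n)}
    (hP : ∀ N : ℕ, N ≠ 0 → ∀ k : intLattice n, k ∈ P N ↔ s + (N : ℝ)⁻¹ • (k : Rn n) ∈ D) :
    ∀ᶠ N in Filter.atTop, ‖latKer (P N) s N 0‖ ≤ 2 := by
  have h := (tendsto_latKer hD hP 0).norm
  have h1 : ker D 0 = 1 := by simpa using hD.ker_int 0
  rw [h1, norm_one] at h
  filter_upwards [h.eventually_le_const (by norm_num : (1 : ℝ) < 2)] with N hN using hN

theorem exists_scale {D : Set (Rn n)} (hD : IsCompact D) {s : Rn n} {N : ℕ} (hN : N ≠ 0)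
    (hs : ∀ k : intLattice n, s + (N : ℝ)⁻¹ • (k : Rn n) ∉ frontier D) {η₀ : ℝ} (hη : 0 < η₀) :
    ∃ δ > (0 : ℝ), δ * N ≤ η₀ ∧ δ * N ≤ 1 ∧ ∀ k : intLattice n,
      ∀ x ∈ Metric.closedBall (s + (N : ℝ)⁻¹ • (k : Rn n)) δ, x ∉ frontier D := by
  have hN' : (0 : ℝ) < N := by exact_mod_cast Nat.pos_of_ne_zero hN
  obtain ⟨δ, hδ, h⟩ := exists_ball_disjoint_frontier hD hN hs
  refine ⟨min δ (min (η₀ / N) (1 / N)), by positivity, ?_, ?_, fun k x hx =>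
    h k x (Metric.closedBall_subset_closedBall (min_le_left _ _) hx)⟩
  · exact (le_div_iff₀ hN').1 ((min_le_right _ _).trans (min_le_left _ _))
  · exact (le_div_iff₀ hN').1 ((min_le_right _ _).trans (min_le_right _ _))

/-- Nⁿ times the integral over the cube of the full sum equals ∫ g, by unfolding and the change of
variables x ↦ N x. -/
theorem ofReal_pow_mul_lintegral_cube_le {g : Rn n → ℝ≥0∞} (hg : Measurable g) {N : ℕ} (hN : N ≠ 0)
    {v : Rn n → ℝ≥0∞} (hv : ∀ x, v x ≤ ∑' l : intLattice n, g ((N : ℝ) • (x + l))) :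
    ENNReal.ofReal ((N : ℝ) ^ n) * ∫⁻ x in cube n, v x ≤ ∫⁻ x, g x := by
  have hN' : (0 : ℝ) < N := by exact_mod_cast Nat.pos_of_ne_zero hN
  have h1 := lintegral_comp_add_smul hg hN' 0
  simp only [zero_add] at h1
  have h2 : ∫⁻ x in cube n, v x ≤ ENNReal.ofReal ((N : ℝ) ^ n)⁻¹ * ∫⁻ x, g x := by
    rw [← h1, lintegral_eq_lintegral_cube_tsum (f := fun x => g ((N : ℝ) • x))
      (hg.comp (measurable_const_smul _))]
    refine lintegral_mono fun x => (hv x).trans (le_of_eq (tsum_congr fun l => ?_))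
    rw [add_comm]
  refine (mul_le_mul' le_rfl h2).trans (le_of_eq ?_)
  rw [← mul_assoc, ← ENNReal.ofReal_mul (by positivity), mul_inv_cancel₀ (by positivity),
    ENNReal.ofReal_one, one_mul]

theorem enorm_latSum_smul_add (P : Finset (intLattice n)) (s : Rn n) {N : ℕ} (hN : N ≠ 0)
    (A : Finset (intLattice n)) (a : intLattice n → ℂ) (x : Rn n) (l : intLattice n) :
    ‖latSum P s N A a ((N : ℝ) • (x + l))‖ₑ = ‖latSum P s N A a ((N : ℝ) • x)‖ₑ := by
  rw [smul_add, latSum_add P s hN, enorm_mul, enorm_ec, one_mul]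

/-- Sampling is applied to f = (𝓕⁻ ρ)(δ ·) · latSum. As |latSum| is periodic under Nℤⁿ, ‖f‖_p^p is
at least a constant times (δN)⁻ⁿ times the integral of |latSum|^p over a period, while the samples
contribute at most a constant times (δN)⁻ⁿ ∑ |a(k)|^p. The factor (δN)⁻ⁿ, which cannot be controlled
as N grows, cancels. -/
theorem IsStableSampling.exists_kerBound (hK : IsCompact K) (hD : SpectralDomain (normalize K))
    (hp : 1 < p) (hp' : p ≠ ∞) (h : IsStableSampling (intLattice n : Set (Rn n)) K p) :
    ∃ C : ℝ≥0, KerBound (normalize K) p.toReal C := by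
  have hq := one_lt_toReal hp hp'
  set q := p.toReal
  obtain ⟨C₁, hC₁⟩ := h
  obtain ⟨ρ, hρ, -, hρr, hρ0⟩ := exists_bump n
  have hφ0 : (𝓕⁻ ρ) 0 ≠ 0 := by
    rwa [SchwartzMap.fourierInv_coe, Real.fourierInv_eq_fourier_neg, neg_zero, ← SchwartzMap.fourier_coe]
  obtain ⟨B, hB⟩ := exists_tsum_enorm_rpow_le (𝓕⁻ ρ) hq.le
  obtain ⟨c, hc, η₀, hη₀, hcη⟩ := exists_le_tsum_norm_rpow (𝓕⁻ ρ).continuous hφ0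
    (zero_lt_one.trans hq)
  obtain ⟨s, hs⟩ := hD.exists_shift
  obtain ⟨P, hP⟩ := exists_nodes hD.isCompact s
  refine ⟨c⁻¹ * (C₁ * (2 ^ q * B)), KerBound.of_latSum hD hP fun A a => ?_⟩
  filter_upwards [Filter.eventually_ne_atTop 0, eventually_incongruent A,
    hD.eventually_latKer_zero hP] with N hN hA h0
  have hN' : (0 : ℝ) < N := by exact_mod_cast Nat.pos_of_ne_zero hN
  obtain ⟨δ, hδ, hδη, hδ1, hball⟩ := exists_scale hD.isCompact hN (hs N) hη₀
  obtain ⟨f, hf, hfx, hfs⟩ := exists_bandLimited_contRep_eq_mul_latSum hK hD hp hp' hρ hB hN (hs N)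
    (hP N hN) h0 hA a hδ hδ1 hball
  set E := ENNReal.ofReal ((δ * N) ^ n)⁻¹ with hE
  have hE0 : E ≠ 0 := by rw [hE]; simp; positivity
  have hEt : E ≠ ∞ := ENNReal.ofReal_ne_top
  have h1 : ENNReal.ofReal ((N : ℝ) ^ n) * ∫⁻ x in cube n,
      (c * E) * ‖latSum (P N) s N A a ((N : ℝ) • x)‖ₑ ^ q ≤ ∫⁻ x, ‖contRep f x‖ₑ ^ q := by
    refine ofReal_pow_mul_lintegral_cube_le
      ((continuous_contRep hK hp hp' hf).enorm.measurable.pow_const q) hN fun x => ?_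
    refine (mul_le_mul' (hcη (δ * N) (by positivity) hδη ((δ * N) • x)) le_rfl).trans ?_
    rw [← ENNReal.tsum_mul_right]
    refine le_of_eq (tsum_congr fun l => ?_)
    rw [hfx, enorm_mul, enorm_latSum_smul_add _ _ hN, ENNReal.mul_rpow_of_nonneg _ _ (by linarith),
      smul_smul, smul_add]
  rw [lintegral_const_mul' _ _ (ENNReal.mul_ne_top ENNReal.coe_ne_top hEt),
    lintegral_contRep hK hp hp' hf] at h1
  have h2 := (h1.trans (hC₁ f hf)).trans (mul_le_mul' le_rfl hfs)
  have hc' : (c : ℝ≥0∞) ≠ 0 := by exact_mod_cast hc.ne'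
  set I := ENNReal.ofReal ((N : ℝ) ^ n) * ∫⁻ x in cube n, ‖latSum (P N) s N A a ((N : ℝ) • x)‖ₑ ^ q
  set T := ∑ k ∈ A, ‖a k‖ₑ ^ q
  have h3 : E * (c * I) ≤ E * (C₁ * (2 ^ q * B) * T) := by
    refine le_trans (le_of_eq ?_) (h2.trans (le_of_eq ?_)) <;> ring
  have h4 := (ENNReal.mul_le_mul_iff_right hE0 hEt).1 h3
  have h5 : I = (c : ℝ≥0∞)⁻¹ * (c * I) := by
    rw [← mul_assoc, ENNReal.inv_mul_cancel hc' ENNReal.coe_ne_top, one_mul]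
  rw [h5, ENNReal.coe_mul, ENNReal.coe_inv hc.ne', mul_assoc]
  refine mul_le_mul' le_rfl (h4.trans (le_of_eq ?_))
  rw [ENNReal.coe_mul, ENNReal.coe_mul, ENNReal.coe_rpow_of_nonneg _ (by linarith)]
  rfl

end

/-! ### Stable interpolation implies the synthesis bound -/

section

variable {n : ℕ}

theorem norm_fourier_mul_ec_le (ρ : 𝓢(Rn n, ℂ)) (s : Rn n) {δ t : ℝ} (hδ : δ ≠ 0)
    (ht : t ≠ 0) : ∃ C : ℝ, ∀ x, ‖(𝓕 ρ) (δ • (t • x)) * ec (-⟪t • x, s⟫)‖ ≤ C * wt x := by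
  obtain ⟨C, -, hC⟩ := exists_norm_le_wt (dilate t ht (dilate δ hδ (𝓕 ρ)))
  exact ⟨C, fun x => by simpa using hC x⟩

/-- Poisson summation for the product of F, the transformed bump and a character, all dilated by N.
Its Fourier transform at an integer point k is, up to a constant, the pairing of F with the
transform of the bump at the node s + k / N, which is zero. -/
theorem tsum_mul_fourier_eq_zero {F : Rn n → ℂ} (hFc : Continuous F) {M : ℝ} (hM : ∀ x, ‖F x‖ ≤ M)
    {U : Set (Rn n)} (hF : FVanishOn F U) {ρ : 𝓢(Rn n, ℂ)} (hρ : tsupport ρ ⊆ Metric.ball 0 1)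
    (hρc : HasCompactSupport ρ) {s : Rn n} {N : ℕ} (hN : N ≠ 0) {δ : ℝ} (hδ : 0 < δ)
    (hball : ∀ k : intLattice n, Metric.closedBall (s + (N : ℝ)⁻¹ • (k : Rn n)) δ ⊆ U) (x : Rn n) :
    ∑' l : intLattice n, F ((N : ℝ) • (x + l)) *
      ((𝓕 ρ) (δ • ((N : ℝ) • (x + l))) * ec (-⟪(N : ℝ) • (x + l), s⟫)) = 0 := by
  have hN' : (0 : ℝ) < N := by exact_mod_cast Nat.pos_of_ne_zero hN
  have := continuous_ec
  set g : Rn n → ℂ := fun y => F y * ((𝓕 ρ) (δ • y) * ec (-⟪y, s⟫)) with hg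
  set u : Rn n → ℂ := fun y => g ((N : ℝ) • y) with hu
  obtain ⟨C, hC⟩ := norm_fourier_mul_ec_le ρ s hδ.ne' hN'.ne'
  have hM0 : 0 ≤ M := (norm_nonneg _).trans (hM 0)
  have huc : Continuous u := by
    have := (𝓕 ρ).continuous
    rw [hu, hg]
    fun_prop
  have hub : ∀ y, ‖u y‖ ≤ (M * C) * wt y := fun y => by
    rw [hu, hg]
    beta_reduce
    rw [norm_mul, mul_assoc]
    exact mul_le_mul (hM _) (hC y) (norm_nonneg _) hM0
  have hF0 : ∀ k : intLattice n, 𝓕 u k = 0 := by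
    intro k
    have h1 := hF (nodeBump ρ hδ.ne' (s + (N : ℝ)⁻¹ • (k : Rn n)))
      (hasCompactSupport_nodeBump hρc _ _) ((tsupport_nodeBump_subset hρ hδ _).trans (hball k))
    have h2 : ∀ y, ec (-⟪(N : ℝ)⁻¹ • ((N : ℝ) • y), (k : Rn n)⟫) * g ((N : ℝ) • y) =
        ec (-⟪y, (k : Rn n)⟫) * u y := fun y => by rw [inv_smul_smul₀ hN'.ne']
    rw [fourier_eq_ec, ← integral_congr_ae (Filter.Eventually.of_forall h2),
      Measure.integral_comp_smul volume
        (fun z => ec (-⟪(N : ℝ)⁻¹ • z, (k : Rn n)⟫) * g z) (N : ℝ)]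
    refine smul_eq_zero_of_right _ ?_
    have h3 : ((δ ^ n : ℝ) : ℂ) ≠ 0 := by exact_mod_cast (pow_pos hδ n).ne'
    refine (mul_eq_zero.1 (?_ : ((δ ^ n : ℝ) : ℂ) * _ = 0)).resolve_left h3
    rw [← integral_const_mul, ← h1]
    refine integral_congr_ae (Filter.Eventually.of_forall fun z => ?_)
    beta_reduce
    rw [fourier_nodeBump ρ hδ, inner_add_left, neg_add, ec_add, real_inner_smul_left,
      real_inner_smul_left, real_inner_comm z s, real_inner_comm z (k : Rn n), hg]
    ring
  have h := hasSum_fourier_mul_ec huc hub (by simp only [hF0]; exact summable_zero) x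
  simp only [hF0, zero_mul] at h
  exact h.unique hasSum_zero

theorem summable_fourier_mul_ec (ρ : 𝓢(Rn n, ℂ)) (s : Rn n) {δ t : ℝ} (hδ : δ ≠ 0)
    (ht : t ≠ 0) (x : Rn n) : Summable fun l : intLattice n =>
      ‖(𝓕 ρ) (δ • (t • (x + (l : Rn n)))) * ec (-⟪t • (x + (l : Rn n)), s⟫)‖ := by
  obtain ⟨C, hC⟩ := norm_fourier_mul_ec_le ρ s hδ ht
  exact ((summable_wt_add x).mul_left C).of_nonneg_of_le (fun _ => norm_nonneg _) fun l => hC _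

/-- The difference G - H has no spectrum near the nodes, so the weighted sums of G and H over the
points N (x + l) agree. In the sum for G the twist by s and the conjugate factor turn each term into
one common number, of modulus |latSum (N x)|, times |𝓕⁻ ρ|² at the point. -/
theorem enorm_latSum_mul_tsum_le {G H : Rn n → ℂ} (hFc : Continuous fun x => G x - H x) {M M' : ℝ}
    (hM : ∀ x, ‖G x - H x‖ ≤ M) (hM' : ∀ x, ‖H x‖ ≤ M') {U : Set (Rn n)}
    (hF : FVanishOn (fun x => G x - H x) U) {ρ : 𝓢(Rn n, ℂ)}
    (hρ : tsupport ρ ⊆ Metric.ball 0 1) (hρc : HasCompactSupport ρ)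
    (hconj : ∀ x, (𝓕 ρ) x = (starRingEnd ℂ) ((𝓕⁻ ρ) x)) {s : Rn n} {N : ℕ} (hN : N ≠ 0) {δ : ℝ}
    (hδ : 0 < δ)
    (hball : ∀ k : intLattice n, Metric.closedBall (s + (N : ℝ)⁻¹ • (k : Rn n)) δ ⊆ U)
    {P A : Finset (intLattice n)} {a : intLattice n → ℂ}
    (hG : ∀ x, G x = (𝓕⁻ ρ) (δ • x) * latSum P s N A a x) (x : Rn n) :
    ‖latSum P s N A a ((N : ℝ) • x)‖ₑ *
        ∑' l : intLattice n, ‖(𝓕⁻ ρ) (δ • ((N : ℝ) • (x + l)))‖ₑ ^ (2 : ℝ) ≤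
      ∑' l : intLattice n, ‖H ((N : ℝ) • (x + l))‖ₑ * ‖(𝓕⁻ ρ) (δ • ((N : ℝ) • (x + l)))‖ₑ := by
  have hN' : (0 : ℝ) < N := by exact_mod_cast Nat.pos_of_ne_zero hN
  set y : intLattice n → Rn n := fun l => (N : ℝ) • (x + l) with hy
  set w : intLattice n → ℂ := fun l => (𝓕 ρ) (δ • y l) * ec (-⟪y l, s⟫) with hw
  have hws : Summable fun l => ‖w l‖ := summable_fourier_mul_ec ρ s hδ.ne' hN'.ne' x
  have hwn : ∀ l, ‖w l‖ = ‖(𝓕⁻ ρ) (δ • y l)‖ := fun l => by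
    rw [hw]
    beta_reduce
    rw [norm_mul, norm_ec, mul_one, hconj, RCLike.norm_conj]
  have hbs : ∀ {F : Rn n → ℂ} {M : ℝ}, (∀ x, ‖F x‖ ≤ M) → Summable fun l => F (y l) * w l := by
    intro F M h
    refine Summable.of_norm_bounded (hws.mul_left M) fun l => ?_
    rw [norm_mul]
    exact mul_le_mul_of_nonneg_right (h _) (norm_nonneg _)
  have h1 : ∑' l, (G (y l) - H (y l)) * w l = 0 :=
    tsum_mul_fourier_eq_zero hFc hM hF hρ hρc hN hδ hball x
  have h2 : ∑' l, G (y l) * w l = ∑' l, H (y l) * w l := by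
    have h3 := (hbs hM).tsum_add (hbs hM')
    rw [h1, zero_add] at h3
    rw [← h3]
    exact tsum_congr fun l => by ring
  have h4 : ∀ l, G (y l) * w l = (ec (-⟪(N : ℝ) • x, s⟫) * latSum P s N A a ((N : ℝ) • x)) *
      ((‖(𝓕⁻ ρ) (δ • y l)‖ ^ 2 : ℝ) : ℂ) := by
    intro l
    have h5 : latSum P s N A a (y l) * ec (-⟪y l, s⟫) =
        ec (-⟪(N : ℝ) • x, s⟫) * latSum P s N A a ((N : ℝ) • x) := by
      rw [hy]
      beta_reduce
      rw [smul_add, latSum_add P s hN, inner_add_left, neg_add, ec_add]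
      have h6 := ec_neg_mul ⟪(N : ℝ) • (l : Rn n), s⟫
      linear_combination ec (-⟪(N : ℝ) • x, s⟫) * latSum P s N A a ((N : ℝ) • x) * h6
    rw [← h5, hG, hw]
    beta_reduce
    have h7 := RCLike.mul_conj ((𝓕⁻ ρ) (δ • y l))
    rw [← hconj] at h7
    push_cast
    linear_combination latSum P s N A a (y l) * ec (-⟪y l, s⟫) * h7
  have h5 : Summable fun l => ‖(𝓕⁻ ρ) (δ • y l)‖ ^ 2 := by
    obtain ⟨C, hC0, hC⟩ := exists_norm_le_wt (𝓕⁻ ρ)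
    refine (hws.mul_left C).of_nonneg_of_le (fun _ => by positivity) fun l => ?_
    rw [hwn, sq]
    exact mul_le_mul_of_nonneg_right ((hC _).trans (mul_le_of_le_one_right hC0.le (wt_le_one _)))
      (norm_nonneg _)
  calc _ = ‖∑' l, G (y l) * w l‖ₑ := by
        simp only [h4]
        rw [tsum_mul_left, enorm_mul, enorm_mul, enorm_ec, one_mul, ← Complex.ofReal_tsum]
        congr 1
        rw [← ofReal_norm, Complex.norm_real, Real.norm_of_nonneg (tsum_nonneg fun _ => by positivity),
          ENNReal.ofReal_tsum_of_nonneg (fun _ => by positivity) h5]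
        refine tsum_congr fun l => ?_
        rw [ENNReal.ofReal_pow (norm_nonneg _), ofReal_norm, ENNReal.rpow_ofNat]
    _ ≤ ∑' l, ‖H (y l) * w l‖ₑ := by
        rw [h2]
        exact enorm_tsum_le_tsum_enorm
    _ = _ := by
        refine tsum_congr fun l => ?_
        rw [enorm_mul, ← ofReal_norm (w l), hwn, ofReal_norm]

theorem tsum_mul_rpow_le_of_le {ι : Type*} [Countable ι] {q : ℝ} (hq : 1 < q) (f k : ι → ℝ≥0∞)
    {A B : ℝ≥0∞} (hA : ∑' i, k i ≤ A) (hB : ∀ i, k i ≤ B) :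
    (∑' i, f i * k i) ^ q ≤ A ^ (q - 1) * (B * ∑' i, f i ^ q) := by
  let _ : MeasurableSpace ι := ⊤
  have h := lintegral_mul_rpow_le_of_le (μ := Measure.count) hq
    (measurable_from_top (f := f)).aemeasurable (measurable_from_top (f := k)).aemeasurable (A := A)
    (by rwa [lintegral_count]) hB
  simpa only [lintegral_count] using h

end

section

variable {n : ℕ} {p : ℝ≥0∞} [Fact (1 ≤ p)] {K : Set (Rn n)}

theorem FVanishOn.sub {f g : Rn n → ℂ} {U : Set (Rn n)} (hf : FVanishOn f U) {q : ℝ} (hq : 1 < q)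
    (hfq : FinLq q f) (hgq : FinLq q g) (hg : FVanishOn g U) : FVanishOn (fun x => f x - g x) U := by
  intro φ h1 h2
  simp only [mul_sub]
  rw [integral_sub (hfq.integrable_schwartz_mul hq _) (hgq.integrable_schwartz_mul hq _),
    hf φ h1 h2, hg φ h1 h2, sub_zero]

theorem exists_norm_contRep_le (hK : IsCompact K) (hp : 1 < p) (hp' : p ≠ ∞)
    {f : Lp ℂ p (volume : Measure (Rn n))} (hf : f ∈ bandLimited K p) :
    ∃ M : ℝ, ∀ x, ‖contRep f x‖ ≤ M := by
  obtain ⟨θ, hθ⟩ := exists_contRep_eq_convS hK hp hp'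
  obtain ⟨M, hM⟩ := FinLq.exists_lintegral_le (one_lt_toReal hp hp')
    ((finLq_iff_memLp (zero_lt_one.trans hp).ne' hp').2 (Lp.memLp f)) θ
  refine ⟨M, fun x => ?_⟩
  have h := (enorm_convS_le θ f x).trans (hM x)
  rw [← (hθ f hf).1] at h
  exact_mod_cast h

/-- The open mapping theorem for the sampling operator makes the choice of an interpolant
quantitative. -/
theorem IsStableInterpolation.exists_enorm_le (hK : IsCompact K) (hp : 1 < p) (hp' : p ≠ ∞)
    (h : IsStableInterpolation (intLattice n : Set (Rn n)) K p) :
    ∃ C : ℝ≥0, ∀ f ∈ bandLimited K p, ∃ g ∈ bandLimited K p,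
      (∀ k : intLattice n, contRep g k = contRep f k) ∧
        ‖g‖ₑ ^ p.toReal ≤ C * ∑' k : intLattice n, ‖contRep f k‖ₑ ^ p.toReal := by
  have : CompleteSpace (bandLimited K p) := (isClosed_bandLimited hK hp hp').completeSpace_coe
  have hq := one_lt_toReal hp hp'
  obtain ⟨S, hS⟩ := exists_sampling (K := K) hK hp hp'
  have hsurj : Function.Surjective S := by
    intro a
    obtain ⟨f, hf, hfa⟩ := h a
    refine ⟨⟨f, hf⟩, lp.ext (funext fun k => ?_)⟩
    rw [hS]
    exact hfa k
  obtain ⟨C, hC0, hC⟩ := S.exists_preimage_norm_le hsurj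
  refine ⟨C.toNNReal ^ p.toReal, fun f hf => ?_⟩
  obtain ⟨g, hg, hgn⟩ := hC (S ⟨f, hf⟩)
  refine ⟨g, g.2, fun k => ?_, ?_⟩
  · rw [← hS, hg, hS]
  · have h1 : ‖(g : Lp ℂ p (volume : Measure (Rn n)))‖ₑ ≤ C.toNNReal * ‖S ⟨f, hf⟩‖ₑ := by
      have h2 := ENNReal.ofReal_le_ofReal hgn
      rwa [ENNReal.ofReal_mul hC0.le, ofReal_norm, ofReal_norm] at h2
    refine (ENNReal.rpow_le_rpow h1 (by linarith)).trans (le_of_eq ?_)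
    rw [ENNReal.mul_rpow_of_nonneg _ _ (by linarith), lp_enorm_rpow_eq_tsum hp hp',
      ENNReal.coe_rpow_of_nonneg _ (by linarith)]
    simp only [hS]

/-- The function f = (𝓕⁻ ρ)(δ ·) · latSum is compared with an interpolant g of its samples whose
norm is controlled. Although f and g may differ, f - g vanishes on ℤⁿ, so its spectrum lies in ∂D,
outside the δ-balls around all nodes. Hence latSum is bounded by weighted averages of g. -/
theorem IsStableInterpolation.exists_kerBound (hK : IsCompact K)
    (hD : SpectralDomain (normalize K)) (hp : 1 < p) (hp' : p ≠ ∞)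
    (h : IsStableInterpolation (intLattice n : Set (Rn n)) K p) :
    ∃ C : ℝ≥0, KerBound (normalize K) p.toReal C := by
  have hq := one_lt_toReal hp hp'
  obtain ⟨C, hC⟩ := h.exists_enorm_le hK hp hp'
  set q := p.toReal
  obtain ⟨ρ, hρ, hρc, hρr, hρ0⟩ := exists_bump n
  have hφ0 : (𝓕⁻ ρ) 0 ≠ 0 := by
    rwa [SchwartzMap.fourierInv_coe, Real.fourierInv_eq_fourier_neg, neg_zero,
      ← SchwartzMap.fourier_coe]
  have hconj : ∀ x, (𝓕 ρ) x = (starRingEnd ℂ) ((𝓕⁻ ρ) x) := fun x => by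
    rw [SchwartzMap.fourier_coe, SchwartzMap.fourierInv_coe, fourier_eq_ec, fourierInv_eq_ec,
      ← integral_conj]
    simp only [map_mul, conj_ec, hρr]
  obtain ⟨B, hB⟩ := exists_tsum_enorm_rpow_le (𝓕⁻ ρ) hq.le
  obtain ⟨B₁, hB₁⟩ := exists_tsum_enorm_rpow_le (𝓕⁻ ρ) le_rfl
  obtain ⟨M, hM⟩ := BandLimited.exists_enorm_le (𝓕⁻ ρ)
  obtain ⟨c, hc, η₀, hη₀, hcη⟩ := exists_le_tsum_norm_rpow (𝓕⁻ ρ).continuous hφ0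
    (zero_lt_two' ℝ)
  obtain ⟨s, hs⟩ := hD.exists_shift
  obtain ⟨P, hP⟩ := exists_nodes hD.isCompact s
  refine ⟨(c ^ q)⁻¹ * (B₁ ^ (q - 1) * (M * (C * (2 ^ q * B)))), KerBound.of_latSum hD hP fun A a => ?_⟩
  filter_upwards [Filter.eventually_ne_atTop 0, eventually_incongruent A,
    hD.eventually_latKer_zero hP] with N hN hA h0
  have hN' : (0 : ℝ) < N := by exact_mod_cast Nat.pos_of_ne_zero hN
  obtain ⟨δ, hδ, hδη, hδ1, hball⟩ := exists_scale hD.isCompact hN (hs N) hη₀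
  obtain ⟨f, hf, hfx, hfs⟩ := exists_bandLimited_contRep_eq_mul_latSum hK hD hp hp' hρ hB hN (hs N)
    (hP N hN) h0 hA a hδ hδ1 hball
  obtain ⟨g, hg, hgf, hgn⟩ := hC f hf
  set E := ENNReal.ofReal ((δ * N) ^ n)⁻¹ with hE
  have hE0 : E ≠ 0 := by rw [hE]; simp; positivity
  have hEt : E ≠ ∞ := ENNReal.ofReal_ne_top
  obtain ⟨Mf, hMf⟩ := exists_norm_contRep_le hK hp hp' hf
  obtain ⟨Mg, hMg⟩ := exists_norm_contRep_le hK hp hp' hg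
  have hfc := continuous_contRep hK hp hp' hf
  have hgc := continuous_contRep hK hp hp' hg
  have hfin := (finLq_contRep hK hp hp' hf).sub hq (finLq_contRep hK hp hp' hg)
  have hvan : FVanishOn (fun x => contRep f x - contRep g x) (frontier (normalize K))ᶜ := by
    refine hD.fVanishOn_compl_frontier hq hfin (hfc.sub hgc) ?_ fun k => by rw [hgf, sub_self]
    exact (fVanishOn_contRep hK hp hp' hf).sub hq (finLq_contRep hK hp hp' hf)
      (finLq_contRep hK hp hp' hg) (fVanishOn_contRep hK hp hp' hg)
  have hpt := enorm_latSum_mul_tsum_le (hfc.sub hgc)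
    (fun x => (norm_sub_le _ _).trans (add_le_add (hMf x) (hMg x))) hMg hvan hρ hρc hconj hN hδ hball hfx
  have h1 : ENNReal.ofReal ((N : ℝ) ^ n) * ∫⁻ x in cube n,
      (c * E) ^ q * ‖latSum (P N) s N A a ((N : ℝ) • x)‖ₑ ^ q ≤
        ∫⁻ x, ((B₁ * E) ^ (q - 1) * M) * ‖contRep g x‖ₑ ^ q := by
    refine ofReal_pow_mul_lintegral_cube_le ((hgc.enorm.measurable.pow_const q).const_mul _) hN
      fun x => ?_
    have hsm : ∀ l : intLattice n, δ • ((N : ℝ) • (x + l)) = (δ * N) • x + (δ * N) • (l : Rn n) :=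
      fun l => by rw [smul_smul, smul_add]
    have h2 := hcη (δ * N) (by positivity) hδη ((δ * N) • x)
    have h3 : ∑' l : intLattice n, ‖(𝓕⁻ ρ) (δ • ((N : ℝ) • (x + l)))‖ₑ ≤ B₁ * E := by
      have := hB₁ (δ * N) (by positivity) hδ1 ((δ * N) • x)
      simpa only [ENNReal.rpow_one, hsm] using this
    rw [← ENNReal.mul_rpow_of_nonneg _ _ (by linarith), ENNReal.tsum_mul_left]
    -- Jensen's inequality for the sum over l with weights |𝓕⁻ ρ|, each at most M and of total mass
    -- at most B₁ E.
    refine le_trans (ENNReal.rpow_le_rpow ?_ (by linarith))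
      ((tsum_mul_rpow_le_of_le hq (fun l : intLattice n => ‖contRep g ((N : ℝ) • (x + l))‖ₑ) _ h3
        fun l => hM _).trans_eq (mul_assoc _ _ _).symm)
    refine le_trans ?_ (hpt x)
    rw [mul_comm]
    refine mul_le_mul' le_rfl (h2.trans (le_of_eq ?_))
    simp only [hsm]
  have hcE : (c * E : ℝ≥0∞) ^ q ≠ ∞ :=
    ENNReal.rpow_ne_top_of_nonneg (by linarith) (ENNReal.mul_ne_top ENNReal.coe_ne_top hEt)
  rw [lintegral_const_mul' _ _ hcE,
    lintegral_const_mul _ (hgc.enorm.measurable.pow_const q), lintegral_contRep hK hp hp' hg] at h1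
  have h2 := h1.trans (mul_le_mul' le_rfl (hgn.trans (mul_le_mul' le_rfl hfs)))
  have hc' : (c : ℝ≥0∞) ^ q ≠ 0 :=
    (ENNReal.rpow_pos (by exact_mod_cast hc) ENNReal.coe_ne_top).ne'
  have hct : (c : ℝ≥0∞) ^ q ≠ ∞ := ENNReal.rpow_ne_top_of_nonneg (by linarith) ENNReal.coe_ne_top
  set I := ENNReal.ofReal ((N : ℝ) ^ n) * ∫⁻ x in cube n, ‖latSum (P N) s N A a ((N : ℝ) • x)‖ₑ ^ q
  set T := ∑ k ∈ A, ‖a k‖ₑ ^ q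
  -- The two sides have the same homogeneity in E = (δN)⁻ⁿ: the exponent is q on the left, and q - 1
  -- from Jensen's inequality plus 1 from the samples on the right. So E cancels.
  have hEq : E ^ q = E ^ (q - 1) * E := by
    conv_lhs => rw [← sub_add_cancel q 1, ENNReal.rpow_add _ _ hE0 hEt, ENNReal.rpow_one]
  rw [ENNReal.mul_rpow_of_nonneg _ _ (by linarith : 0 ≤ q),
    ENNReal.mul_rpow_of_nonneg _ _ (by linarith : 0 ≤ q - 1)] at h2
  have h3 : E ^ q * ((c : ℝ≥0∞) ^ q * I) ≤
      E ^ q * ((B₁ : ℝ≥0∞) ^ (q - 1) * (M * (C * (2 ^ q * B))) * T) := by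
    refine le_trans (le_of_eq ?_) (h2.trans (le_of_eq ?_))
    · ring
    · rw [hEq]; ring
  have h4 := (ENNReal.mul_le_mul_iff_right (ENNReal.rpow_pos (pos_iff_ne_zero.2 hE0) hEt).ne'
    (ENNReal.rpow_ne_top_of_nonneg (by linarith) hEt)).1 h3
  have h5 : I = ((c : ℝ≥0∞) ^ q)⁻¹ * ((c : ℝ≥0∞) ^ q * I) := by
    rw [← mul_assoc, ENNReal.inv_mul_cancel hc' hct, one_mul]
  rw [h5, ENNReal.coe_mul, ENNReal.coe_inv (NNReal.rpow_pos hc).ne', mul_assoc,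
    ENNReal.coe_rpow_of_nonneg _ (by linarith)]
  refine mul_le_mul' le_rfl (h4.trans (le_of_eq ?_))
  simp only [ENNReal.coe_mul, ENNReal.coe_rpow_of_nonneg _ (by linarith : 0 ≤ q),
    ENNReal.coe_rpow_of_nonneg _ (by linarith : 0 ≤ q - 1)]
  rfl

end

end BandLimited

end

/-! ### The equivalence of the four properties -/

theorem mainTheorem1 (n : ℕ) (p : ℝ≥0∞) [Fact (1 ≤ p)] (hp : 1 < p) (hp' : p ≠ ∞)
    (K : Set (BandLimited.Rn n)) (hK : BandLimited.IsRegularCompact K)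
    (hfund : IsAddFundamentalDomain (BandLimited.twoPiLattice n) K volume) :
    List.TFAE
      [BandLimited.IsFLpMultiplier (K.indicator (fun _ => (1 : ℂ))) p,
       BandLimited.IsStableSampling (BandLimited.intLattice n : Set (BandLimited.Rn n)) K p,
       BandLimited.IsStableInterpolation (BandLimited.intLattice n : Set (BandLimited.Rn n)) K p,
       BandLimited.SamplingIsIsomorphism
         (BandLimited.intLattice n : Set (BandLimited.Rn n)) K p] := by
  have hKc := hK.isCompact
  have hD := BandLimited.spectralDomain_normalize hK hfund
  have hmul : BandLimited.IsFLpMultiplier (K.indicator (fun _ => (1 : ℂ))) p ↔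
      ∃ C, BandLimited.KerBound (BandLimited.normalize K) p.toReal C := by
    rw [BandLimited.isFLpMultiplier_indicator_iff hKc]
    exact ⟨fun ⟨_, h⟩ => BandLimited.KerBound.of_multiplierBound hD.isCompact hp hp' h,
      fun ⟨_, h⟩ => ⟨_, BandLimited.MultiplierBound.of_kerBound hD.isCompact hp hp' h⟩⟩
  tfae_have 1 → 4 := fun h => by
    obtain ⟨C, hC⟩ := hmul.1 h
    exact hC.samplingIsIsomorphism hKc hD hp hp'
  tfae_have 4 → 2 := fun h => h.isStableSampling hp hp'
  tfae_have 4 → 3 := fun h => h.isStableInterpolation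
  tfae_have 2 → 1 := fun h => hmul.2 (h.exists_kerBound hKc hD hp hp')
  tfae_have 3 → 1 := fun h => hmul.2 (h.exists_kerBound hKc hD hp hp')
  tfae_finish
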